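/- Let $m\ge 2$ and let $\Omega\subset\mathbb R^m$ be a bounded domain with Lipschitz boundary. **Energies.** Let $\Psi$ be the set of nondecreasing convex $\psi:[0,\infty)\to[0,\infty)$ with $\psi(0)=0$ and $\psi^\infty:=\lim_{t\to\infty}\psi(t)/t\in(0,\infty)$ for which there are $K,C>0$ such that, for all $s,t>0$, $y\in\partial\psi(t)$, $z\in\partial\psi(s)$, $$(y-z)(t-s)\le 0 \ \text{ if } \min\{s,t\}\ge K,\qquad (y-z)(t-s)\le C|t-s|^2\ \text{ if } \min\{s,t\}<K .$$ For $\psi\in\Psi$ and $u\in BV(\Omega)$, with $Du=\nabla u\,\mathcal L^m+D^su$ the Lebesgue decomposition of the distributional gradient, put $$TV_\psi(u)=\int_\Omega\psi(\|\nabla u\|)\,dx+\psi^\infty|D^su|(\Omega),$$ and $TV_\psi(u)=\infty$ for $u\in L^1(\Omega)\setminus BV(\Omega)$. Norms on $\mathbb R^m$ are Euclidean. **Comparison constants.** Let $\mathcal F(\Omega,U)$, for $U\subset\Omega$ open, be the set of bijections $\gamma:\Omega\to\Omega$ that are Lipschitz together with $\gamma^{-1}$ and satisfy $\gamma(x)=x$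 for $x\in\Omega\setminus U$; let $\gamma_\#u=u\circ\gamma^{-1}$. Let $\nabla$ denote the transposed Jacobian matrix, $J_\gamma=|\det\nabla\gamma|$, $A_\gamma(x)=\nabla\gamma^{-1}(\gamma(x))$, $L_\gamma=J_\gamma A_\gamma$. With essential suprema over $x\in\Omega$, put $$G_{\gamma_1,\gamma_2}=\max\Bigl\{0,\ \sup_{x\in\Omega,\,\|v\|=1}\bigl(\|L_{\gamma_1}(x)v\|+\|L_{\gamma_2}(x)v\|-2\bigr)\Bigr\},\quad J_{\gamma_1,\gamma_2}=\sup_{x\in\Omega}|J_{\gamma_1}(x)+J_{\gamma_2}(x)-2|,$$ $$D_\gamma=\sup_{x\in\Omega}\|A_\gamma(x)-I\|,\qquad T_{\gamma_1,\gamma_2}=G_{\gamma_1,\gamma_2}+J_{\gamma_1,\gamma_2}+D_{\gamma_1}^2+D_{\gamma_2}^2 .$$ **Claim.** Every Huber energy $\psi(t)=\frac{\eta}{2}t^2$ for $0\le t<1/\eta$, $\psi(t)=t-\frac1{2\eta}$ for $t\ge 1/\eta$, with $\eta>0$, belongs to $\Psi$. For every $\psi\in\Psi$ the functional $R=TV_\psi$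 has the following properties. 1. (Admissibility.) $R$ is a convex functional on $L^1(\Omega)$, it is lower semicontinuous with respect to weak* convergence in $BV(\Omega)$, and there is $C>0$ with $|Du|(\Omega)\le C(1+\|u\|_{L^1(\Omega)}+R(u))$ for all $u\in L^1(\Omega)$, where $|Du|(\Omega)\in[0,\infty]$ is the total variation of $u$. 2. (Double-Lipschitz comparability.) There is $R^a\ge 0$ such that for all $u\in BV(\Omega)$, open $U\subset\Omega$ and $\gamma_1,\gamma_2\in\mathcal F(\Omega,U)$ with $T_{\gamma_1,\gamma_2}<1$, the numbers $R(u)$, $R(\gamma_{1\#}u)$, $R(\gamma_{2\#}u)$ are finite and $$R(\gamma_{1\#}u)+R(\gamma_{2\#}u)-2R(u)\le R^a\,T_{\gamma_1,\gamma_2}\,|Du|(\overline U).$$ 3. (Separable double-Lipschitz comparability.) There are $R^a,R^s\ge0$ such that for all $u,U,\gamma_1,\gamma_2$ as in 2 and every Lipschitz $(m-1)$-graph $\Gamma\subset\mathbb R^m$ (a set $\{v+g(v)z: v\in V\}$ with $\|z\|=1$, $V\subset z^\perp$ open in $z^\perp$, $g:V\to\mathbb R$ Lipschitz) $$R(\gamma_{1\#}u)+R(\gamma_{2\#}u)-2R(u)\le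 R^a\,T_{\gamma_1,\gamma_2}\,|Du|(\overline U\setminus\Gamma)+R^s\bigl(|D\gamma_{1\#}u|(\gamma_1(\Gamma\cap\Omega))+|D\gamma_{2\#}u|(\gamma_2(\Gamma\cap\Omega))-2|Du|(\Gamma)\bigr),$$ with the measures $|Du|$, $|D\gamma_{i\#}u|$ living on $\Omega$. 4. (Boundedness of solutions.) Let $\phi:\mathbb R\to[0,\infty]$ be convex, lower semicontinuous and even with $\phi(0)=0$, $\phi(t)>0$ for $t\ne0$, and $\|w\|_{L^1(\Omega)}\le C(1+\int_\Omega\phi(w)\,dx)$ for some $C>0$ and all $w\in L^1(\Omega)$. Let $f\in L^1(\Omega)$, and let $u\in L^1(\Omega)$ minimise $v\mapsto\int_\Omega\phi(f-v)\,dx+R(v)$ over $L^1(\Omega)$ with finite minimum. Then $\|u\|_{L^\infty(\Omega)}\le\|f\|_{L^\infty(\Omega)}$ (with values in $[0,\infty]$). -/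

import Mathlib

open MeasureTheory Set Filter Topology
open scoped NNReal ENNReal ContDiff

noncomputable section

namespace BVReg

/-- Euclidean space of dimension `m`. -/
abbrev Rn (m : ℕ) : Type := EuclideanSpace ℝ (Fin m)

/-! ### Functions of bounded variation -/

/-- The (finite, vector-valued) measure `μ` on `Ω` is the distributional gradient of `u`:
`∫_Ω u ∂ᵢφ dx = - ∫_Ω φ dμᵢ` for all real `φ ∈ C_c^∞(Ω)` and all `i`. Measures on `Ω` are
represented by measures on the whole space that live on `Ω`. -/
def IsDistribGradient {m : ℕ} (Ω : Set (Rn m)) (u : Rn m → ℝ)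
    (μ : VectorMeasure (Rn m) (Rn m)) : Prop :=
  μ.variation Ωᶜ = 0 ∧
    ∀ φ : Rn m → ℝ, ContDiff ℝ ∞ φ → HasCompactSupport φ → tsupport φ ⊆ Ω →
      ∫ x in Ω, u x • gradient φ x = - ∫ᵛ x, φ x ∂•μ

/-- `u ∈ BV(Ω)`. Functions on `Ω` are represented by functions on the whole space, whose values
outside `Ω` play no role. -/
def IsBV {m : ℕ} (Ω : Set (Rn m)) (u : Rn m → ℝ) : Prop :=
  IntegrableOn u Ω ∧ ∃ μ, IsDistribGradient Ω u μ

open Classical in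
/-- The distributional gradient `Du` of `u ∈ BV(Ω)`. -/
def distribGradient {m : ℕ} (Ω : Set (Rn m)) (u : Rn m → ℝ) : VectorMeasure (Rn m) (Rn m) :=
  if h : ∃ μ, IsDistribGradient Ω u μ then h.choose else 0

/-- The total variation measure `|Du|`, for the Euclidean norm. -/
def absD {m : ℕ} (Ω : Set (Rn m)) (u : Rn m → ℝ) : Measure (Rn m) :=
  (distribGradient Ω u).variation

/-- The density `∇u` of the absolutely continuous part of `Du`, computed by components. -/
def approxGradient {m : ℕ} (Ω : Set (Rn m)) (u : Rn m → ℝ) (x : Rn m) : Rn m :=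
  WithLp.toLp 2 fun i =>
    SignedMeasure.rnDeriv
      ((distribGradient Ω u).mapRange (EuclideanSpace.proj (𝕜 := ℝ) i).toLinearMap.toAddMonoidHom
        (EuclideanSpace.proj (𝕜 := ℝ) i).continuous) volume x

/-- The singular part `Dˢu = Du - ∇u ℒᵐ`. -/
def singularGradient {m : ℕ} (Ω : Set (Rn m)) (u : Rn m → ℝ) : VectorMeasure (Rn m) (Rn m) :=
  distribGradient Ω u - (volume : Measure (Rn m)).withDensityᵥ (approxGradient Ω u)

/-- The total variation norm of the distribution `Du` for `u ∈ L¹(Ω)`, as the supremum of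
`∫_Ω u div φ dx` over `φ ∈ C_c^∞(Ω; ℝᵐ)` with `‖φ(x)‖ ≤ 1` for all `x`; it may be `∞`. -/
def totalVariation {m : ℕ} (Ω : Set (Rn m)) (u : Rn m → ℝ) : ℝ≥0∞ :=
  ⨆ (φ : Rn m → Rn m) (_ : ContDiff ℝ ∞ φ) (_ : HasCompactSupport φ) (_ : tsupport φ ⊆ Ω)
    (_ : ∀ x, ‖φ x‖ ≤ 1),
    ENNReal.ofReal (∫ x in Ω, u x * LinearMap.trace ℝ (Rn m) (fderiv ℝ φ x).toLinearMap)

/-- The norm of `L¹(Ω)`. -/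
def normL1 {m : ℕ} (Ω : Set (Rn m)) (u : Rn m → ℝ) : ℝ≥0∞ := ∫⁻ x in Ω, ‖u x‖ₑ

/-- Weak* convergence in `BV(Ω)`: strong convergence in `L¹(Ω)`, and weak* convergence of the
gradients, tested with `C₀(Ω)`, the continuous functions on `Ω` that vanish at the boundary and
at infinity. -/
def TendstoWeakStarBV {m : ℕ} (Ω : Set (Rn m)) (u : ℕ → Rn m → ℝ) (u₀ : Rn m → ℝ) : Prop :=
  (∀ k, IsBV Ω (u k)) ∧ IsBV Ω u₀ ∧
    Tendsto (fun k => normL1 Ω (u k - u₀)) atTop (𝓝 0) ∧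
    ∀ φ : ZeroAtInftyContinuousMap (Rn m) ℝ, (∀ x ∉ Ω, φ x = 0) →
      Tendsto (fun k => ∫ᵛ x, φ x ∂•(distribGradient Ω (u k))) atTop
        (𝓝 (∫ᵛ x, φ x ∂•(distribGradient Ω u₀)))

/-! ### Domains with Lipschitz boundary, Lipschitz graphs -/

/-- `Ω` is a bounded domain (nonempty, open, connected) with Lipschitz boundary: near each boundary
point, in suitable orthogonal coordinates, it is the open region above the graph of a Lipschitz
function of the coordinates orthogonal to `z`. -/
structure IsBoundedLipschitzDomain {m : ℕ} (Ω : Set (Rn m)) : Prop where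
  isOpen : IsOpen Ω
  isConnected : IsConnected Ω
  isBounded : Bornology.IsBounded Ω
  boundary : ∀ x ∈ frontier Ω, ∃ r > 0, ∃ z : Rn m, ‖z‖ = 1 ∧
    ∃ (K : ℝ≥0) (g : Rn m → ℝ), LipschitzWith K g ∧
      Ω ∩ Metric.ball x r = {y | g (y - inner ℝ z y • z) < inner ℝ z y} ∩ Metric.ball x r

/-- `Γ` is a Lipschitz `(m-1)`-graph: `Γ = {v + g(v) z | v ∈ V}` for a unit vector `z`, an open
subset `V` of `z^⊥` and a Lipschitz function `g` on `V`. -/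
def IsLipschitzGraph {m : ℕ} (Γ : Set (Rn m)) : Prop :=
  ∃ z : Rn m, ‖z‖ = 1 ∧
    ∃ (V : Set (ℝ ∙ z)ᗮ) (K : ℝ≥0) (g : (ℝ ∙ z)ᗮ → ℝ), IsOpen V ∧ LipschitzOnWith K g V ∧
      Γ = (fun v : (ℝ ∙ z)ᗮ => (v : Rn m) + g v • z) '' V

/-! ### Bi-Lipschitz transformations and comparison constants -/

/-- The bijective transformations of `Ω` that are Lipschitz together with their inverse. (The Lusin
`N`-property holds automatically.) Only the values on `Ω` of the two maps matter. -/
structure BiLipTransf {m : ℕ} (Ω : Set (Rn m)) where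
  /-- the transformation -/
  map : Rn m → Rn m
  /-- its inverse -/
  inv : Rn m → Rn m
  mapsTo : MapsTo map Ω Ω
  mapsTo_inv : MapsTo inv Ω Ω
  invOn : InvOn inv map Ω Ω
  lipschitz : ∃ K : ℝ≥0, LipschitzOnWith K map Ω
  lipschitz_inv : ∃ K : ℝ≥0, LipschitzOnWith K inv Ω

namespace BiLipTransf

variable {m : ℕ} {Ω : Set (Rn m)}

/-- `γ(x) = x` for `x ∈ Ω ∖ U`. -/
def IsIdOff (γ : BiLipTransf Ω) (U : Set (Rn m)) : Prop := ∀ x ∈ Ω \ U, γ.map x = x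

/-- The pushforward `u ∘ γ⁻¹`. -/
def push (γ : BiLipTransf Ω) (u : Rn m → ℝ) : Rn m → ℝ := u ∘ γ.inv

/-- `∇γ⁻¹(γ(x))`, where the gradient has components as columns, that is, `∇` denotes the transpose of
the Jacobian matrix (so that `∇(u ∘ γ⁻¹) = ∇γ⁻¹ (∇u ∘ γ⁻¹)`). -/
def gradInv (γ : BiLipTransf Ω) (x : Rn m) : Rn m →L[ℝ] Rn m :=
  ContinuousLinearMap.adjoint (fderiv ℝ γ.inv (γ.map x))

/-- The Jacobian determinant `√(det (L* L)) = |det L|` of `γ` at `x`. -/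
def jac (γ : BiLipTransf Ω) (x : Rn m) : ℝ := |(fderiv ℝ γ.map x).det|

/-- `∇γ⁻¹(γ(x))` times the Jacobian determinant of `γ` at `x`. -/
def lipJac (γ : BiLipTransf Ω) (x : Rn m) : Rn m →L[ℝ] Rn m := γ.jac x • γ.gradInv x

/-- `sup_{x ∈ Ω, ‖v‖ = 1} ‖L₁(x) v‖ + ‖L₂(x) v‖ - 2‖v‖`, or `0` if that is negative. As gradients
of Lipschitz maps exist almost everywhere, suprema over `x` are essential suprema. -/
def compG (γ₁ γ₂ : BiLipTransf Ω) : ℝ≥0∞ :=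
  essSup (fun x => ⨆ (v : Rn m) (_ : ‖v‖ = 1),
    ENNReal.ofReal (‖γ₁.lipJac x v‖ + ‖γ₂.lipJac x v‖ - 2 * ‖v‖)) (volume.restrict Ω)

/-- `sup_{x ∈ Ω} |J₁(x) + J₂(x) - 2|` for the Jacobian determinants `J₁`, `J₂`. -/
def compJ (γ₁ γ₂ : BiLipTransf Ω) : ℝ≥0∞ :=
  essSup (fun x => ENNReal.ofReal |γ₁.jac x + γ₂.jac x - 2|) (volume.restrict Ω)

/-- The distance to the identity, `sup_{x ∈ Ω} ‖∇γ⁻¹(γ(x)) - I‖`. -/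
def distId (γ : BiLipTransf Ω) : ℝ≥0∞ :=
  essSup (fun x => ‖γ.gradInv x - ContinuousLinearMap.id ℝ (Rn m)‖ₑ) (volume.restrict Ω)

/-- The double-Lipschitz comparison constant. -/
def compT (γ₁ γ₂ : BiLipTransf Ω) : ℝ≥0∞ :=
  compG γ₁ γ₂ + compJ γ₁ γ₂ + γ₁.distId ^ 2 + γ₂.distId ^ 2

end BiLipTransf

/-! ### Properties of regularisation functionals on `L¹(Ω)` -/

/-- `R` is an admissible regularisation functional on `L¹(Ω)`. The first field says that `R` is
well defined on classes of functions that agree almost everywhere on `Ω`. -/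
structure IsAdmissible {m : ℕ} (Ω : Set (Rn m)) (R : (Rn m → ℝ) → ℝ≥0∞) : Prop where
  congr : ∀ u v, IntegrableOn u Ω → u =ᵐ[volume.restrict Ω] v → R u = R v
  convex : ∀ u v, IntegrableOn u Ω → IntegrableOn v Ω → ∀ a b : ℝ, 0 ≤ a → 0 ≤ b → a + b = 1 →
    R (a • u + b • v) ≤ ENNReal.ofReal a * R u + ENNReal.ofReal b * R v
  lsc : ∀ (u : ℕ → Rn m → ℝ) (u₀ : Rn m → ℝ), TendstoWeakStarBV Ω u u₀ →
    R u₀ ≤ liminf (fun k => R (u k)) atTop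
  coercive : ∃ C : ℝ, 0 < C ∧ ∀ u, IntegrableOn u Ω →
    totalVariation Ω u ≤ ENNReal.ofReal C * (1 + normL1 Ω u + R u)

/-- `R` is double-Lipschitz comparable. That `R` is finite on the functions involved is part of the
claim, as the difference would make no sense otherwise. -/
def IsDoubleLipschitzComparable {m : ℕ} (Ω : Set (Rn m)) (R : (Rn m → ℝ) → ℝ≥0∞) : Prop :=
  ∃ Ra : ℝ, 0 ≤ Ra ∧
    ∀ u, IsBV Ω u → ∀ U, IsOpen U → U ⊆ Ω →
    ∀ γ₁ γ₂ : BiLipTransf Ω, γ₁.IsIdOff U → γ₂.IsIdOff U → γ₁.compT γ₂ < 1 →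
      (R u ≠ ⊤ ∧ R (γ₁.push u) ≠ ⊤ ∧ R (γ₂.push u) ≠ ⊤) ∧
      (R (γ₁.push u)).toReal + (R (γ₂.push u)).toReal - 2 * (R u).toReal
        ≤ Ra * (γ₁.compT γ₂).toReal * (absD Ω u).real (closure U)

/-- `R` is separably double-Lipschitz comparable. -/
def IsSeparablyDoubleLipschitzComparable {m : ℕ} (Ω : Set (Rn m)) (R : (Rn m → ℝ) → ℝ≥0∞) :
    Prop :=
  ∃ Ra Rs : ℝ, 0 ≤ Ra ∧ 0 ≤ Rs ∧
    ∀ u, IsBV Ω u → ∀ U, IsOpen U → U ⊆ Ω →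
    ∀ γ₁ γ₂ : BiLipTransf Ω, γ₁.IsIdOff U → γ₂.IsIdOff U → γ₁.compT γ₂ < 1 →
    ∀ Γ, IsLipschitzGraph Γ →
      (R u ≠ ⊤ ∧ R (γ₁.push u) ≠ ⊤ ∧ R (γ₂.push u) ≠ ⊤) ∧
      (R (γ₁.push u)).toReal + (R (γ₂.push u)).toReal - 2 * (R u).toReal
        ≤ Ra * (γ₁.compT γ₂).toReal * (absD Ω u).real (closure U \ Γ)
          + Rs * ((absD Ω (γ₁.push u)).real (γ₁.map '' (Γ ∩ Ω))
            + (absD Ω (γ₂.push u)).real (γ₂.map '' (Γ ∩ Ω))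
            - 2 * (absD Ω u).real Γ)

/-! ### Convex energies and their functionals -/

/-- `z` is a subgradient at `t` of the function `ψ` on `[0, ∞)`. -/
def IsSubgradient (ψ : ℝ → ℝ) (t z : ℝ) : Prop := ∀ s, 0 ≤ s → ψ t + z * (s - t) ≤ ψ s

/-- The class `Ψ` of convex energies `ψ : [0, ∞) → [0, ∞)`. The condition on subgradients is imposed
at interior points only: seen on the half-line, the subdifferential at `0` is unbounded below. -/
structure IsConvexEnergy (ψ : ℝ → ℝ) : Prop where
  mono : MonotoneOn ψ (Ici 0)
  convex : ConvexOn ℝ (Ici 0) ψ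
  zero : ψ 0 = 0
  recession : ∃ l : ℝ, 0 < l ∧ Tendsto (fun t => ψ t / t) atTop (𝓝 l)
  subgradient : ∃ K C : ℝ, 0 < K ∧ 0 < C ∧ ∀ t s : ℝ, 0 < t → 0 < s →
    ∀ y z : ℝ, IsSubgradient ψ t y → IsSubgradient ψ s z →
      (K ≤ min t s → (y - z) * (t - s) ≤ 0) ∧
      (min t s < K → (y - z) * (t - s) ≤ C * |t - s| ^ 2)

/-- `ψ^∞ = lim_{t → ∞} ψ(t) / t`. -/
def recession (ψ : ℝ → ℝ) : ℝ := limUnder atTop fun t => ψ t / t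

open Classical in
/-- `TV_ψ(u) = ∫_Ω ψ(‖∇u‖) dx + ψ^∞ |Dˢu|(Ω)` for `u ∈ BV(Ω)`, and `∞` for other `u ∈ L¹(Ω)`. -/
def TV {m : ℕ} (Ω : Set (Rn m)) (ψ : ℝ → ℝ) (u : Rn m → ℝ) : ℝ≥0∞ :=
  if IsBV Ω u then
    (∫⁻ x in Ω, ENNReal.ofReal (ψ ‖approxGradient Ω u x‖))
      + ENNReal.ofReal (recession ψ) * (singularGradient Ω u).variation Ω
  else ⊤

/-- The Huber energy with parameter `η`. -/
def huber (η t : ℝ) : ℝ := if 1 / η ≤ t then t - 1 / (2 * η) else η / 2 * t ^ 2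

/-! ### The variational problem -/

/-- `φ : ℝ → [0, ∞]` is an admissible fidelity function on `Ω`. -/
structure IsAdmissibleFidelity {m : ℕ} (Ω : Set (Rn m)) (φ : ℝ → ℝ≥0∞) : Prop where
  convex : ∀ s t a b : ℝ, 0 ≤ a → 0 ≤ b → a + b = 1 →
    φ (a * s + b * t) ≤ ENNReal.ofReal a * φ s + ENNReal.ofReal b * φ t
  lsc : LowerSemicontinuous φ
  zero : φ 0 = 0
  even : ∀ t, φ (-t) = φ t
  coercive : ∃ C : ℝ, 0 < C ∧ ∀ u : Rn m → ℝ, IntegrableOn u Ω →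
    normL1 Ω u ≤ ENNReal.ofReal C * ((∫⁻ x in Ω, φ (u x)) + 1)

/-- The objective `∫_Ω φ(f(x) - u(x)) dx + R(u)`. -/
def objective {m : ℕ} (Ω : Set (Rn m)) (R : (Rn m → ℝ) → ℝ≥0∞) (φ : ℝ → ℝ≥0∞)
    (f u : Rn m → ℝ) : ℝ≥0∞ :=
  (∫⁻ x in Ω, φ (f x - u x)) + R u

/-- `u` solves `min_{u ∈ L¹(Ω)} ∫_Ω φ(f(x) - u(x)) dx + R(u)`, and the minimum is finite. -/
def IsSolution {m : ℕ} (Ω : Set (Rn m)) (R : (Rn m → ℝ) → ℝ≥0∞) (φ : ℝ → ℝ≥0∞)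
    (f u : Rn m → ℝ) : Prop :=
  IntegrableOn u Ω ∧ objective Ω R φ f u ≠ ⊤ ∧
    ∀ v, IntegrableOn v Ω → objective Ω R φ f u ≤ objective Ω R φ f v

end BVReg

end

open BVReg

namespace BVReg

/-! ### Convex energies -/

/-! Everything rests on convex duality. Let c be the conjugate of ψ. On an open set W ⊆ Ω, the
energy ψ(‖∇u‖) dx + ψ^∞ |Dˢu| is the supremum of -∫ u div φ - ∫_W c(‖φ‖) over test fields φ on W
with ‖φ‖ ≤ ψ^∞. Young's inequality gives one direction (`IsBV.le_energyMeasure`); approximating the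
optimal field by test fields gives the other (`IsBV.energyMeasure_le`). These expressions are affine
and L¹-continuous in u, which yields convexity and lower semicontinuity. Coercivity comes from ψ^∞ t
≤ ψ(t) + const.

Comparability starts from an inequality between numbers, `IsConvexEnergy.exists_comparison`. For
smooth v, a change of variables turns the energy of v ∘ γ⁻¹ into the integral of J_γ ψ(‖A_γ ∇v‖).
Expanding ψ at ‖∇v‖ for both transformations, the slope term is controlled by G, the change of
volume by J, and the remainder is quadratic, hence the squares of D. The remainder has linear growth
in ‖∇v‖ because ψ is affine beyond some threshold (`IsConvexEnergy.exists_affine`).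

The passage to BV functions uses mollification. By duality again, the energy density of the
mollified function is at most the kernel average of the energy measure of u
(`IsBV.energy_gradient_mollify_le`). This needs balls inside Ω, but the test fields have compact
support, so the behaviour at the boundary never matters. `AreComparable.test_le` bounds pairs of
test fields; suprema give open sets, and outer regularity gives all subsets of Ω
(`AreComparable.energyMeasure_le`). That the transformed functions are in BV at all follows from a
Riesz representation argument (`isBV_of_abs_le`).

Taking B = Ω proves comparability. For the separable version B = Ω ∖ Γ; since Γ and its images are
Lebesgue null, the energy on them is exactly ψ^∞ times the total variation measure, so R^s = ψ^∞
works.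

The same comparison theorem, with both transformations equal to the identity and a 1-Lipschitz
function composed on the left, shows that truncation does not increase the energy. Truncating a
minimiser at level ‖f‖_∞ strictly lowers the fidelity unless nothing is cut off. -/

lemma exists_isSubgradient {ψ : ℝ → ℝ} (hψ : ConvexOn ℝ (Ici 0) ψ) {t : ℝ} (ht : 0 < t) :
    ∃ y, IsSubgradient ψ t y := by
  have hint : t ∈ interior (Ici (0 : ℝ)) := by rw [interior_Ici]; exact ht
  refine ⟨derivWithin ψ (Ioi t) t, fun s hs => ?_⟩
  rcases lt_trichotomy s t with h | h | h
  · have h1 := hψ.slope_le_leftDeriv_of_mem_interior (mem_Ici.2 hs) hint h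
    have h2 := hψ.leftDeriv_le_rightDeriv_of_mem_interior hint
    have h3 := h1.trans h2
    rw [slope_def_field, div_le_iff₀ (by linarith)] at h3
    linarith
  · subst h; simp
  · have h1 := hψ.rightDeriv_le_slope_of_mem_interior hint (mem_Ici.2 hs) h
    rw [slope_def_field, le_div_iff₀ (by linarith)] at h1
    linarith

lemma IsSubgradient.mono {ψ : ℝ → ℝ} {s t y z : ℝ} (hs : 0 ≤ s) (ht : 0 ≤ t)
    (hy : IsSubgradient ψ t y) (hz : IsSubgradient ψ s z) (hts : t < s) : y ≤ z := by
  have h1 := hy s hs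
  have h2 := hz t ht
  nlinarith

/-- `c` is the convex conjugate of `ψ` on `[0, r]`, and `p` selects subgradients of `ψ`. -/
structure IsDualPair (ψ c p : ℝ → ℝ) (r : ℝ) : Prop where
  mono : Monotone p
  nonneg : ∀ t, 0 ≤ p t
  le : ∀ t, p t ≤ r
  continuous_conj : Continuous c
  conj_zero : c 0 = 0
  conj_nonneg : ∀ s, 0 ≤ c s
  young : ∀ s t, s ≤ r → 0 ≤ t → s * t - c s ≤ ψ t
  young_eq : ∀ t, 0 ≤ t → p t * t - c (p t) = ψ t

lemma IsConvexEnergy.nonneg {ψ : ℝ → ℝ} (h : IsConvexEnergy ψ) {t : ℝ} (ht : 0 ≤ t) : 0 ≤ ψ t := by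
  have := h.mono (mem_Ici.2 le_rfl) (mem_Ici.2 ht) ht
  rwa [h.zero] at this

lemma IsConvexEnergy.tendsto_recession {ψ : ℝ → ℝ} (h : IsConvexEnergy ψ) :
    Tendsto (fun t => ψ t / t) atTop (𝓝 (BVReg.recession ψ)) := by
  obtain ⟨l, -, hl⟩ := h.recession
  rwa [BVReg.recession, hl.limUnder_eq]

lemma IsConvexEnergy.recession_pos {ψ : ℝ → ℝ} (h : IsConvexEnergy ψ) : 0 < BVReg.recession ψ := by
  obtain ⟨l, hl0, hl⟩ := h.recession
  rwa [BVReg.recession, hl.limUnder_eq]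

lemma IsSubgradient.nonneg_of_energy {ψ : ℝ → ℝ} (h : IsConvexEnergy ψ) {t y : ℝ} (ht : 0 < t)
    (hy : IsSubgradient ψ t y) : 0 ≤ y := by
  have h1 := hy (t / 2) (by linarith)
  have h2 := h.mono (mem_Ici.2 (by linarith : (0 : ℝ) ≤ t / 2)) (mem_Ici.2 ht.le)
    (by linarith : t / 2 ≤ t)
  nlinarith

/-- Divide the subgradient inequality by s and let s → ∞. -/
lemma IsSubgradient.le_recession {ψ : ℝ → ℝ} (h : IsConvexEnergy ψ) {t y : ℝ}
    (hy : IsSubgradient ψ t y) : y ≤ BVReg.recession ψ := by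
  have h1 : Tendsto (fun s : ℝ => (ψ t - y * t) * s⁻¹ + y) atTop
      (𝓝 ((ψ t - y * t) * 0 + y)) :=
    (tendsto_inv_atTop_zero.const_mul _).add_const _
  rw [mul_zero, zero_add] at h1
  refine le_of_tendsto_of_tendsto h1 h.tendsto_recession ?_
  filter_upwards [eventually_gt_atTop 0] with s hs
  rw [le_div_iff₀ hs]
  have := hy s hs.le
  field_simp
  linarith

/-- Beyond some threshold `K` a convex energy is affine, with slope `BVReg.recession ψ`. -/
lemma IsConvexEnergy.exists_affine {ψ : ℝ → ℝ} (h : IsConvexEnergy ψ) :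
    ∃ K C : ℝ, 0 < K ∧ 0 < C ∧
      (∀ t y, K ≤ t → IsSubgradient ψ t y → y = BVReg.recession ψ) ∧
      (∀ t, K ≤ t → ψ t = ψ K + BVReg.recession ψ * (t - K)) ∧
      ∀ s t y z, 0 < s → 0 < t → IsSubgradient ψ t y → IsSubgradient ψ s z →
        (y - z) * (t - s) ≤ C * |t - s| ^ 2 := by
  obtain ⟨K, C, hK, hC, hsub⟩ := h.subgradient
  have key : ∀ s t y z, 0 < s → 0 < t → IsSubgradient ψ t y → IsSubgradient ψ s z →
        (y - z) * (t - s) ≤ C * |t - s| ^ 2 := by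
    intro s t y z hs ht hy hz
    obtain ⟨h1, h2⟩ := hsub t s ht hs y z hy hz
    rcases le_or_gt K (min t s) with hm | hm
    · exact (h1 hm).trans (by positivity)
    · exact h2 hm
  -- Subgradients increase, while the first condition of the class gives the reverse order beyond K.
  have eqsub : ∀ s t y z, K ≤ t → t < s → IsSubgradient ψ t y → IsSubgradient ψ s z → y = z := by
    intro s t y z ht hts hy hz
    have ht0 : 0 < t := by linarith
    have h1 := (hsub t s ht0 (by linarith) y z hy hz).1 (le_min ht (by linarith))
    have h2 := hy.mono (by linarith) ht0.le hz hts
    nlinarith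
  have aff : ∀ s t y, K ≤ t → t < s → IsSubgradient ψ t y → ψ s = ψ t + y * (s - t) := by
    intro s t y ht hts hy
    obtain ⟨z, hz⟩ := exists_isSubgradient h.convex (t := s) (by linarith)
    have hyz := eqsub s t y z ht hts hy hz
    subst hyz
    have h1 := hy s (by linarith)
    have h2 := hz t (by linarith)
    linarith
  -- Beyond t the function is affine with slope y, so ψ(s)/s tends to y.
  have eqr : ∀ t y, K ≤ t → IsSubgradient ψ t y → y = BVReg.recession ψ := by
    intro t y ht hy
    have h1 : Tendsto (fun s : ℝ => (ψ t - y * t) * s⁻¹ + y) atTop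
      (𝓝 ((ψ t - y * t) * 0 + y)) :=
      (tendsto_inv_atTop_zero.const_mul _).add_const _
    rw [mul_zero, zero_add] at h1
    refine tendsto_nhds_unique (h1.congr' ?_) h.tendsto_recession
    filter_upwards [eventually_gt_atTop t] with s hs
    have : 0 < s := by linarith
    rw [aff s t y ht hs hy]
    field_simp
    ring
  refine ⟨K, C, hK, hC, eqr, fun t ht => ?_, key⟩
  rcases ht.eq_or_lt with rfl | ht
  · simp
  · obtain ⟨y, hy⟩ := exists_isSubgradient h.convex hK
    rw [aff t K y le_rfl ht hy, eqr K y le_rfl hy]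

lemma IsConvexEnergy.le_recession_mul {ψ : ℝ → ℝ} (h : IsConvexEnergy ψ) {t : ℝ} (ht : 0 ≤ t) :
    ψ t ≤ BVReg.recession ψ * t := by
  rcases ht.eq_or_lt with rfl | ht
  · simp [h.zero]
  · obtain ⟨y, hy⟩ := exists_isSubgradient h.convex ht
    have h1 := hy 0 le_rfl
    have h2 := hy.le_recession h
    rw [h.zero] at h1
    nlinarith

/-- Duality for measures needs a monotone, hence Borel, selection of subgradients with values in [0,
ψ^∞], and a conjugate that stays continuous up to the end point ψ^∞. The latter is available because
ψ is eventually affine. -/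
theorem IsConvexEnergy.exists_isDualPair {ψ : ℝ → ℝ} (h : IsConvexEnergy ψ) :
    ∃ c p, IsDualPair ψ c p (BVReg.recession ψ) := by
  classical
  obtain ⟨K, -, hK, -, -, haff, -⟩ := h.exists_affine
  -- The value 0 for t ≤ 0 keeps p monotone; at t = 0 equality in Young's inequality only needs c(0)
  -- = ψ(0) = 0.
  have hex : ∀ t : ℝ, ∃ y, (0 < t → IsSubgradient ψ t y) ∧ (t ≤ 0 → y = 0) := by
    intro t
    rcases lt_or_ge 0 t with ht | ht
    · obtain ⟨y, hy⟩ := exists_isSubgradient h.convex ht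
      exact ⟨y, fun _ => hy, fun h => absurd ht (not_lt.2 h)⟩
    · exact ⟨0, fun h => absurd ht (not_le.2 h), fun _ => rfl⟩
  choose p hp hp0 using hex
  -- The supremum over [0, K] is finite and K-Lipschitz in s. For s ≤ ψ^∞ nothing is lost: beyond K,
  -- st - ψ(t) has slope s - ψ^∞ ≤ 0.
  set c : ℝ → ℝ := fun s => sSup ((fun t => s * t - ψ t) '' Icc 0 K) with hc
  have hne : ∀ s, ((fun t => s * t - ψ t) '' Icc 0 K).Nonempty :=
    fun s => ⟨_, 0, ⟨le_rfl, hK.le⟩, rfl⟩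
  have hbdd : ∀ s, BddAbove ((fun t => s * t - ψ t) '' Icc 0 K) := by
    intro s
    refine ⟨|s| * K, ?_⟩
    rintro _ ⟨t, ht, rfl⟩
    have h1 := h.nonneg ht.1
    have h2 : s * t ≤ |s| * K :=
      (mul_le_mul_of_nonneg_right (le_abs_self s) ht.1).trans
        (mul_le_mul_of_nonneg_left ht.2 (abs_nonneg s))
    simp only
    linarith
  have hle : ∀ s t, 0 ≤ t → t ≤ K → s * t - ψ t ≤ c s :=
    fun s t h0 h1 => le_csSup (hbdd s) ⟨t, ⟨h0, h1⟩, rfl⟩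
  have hlip : ∀ s s', c s ≤ c s' + K * |s - s'| := by
    intro s s'
    refine csSup_le (hne s) ?_
    rintro _ ⟨t, ht, rfl⟩
    have h1 := hle s' t ht.1 ht.2
    have h2 : (s - s') * t ≤ |s - s'| * K :=
      (mul_le_mul_of_nonneg_right (le_abs_self _) ht.1).trans
        (mul_le_mul_of_nonneg_left ht.2 (abs_nonneg _))
    simp only
    linarith
  have hcz : c 0 = 0 := by
    apply le_antisymm
    · refine csSup_le (hne 0) ?_
      rintro _ ⟨t, ht, rfl⟩
      have := h.nonneg ht.1
      simp only
      linarith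
    · have := hle 0 0 le_rfl hK.le
      rw [h.zero] at this
      linarith
  have hyoung : ∀ s t, s ≤ BVReg.recession ψ → 0 ≤ t → s * t - c s ≤ ψ t := by
    intro s t hs ht
    rcases le_or_gt t K with htK | htK
    · linarith [hle s t ht htK]
    · have h1 := hle s K hK.le le_rfl
      rw [haff t htK.le]
      nlinarith
  refine ⟨c, p, ?_, ?_, ?_, ?_, hcz, ?_, hyoung, ?_⟩
  · intro s t hst
    rcases hst.eq_or_lt with rfl | hst
    · exact le_rfl
    rcases le_or_gt t 0 with ht | ht
    · rw [hp0 t ht, hp0 s (by linarith)]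
    rcases le_or_gt s 0 with hs | hs
    · rw [hp0 s hs]; exact (hp t ht).nonneg_of_energy h ht
    · exact (hp s hs).mono ht.le hs.le (hp t ht) hst
  · intro t
    rcases le_or_gt t 0 with ht | ht
    · rw [hp0 t ht]
    · exact (hp t ht).nonneg_of_energy h ht
  · intro t
    rcases le_or_gt t 0 with ht | ht
    · rw [hp0 t ht]; exact h.recession_pos.le
    · exact (hp t ht).le_recession h
  · refine (LipschitzWith.of_le_add_mul K.toNNReal (f := c) fun s s' => ?_).continuous
    rw [Real.coe_toNNReal _ hK.le, Real.dist_eq]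
    exact hlip s s'
  · intro s
    have := hle s 0 le_rfl hK.le
    rw [h.zero] at this
    linarith
  · intro t ht
    rcases ht.eq_or_lt with rfl | ht
    · rw [hp0 0 le_rfl, hcz, h.zero]; ring
    · apply le_antisymm (hyoung _ _ ((hp t ht).le_recession h) ht.le)
      have : c (p t) ≤ p t * t - ψ t := by
        refine csSup_le (hne _) ?_
        rintro _ ⟨τ, hτ, rfl⟩
        have := hp t ht τ hτ.1
        simp only
        linarith
      linarith

lemma IsConvexEnergy.exists_le_add {ψ : ℝ → ℝ} (h : IsConvexEnergy ψ) :
    ∃ c₀ : ℝ, 0 ≤ c₀ ∧ ∀ t, 0 ≤ t → BVReg.recession ψ * t ≤ ψ t + c₀ := by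
  obtain ⟨c, p, hd⟩ := h.exists_isDualPair
  exact ⟨c (BVReg.recession ψ), hd.conj_nonneg _, fun t ht => by linarith [hd.young _ t le_rfl ht]⟩

/-- Quadratic upper bound for the first-order expansion of `ψ`, of linear growth in `t`. -/
lemma IsConvexEnergy.exists_expansion {ψ : ℝ → ℝ} (h : IsConvexEnergy ψ) :
    ∃ C : ℝ, 0 ≤ C ∧ ∀ t, 0 < t → ∃ y, 0 ≤ y ∧ y ≤ BVReg.recession ψ ∧ 0 ≤ y * t - ψ t ∧
      ∀ a D, 0 ≤ a → |a - t| ≤ D * t →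
        ψ a ≤ ψ t + y * (a - t) + C * D ^ 2 * t := by
  obtain ⟨K, C, hK, hC, hr, haff, hlip⟩ := h.exists_affine
  have hr0 := h.recession_pos
  -- The first summand serves t ≤ 2K, where t² ≤ 2K t; the second serves t > 2K, where the error
  -- vanishes unless a < K.
  refine ⟨2 * K * C + 4 * BVReg.recession ψ, by positivity, fun t ht => ?_⟩
  obtain ⟨y, hy⟩ := exists_isSubgradient h.convex ht
  have hy0 := hy.nonneg_of_energy h ht
  have hyr := hy.le_recession h
  have hyt : 0 ≤ y * t - ψ t := by
    have := hy 0 le_rfl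
    rw [h.zero] at this
    linarith
  refine ⟨y, hy0, hyr, hyt, fun a D ha had => ?_⟩
  have hD : 0 ≤ D := by
    have := (abs_nonneg (a - t)).trans had
    by_contra hneg
    nlinarith
  -- A subgradient z at a gives ψ(a) ≤ ψ(t) + z(a - t), and replacing z by y costs at most C(a -
  -- t)². At a = 0, where no condition on subgradients is imposed, a small δ > 0 takes its place.
  have hquad : ψ a ≤ ψ t + y * (a - t) + C * (a - t) ^ 2 := by
    rcases ha.eq_or_lt with rfl | ha
    · have hcont : ∀ ε, 0 < ε → ψ 0 ≤ ψ t + y * (0 - t) + C * (0 - t) ^ 2 + ε := by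
        intro ε hε
        obtain ⟨δ, hδ0, hδt, hδ⟩ : ∃ δ, 0 < δ ∧ δ < t ∧ y * δ ≤ ε := by
          refine ⟨min (t / 2) (ε / (y + 1)), by positivity, ?_, ?_⟩
          · exact (min_le_left _ _).trans_lt (by linarith)
          · calc y * min (t / 2) (ε / (y + 1)) ≤ y * (ε / (y + 1)) :=
                  mul_le_mul_of_nonneg_left (min_le_right _ _) hy0
              _ ≤ ε := by
                  rw [mul_div_assoc', div_le_iff₀ (by linarith)]
                  nlinarith
        obtain ⟨z, hz⟩ := exists_isSubgradient h.convex hδ0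
        have h1 := hlip t δ z y ht hδ0 hz hy
        rw [sq_abs] at h1
        have h2 := hz t ht.le
        have h3 := h.nonneg hδ0.le
        rw [h.zero]
        nlinarith [mul_nonneg hC.le (mul_nonneg hδ0.le (by linarith : 0 ≤ 2 * t - δ))]
      exact le_of_forall_pos_le_add hcont
    · obtain ⟨z, hz⟩ := exists_isSubgradient h.convex ha
      have h1 := hlip t a z y ht ha hz hy
      rw [sq_abs] at h1
      have h2 := hz t ht.le
      nlinarith
  have hsq : (a - t) ^ 2 ≤ (D * t) ^ 2 := sq_le_sq' (by linarith [neg_abs_le (a - t)])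
    ((le_abs_self _).trans had)
  have hn1 : 0 ≤ 4 * BVReg.recession ψ * D ^ 2 * t := by positivity
  have hn2 : 0 ≤ 2 * K * C * D ^ 2 * t := by positivity
  rcases le_or_gt t (2 * K) with htK | htK
  · have h3 : C * (a - t) ^ 2 ≤ 2 * K * C * D ^ 2 * t := by
      calc C * (a - t) ^ 2 ≤ C * (D * t) ^ 2 := by gcongr
        _ = t * (C * D ^ 2 * t) := by ring
        _ ≤ (2 * K) * (C * D ^ 2 * t) := by gcongr
        _ = _ := by ring
    linarith
  · have hyr' : y = BVReg.recession ψ := hr t y (by linarith) hy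
    subst hyr'
    have e1 := haff t (by linarith)
    rcases le_or_gt K a with haK | haK
    · have e2 := haff a haK
      rw [e2, e1]
      linarith
    · have h1 := h.le_recession_mul ha
      have hψK : 0 ≤ ψ K := h.nonneg hK.le
      -- Here a < K < t/2, so the relative error D is at least 1/2 and 4D² ≥ 1.
      have hD2 : t ≤ 2 * (D * t) := by
        have := (neg_abs_le (a - t))
        linarith
      have hD2' : 1 ≤ 2 * D := by
        by_contra hcon
        push Not at hcon
        nlinarith
      have h5 : t ≤ 4 * D ^ 2 * t := by nlinarith [mul_nonneg ht.le hD]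
      have : BVReg.recession ψ * K ≤ 4 * BVReg.recession ψ * D ^ 2 * t := by
        calc BVReg.recession ψ * K ≤ BVReg.recession ψ * t := by gcongr; linarith
          _ ≤ BVReg.recession ψ * (4 * D ^ 2 * t) := by gcongr
          _ = _ := by ring
      rw [e1]
      linarith

/-- Add the expansions of ψ at t with weights J₁, J₂. Apart from 2ψ(t) there remain y(J₁a₁ + J₂a₂ -
2t), controlled by G, then (2 - J₁ - J₂)(yt - ψ(t)), controlled by J, and the quadratic remainders.
First-order deviations of the two transformations enter only through their sum, so they may cancel.
-/
theorem IsConvexEnergy.exists_comparison {ψ : ℝ → ℝ} (h : IsConvexEnergy ψ) :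
    ∃ R : ℝ, 0 ≤ R ∧ ∀ t a₁ a₂ J₁ J₂ G J D₁ D₂ : ℝ, 0 ≤ t → 0 ≤ a₁ → 0 ≤ a₂ → 0 ≤ J₁ → 0 ≤ J₂ →
      0 ≤ G → G + J + D₁ ^ 2 + D₂ ^ 2 < 1 → J₁ * a₁ + J₂ * a₂ ≤ (2 + G) * t →
      |J₁ + J₂ - 2| ≤ J → |a₁ - t| ≤ D₁ * t → |a₂ - t| ≤ D₂ * t →
      J₁ * ψ a₁ + J₂ * ψ a₂ ≤ 2 * ψ t + R * (G + J + D₁ ^ 2 + D₂ ^ 2) * t := by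
  obtain ⟨C, hC, hexp⟩ := h.exists_expansion
  have hr0 := h.recession_pos
  -- The 3 bounds each Jᵢ: both are nonnegative and J₁ + J₂ ≤ 2 + J with J < 1.
  refine ⟨3 * C + BVReg.recession ψ, by positivity, ?_⟩
  intro t a₁ a₂ J₁ J₂ G J D₁ D₂ ht ha₁ ha₂ hJ₁ hJ₂ hG hT hGG hJJ hD₁ hD₂
  rcases ht.eq_or_lt with rfl | ht
  · have e1 : a₁ = 0 := by simpa using hD₁
    have e2 : a₂ = 0 := by simpa using hD₂
    simp [e1, e2, h.zero]
  obtain ⟨y, hy0, hyr, hyt, hy⟩ := hexp t ht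
  have h1 := mul_le_mul_of_nonneg_left (hy a₁ D₁ ha₁ hD₁) hJ₁
  have h2 := mul_le_mul_of_nonneg_left (hy a₂ D₂ ha₂ hD₂) hJ₂
  have hJ0 : 0 ≤ J := (abs_nonneg _).trans hJJ
  have hJu := (abs_le.1 hJJ).2
  have hJl := (abs_le.1 hJJ).1
  have hJ3 : J < 1 := by nlinarith [sq_nonneg D₁, sq_nonneg D₂]
  have e1 : J₁ * (C * D₁ ^ 2 * t) ≤ 3 * (C * D₁ ^ 2 * t) := by gcongr; linarith
  have e2 : J₂ * (C * D₂ ^ 2 * t) ≤ 3 * (C * D₂ ^ 2 * t) := by gcongr; linarith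
  have hψ0 := h.nonneg ht.le
  have e3 : y * (J₁ * a₁ + J₂ * a₂) ≤ y * ((2 + G) * t) := by gcongr
  have e4 : (2 - (J₁ + J₂)) * (y * t - ψ t) ≤ J * (y * t - ψ t) := by gcongr; linarith
  have e5 : y * (G * t) ≤ BVReg.recession ψ * (G * t) := by gcongr
  have e6 : J * (y * t - ψ t) ≤ J * (BVReg.recession ψ * t) := by
    gcongr
    nlinarith
  have e7 : 0 ≤ BVReg.recession ψ * D₁ ^ 2 * t := by positivity
  have e8 : 0 ≤ BVReg.recession ψ * D₂ ^ 2 * t := by positivity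
  have e9 : 0 ≤ C * G * t := by positivity
  have e10 : 0 ≤ C * J * t := by positivity
  nlinarith

/-! ### The Huber energy -/

lemma huber_eq_of_le {η t : ℝ} (ht : 1 / η ≤ t) :
    huber η t = t - 1 / (2 * η) := by rw [huber, if_pos ht]

lemma huber_eq_of_lt {η t : ℝ} (ht : t < 1 / η) : huber η t = η / 2 * t ^ 2 := by
  rw [huber, if_neg (not_le.2 ht)]

/-- The derivative of the Huber function is min(ηt, 1), which is η-Lipschitz. -/
lemma huber_bounds {η : ℝ} (hη : 0 < η) {s t : ℝ} (hs : 0 ≤ s) :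
    huber η t + min (η * t) 1 * (s - t) ≤ huber η s ∧
      huber η s ≤ huber η t + min (η * t) 1 * (s - t) + η / 2 * (s - t) ^ 2 := by
  have hη' : η * (1 / η) = 1 := by field_simp
  set b := 1 / η with hb
  have hb2 : 1 / (2 * η) = b / 2 := by rw [hb]; field_simp
  have hb0 : 0 < b := by positivity
  rcases le_or_gt b s with h1 | h1 <;> rcases le_or_gt b t with h2 | h2
  · have m : min (η * t) 1 = 1 := min_eq_right (by nlinarith)
    rw [huber_eq_of_le h1, huber_eq_of_le h2, m]
    constructor
    · linarith
    · nlinarith [mul_nonneg hη.le (sq_nonneg (s - t))]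
  · have m : min (η * t) 1 = η * t := min_eq_left (by nlinarith)
    rw [huber_eq_of_le h1, huber_eq_of_lt h2, m, hb2]
    constructor
    · nlinarith [mul_nonneg hη.le (sq_nonneg (b - t)),
        mul_nonneg (mul_nonneg hη.le (sub_nonneg.2 h1)) (sub_nonneg.2 h2.le)]
    · nlinarith [mul_nonneg hη.le (sq_nonneg (s - b))]
  · have m : min (η * t) 1 = 1 := min_eq_right (by nlinarith)
    rw [huber_eq_of_lt h1, huber_eq_of_le h2, m, hb2]
    constructor
    · nlinarith [mul_nonneg hη.le (sq_nonneg (s - b))]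
    · nlinarith [mul_nonneg hη.le (sq_nonneg (t - b)),
        mul_nonneg (mul_nonneg hη.le (sub_nonneg.2 h1.le)) (sub_nonneg.2 h2)]
  · have m : min (η * t) 1 = η * t := min_eq_left (by nlinarith)
    rw [huber_eq_of_lt h1, huber_eq_of_lt h2, m]
    constructor
    · nlinarith [mul_nonneg hη.le (sq_nonneg (s - t))]
    · nlinarith

lemma IsSubgradient.eq_of_huber {η : ℝ} (hη : 0 < η) {t y : ℝ} (ht : 0 < t)
    (hy : IsSubgradient (huber η) t y) : y = min (η * t) 1 := by
  set q := min (η * t) 1 with hq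
  have key : ∀ d, -t ≤ d → (y - q) * d ≤ η / 2 * d ^ 2 := by
    intro d hd
    have h1 := hy (t + d) (by linarith)
    have h2 := (huber_bounds hη (s := t + d) (t := t) (by linarith)).2
    rw [add_sub_cancel_left] at h1 h2
    nlinarith
  by_contra hne
  set w := y - q with hw
  have hw0 : w ≠ 0 := sub_ne_zero.2 hne
  have hwa : 0 < |w| := abs_pos.2 hw0
  -- A step e·w that stays in the half-line and has ηe ≤ 1: the linear gain e w² then exceeds the
  -- quadratic bound (ηe/2) e w².
  set e := min (t / |w|) (1 / η) with he
  have he0 : 0 < e := by positivity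
  have het : e * |w| ≤ t := by
    calc e * |w| ≤ t / |w| * |w| := by gcongr; exact min_le_left _ _
      _ = t := by field_simp
  have heη : η * e ≤ 1 := by
    calc η * e ≤ η * (1 / η) := by gcongr; exact min_le_right _ _
      _ = 1 := by field_simp
  have h1 := key (e * w) (by nlinarith [neg_abs_le w])
  have hw2 : 0 < w ^ 2 := by positivity
  have hpos : 0 < e * w ^ 2 := by positivity
  have : η / 2 * (e * w) ^ 2 = (η * e) / 2 * (e * w ^ 2) := by ring
  rw [this] at h1
  nlinarith

theorem isConvexEnergy_huber {η : ℝ} (hη : 0 < η) : IsConvexEnergy (huber η) where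
  mono := by
    intro s hs t ht hst
    have h1 := (huber_bounds hη (s := t) (t := s) ht).1
    have h2 : 0 ≤ min (η * s) 1 := le_min (mul_nonneg hη.le hs) zero_le_one
    nlinarith
  convex := by
    refine ⟨convex_Ici 0, fun s hs t ht a b ha hb hab => ?_⟩
    have h1 := mul_le_mul_of_nonneg_left (huber_bounds hη (s := s) (t := a * s + b * t) hs).1 ha
    have h2 := mul_le_mul_of_nonneg_left (huber_bounds hη (s := t) (t := a * s + b * t) ht).1 hb
    simp only [smul_eq_mul]
    set z := a * s + b * t with hz'
    set q := min (η * z) 1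
    have : a * (huber η z + q * (s - z)) + b * (huber η z + q * (t - z)) = huber η z := by
      have : b = 1 - a := by linarith
      rw [hz', this]
      ring
    linarith
  zero := by
    rw [huber_eq_of_lt (by positivity)]
    ring
  recession := by
    refine ⟨1, one_pos, ?_⟩
    have h1 : Tendsto (fun t : ℝ => 1 - 1 / (2 * η) * t⁻¹) atTop (𝓝 (1 - 1 / (2 * η) * 0)) :=
      (tendsto_inv_atTop_zero.const_mul _).const_sub _
    rw [mul_zero, sub_zero] at h1
    refine h1.congr' ?_
    filter_upwards [eventually_ge_atTop (1 / η)] with t ht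
    have ht0 : 0 < t := lt_of_lt_of_le (by positivity) ht
    rw [huber_eq_of_le ht]
    field_simp
  subgradient := by
    refine ⟨1 / η, η, by positivity, hη, fun t s ht hs y z hy hz => ?_⟩
    rw [hy.eq_of_huber hη ht, hz.eq_of_huber hη hs]
    constructor
    · intro hm
      have h1 : η * (1 / η) = 1 := by field_simp
      have ht' := hm.trans (min_le_left _ _)
      have hs' := hm.trans (min_le_right _ _)
      rw [min_eq_right (by nlinarith), min_eq_right (by nlinarith)]
      simp
    · intro _
      rw [sq_abs]
      have : |min (η * t) 1 - min (η * s) 1| ≤ |η * t - η * s| := by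
        simpa using abs_min_sub_min_le_max (η * t) 1 (η * s) 1
      calc (min (η * t) 1 - min (η * s) 1) * (t - s)
          ≤ |min (η * t) 1 - min (η * s) 1| * |t - s| := by
            rw [← abs_mul]; exact le_abs_self _
        _ ≤ |η * t - η * s| * |t - s| := by gcongr
        _ = η * (t - s) ^ 2 := by
            rw [← mul_sub, abs_mul, abs_of_pos hη, mul_assoc, abs_mul_abs_self]; ring

end BVReg

namespace BVReg

/-! ### Vector measures with values in Euclidean space -/

section VectorMeasure

variable {α : Type*} [MeasurableSpace α] {m : ℕ}

/-- The `i`-th component of a vector measure. -/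
noncomputable abbrev component (μ : VectorMeasure α (Rn m)) (i : Fin m) : SignedMeasure α :=
  μ.mapRange (EuclideanSpace.proj (𝕜 := ℝ) i).toLinearMap.toAddMonoidHom
    (EuclideanSpace.proj (𝕜 := ℝ) i).continuous

lemma component_apply (μ : VectorMeasure α (Rn m)) (i : Fin m) (s : Set α) :
    component μ i s = μ s i := rfl

lemma enorm_le_sum_enorm (x : Rn m) : ‖x‖ₑ ≤ ∑ i, ‖x i‖ₑ := by
  have h : x = ∑ i, x i • EuclideanSpace.single i (1 : ℝ) := by
    ext j
    simp [Pi.single_apply]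
  calc ‖x‖ₑ = ‖∑ i, x i • EuclideanSpace.single i (1 : ℝ)‖ₑ := by rw [← h]
    _ ≤ ∑ i, ‖x i • EuclideanSpace.single i (1 : ℝ)‖ₑ := enorm_sum_le _ _
    _ = ∑ i, ‖x i‖ₑ := by
        refine Finset.sum_congr rfl fun i _ => ?_
        rw [enorm_smul, ← ofReal_norm (EuclideanSpace.single i (1 : ℝ))]
        simp

/-- The target is finite-dimensional, so the variation is dominated by the sum of the finite total
variations of the components. -/
instance isFiniteMeasure_variation (μ : VectorMeasure α (Rn m)) :
    IsFiniteMeasure μ.variation := by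
  have hle : μ.variation ≤ ∑ i, (component μ i).totalVariation := by
    refine VectorMeasure.variation_le_of_forall_enorm_le fun E hE => ?_
    rw [Measure.finsetSum_apply]
    refine (enorm_le_sum_enorm _).trans (Finset.sum_le_sum fun i _ => ?_)
    exact SignedMeasure.enorm_le_totalVariation (component μ i) E
  exact isFiniteMeasure_of_le _ hle

lemma measurable_toLp_pi {f : Fin m → α → ℝ} (hf : ∀ i, Measurable (f i)) :
    Measurable (fun x => (WithLp.toLp 2 fun i => f i x : Rn m)) :=
  (PiLp.continuous_toLp 2 (fun _ : Fin m => ℝ)).measurable.comp (measurable_pi_lambda _ hf)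

lemma integrable_toLp_pi {μ : Measure α} {f : Fin m → α → ℝ} (hm : ∀ i, Measurable (f i))
    (hf : ∀ i, Integrable (f i) μ) :
    Integrable (fun x => (WithLp.toLp 2 fun i => f i x : Rn m)) μ := by
  refine ⟨(measurable_toLp_pi hm).aestronglyMeasurable, ?_⟩
  refine lt_of_le_of_lt (lintegral_mono fun x => enorm_le_sum_enorm _) ?_
  simp only
  rw [lintegral_finsetSum _ fun i _ => (hm i).enorm]
  exact ENNReal.sum_lt_top.2 fun i _ => (hf i).2

lemma integral_apply_coord {μ : Measure α} {f : α → Rn m} (hf : Integrable f μ) (i : Fin m) :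
    (∫ x, f x ∂μ) i = ∫ x, f x i ∂μ :=
  ((EuclideanSpace.proj (𝕜 := ℝ) i).integral_comp_comm hf).symm

/-- Polar decomposition of a vector measure. -/
theorem exists_polar (μ : VectorMeasure α (Rn m)) :
    ∃ σ : α → Rn m, Measurable σ ∧ (∀ᵐ x ∂μ.variation, ‖σ x‖ = 1) ∧
      Integrable σ μ.variation ∧ μ.variation.withDensityᵥ σ = μ := by
  set σ : α → Rn m := fun x => WithLp.toLp 2 fun i => (component μ i).rnDeriv μ.variation x with hσ
  have hm : ∀ i, Measurable ((component μ i).rnDeriv μ.variation) :=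
    fun i => SignedMeasure.measurable_rnDeriv _ _
  have hσm : Measurable σ := measurable_toLp_pi hm
  have hσi : Integrable σ μ.variation :=
    integrable_toLp_pi hm fun i => SignedMeasure.integrable_rnDeriv _ _
  have hμ : μ.variation.withDensityᵥ σ = μ := by
    ext E hE i
    have hac : component μ i ≪ᵥ μ.variation.toENNRealVectorMeasure := by
      refine VectorMeasure.AbsolutelyContinuous.mk fun s hs hs0 => ?_
      rw [Measure.toENNRealVectorMeasure_apply_measurable hs] at hs0
      have := VectorMeasure.enorm_measure_le_variation μ s
      rw [hs0, nonpos_iff_eq_zero, enorm_eq_zero] at this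
      rw [component_apply, this]
      rfl
    have h1 := (component μ i).withDensityᵥ_rnDeriv_eq μ.variation hac
    rw [withDensityᵥ_apply hσi hE, integral_apply_coord hσi.integrableOn, ← component_apply, ← h1,
      withDensityᵥ_apply (SignedMeasure.integrable_rnDeriv _ _) hE]
  refine ⟨σ, hσm, ?_, hσi, hμ⟩
  -- The variation of the measure with density σ has density ‖σ‖ with respect to `μ.variation`;
  -- being `μ.variation` itself, it forces ‖σ‖ = 1.
  have hv := Measure.variation_withDensityᵥ hσi
  rw [hμ] at hv
  have hae : (fun x => ‖σ x‖ₑ) =ᵐ[μ.variation] fun _ => 1 := by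
    rw [← withDensity_eq_iff_of_sigmaFinite hσm.enorm.aemeasurable aemeasurable_const, ← hv]
    exact withDensity_one.symm
  filter_upwards [hae] with x hx
  rwa [← ofReal_norm, ENNReal.ofReal_eq_one] at hx

end VectorMeasure

section Integral

variable {α E : Type*} [MeasurableSpace α] [NormedAddCommGroup E] [NormedSpace ℝ E]
  [CompleteSpace E]

omit [CompleteSpace E] in
lemma integrable_smul_of_integrable_withDensity {μ : Measure α} {f : α → ℝ} {h : α → E}
    (hh : Integrable h μ) (hf : Integrable f (μ.withDensity fun x => ‖h x‖ₑ)) :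
    Integrable (fun x => f x • h x) μ := by
  rw [integrable_withDensity_iff_integrable_smul₀' hh.aestronglyMeasurable.enorm
    (Eventually.of_forall fun x => enorm_lt_top)] at hf
  -- Only ‖h‖f is known to be measurable for μ, not f itself, so f h is rebuilt as (‖h‖f)(h/‖h‖).
  have h1 : AEStronglyMeasurable (fun x => ((‖h x‖ₑ).toReal • f x) • (‖h x‖⁻¹ • h x)) μ :=
    hf.aestronglyMeasurable.smul
      (hh.aestronglyMeasurable.norm.aemeasurable.inv.aestronglyMeasurable.smul
        hh.aestronglyMeasurable)
  have h2 : (fun x => ((‖h x‖ₑ).toReal • f x) • (‖h x‖⁻¹ • h x)) = fun x => f x • h x := by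
    ext x
    rcases eq_or_ne (h x) 0 with hx | hx
    · simp [hx]
    · have : ‖h x‖ ≠ 0 := norm_ne_zero_iff.2 hx
      rw [toReal_enorm, smul_smul, smul_eq_mul]
      congr 1
      field_simp
  rw [h2] at h1
  refine hf.mono h1 (Eventually.of_forall fun x => ?_)
  rw [norm_smul, norm_smul, toReal_enorm, norm_norm, mul_comm]

/-- The integral with respect to a vector measure with a density. -/
theorem integral_withDensityᵥ {μ : Measure α} {h : α → E} (hh : Integrable h μ) {f : α → ℝ}
    (hf : Integrable f (μ.withDensity fun x => ‖h x‖ₑ)) :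
    ∫ᵛ x, f x ∂•(μ.withDensityᵥ h) = ∫ x, f x • h x ∂μ := by
  have hvar : (μ.withDensityᵥ h).variation = μ.withDensity fun x => ‖h x‖ₑ :=
    Measure.variation_withDensityᵥ hh
  rw [← hvar] at hf
  have hint : ∀ f : α → ℝ, Integrable f (μ.withDensityᵥ h).variation →
      Integrable (fun x => f x • h x) μ := fun f hf =>
    integrable_smul_of_integrable_withDensity hh (hvar ▸ hf)
  have hfin : IsFiniteMeasure (μ.withDensityᵥ h).variation := by
    rw [hvar]
    exact isFiniteMeasure_withDensity hh.2.ne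
  have hac : ∀ {p : α → Prop}, (∀ᵐ x ∂(μ.withDensityᵥ h).variation, p x) →
      ∀ᵐ x ∂μ, h x ≠ 0 → p x := by
    intro p hp
    rw [hvar, ae_withDensity_iff' hh.aestronglyMeasurable.enorm] at hp
    filter_upwards [hp] with x hx hx0
    exact hx (by simpa using hx0)
  -- Both sides are linear and L¹-continuous in f for the measure ‖h‖μ, and they agree on
  -- indicators.
  refine Integrable.induction (μ := (μ.withDensityᵥ h).variation)
    (fun f : α → ℝ => ∫ᵛ x, f x ∂•(μ.withDensityᵥ h) = ∫ x, f x • h x ∂μ) ?_ ?_ ?_ ?_ hf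
  · intro c s hs _
    rw [VectorMeasure.integral_indicator hs, VectorMeasure.integral_const]
    simp only [ContinuousLinearMap.lsmul_apply]
    rw [VectorMeasure.restrict_apply _ hs MeasurableSet.univ, univ_inter, withDensityᵥ_apply hh hs,
      ← integral_smul, ← integral_indicator hs]
    congr 1
    ext x
    by_cases hx : x ∈ s <;> simp [hx]
  · intro f g _ hf hg h1 h2
    rw [VectorMeasure.integral_add hf hg, h1, h2, ← integral_add (hint f hf) (hint g hg)]
    simp only [Pi.add_apply, add_smul]
  · refine isClosed_eq VectorMeasure.continuous_integral ?_
    refine (LipschitzWith.of_dist_le_mul (K := 1) fun f g => ?_).continuous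
    have hf := L1.integrable_coeFn f
    have hg := L1.integrable_coeFn g
    rw [dist_eq_norm, ← integral_sub (hint f hf) (hint g hg), NNReal.coe_one, one_mul, dist_eq_norm,
      L1.norm_eq_integral_norm]
    have e : ∫ x, ‖(f - g : α →₁[(μ.withDensityᵥ h).variation] ℝ) x‖ ∂(μ.withDensityᵥ h).variation
        = ∫ x, ‖f x • h x - g x • h x‖ ∂μ := by
      have e1 : ∫ x, ‖(f - g : α →₁[(μ.withDensityᵥ h).variation] ℝ) x‖
          ∂(μ.withDensityᵥ h).variation = ∫ x, ‖f x - g x‖ ∂(μ.withDensityᵥ h).variation := by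
        refine integral_congr_ae ?_
        filter_upwards [Lp.coeFn_sub f g] with x hx
        rw [hx]
        rfl
      rw [e1]
      set k : α → ℝ := fun x => ‖f x - g x‖
      have e2 : ∫ x, ‖f x - g x‖ ∂(μ.withDensityᵥ h).variation
          = ∫ x, (‖h x‖ₑ).toReal • ‖f x - g x‖ ∂μ := by
        refine (congrArg (fun ν => ∫ x, k x ∂ν) hvar).trans ?_
        exact integral_withDensity_eq_integral_toReal_smul₀ hh.aestronglyMeasurable.enorm
          (Eventually.of_forall fun x => enorm_lt_top) _
      rw [e2]
      congr 1
      ext x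
      rw [toReal_enorm, ← sub_smul, norm_smul, smul_eq_mul, mul_comm]
    rw [e]
    exact norm_integral_le_integral_norm _
  · intro f g hfg hf h1
    rw [← VectorMeasure.integral_congr_ae hfg, h1]
    refine integral_congr_ae ?_
    filter_upwards [hac hfg] with x hx
    by_cases hx0 : h x = 0
    · simp [hx0]
    · rw [hx hx0]

end Integral

/-! ### Decomposition of the distributional gradient -/

section Decomposition

variable {m : ℕ} (Ω : Set (Rn m)) (u : Rn m → ℝ)

lemma measurable_approxGradient : Measurable (approxGradient Ω u) :=
  measurable_toLp_pi fun _ => SignedMeasure.measurable_rnDeriv _ _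

lemma integrable_approxGradient : Integrable (approxGradient Ω u) :=
  integrable_toLp_pi (fun _ => SignedMeasure.measurable_rnDeriv _ _)
    fun _ => SignedMeasure.integrable_rnDeriv _ _

lemma distribGradient_eq_add : distribGradient Ω u =
    (volume : Measure (Rn m)).withDensityᵥ (approxGradient Ω u) + singularGradient Ω u := by
  rw [singularGradient, add_sub_cancel]

/-- The singular part of the gradient lives on a Lebesgue null set. -/
lemma exists_singular_set : ∃ N : Set (Rn m), MeasurableSet N ∧ volume N = 0 ∧
    (singularGradient Ω u).variation Nᶜ = 0 := by
  set D := distribGradient Ω u with hD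
  have hms := fun i : Fin m => (component D i).mutuallySingular_singularPart volume
  choose s hs hs1 hs2 using hms
  refine ⟨⋃ i, (s i)ᶜ, MeasurableSet.iUnion fun i => (hs i).compl, ?_, ?_⟩
  · refine measure_iUnion_null fun i => ?_
    have := hs2 i (s i)ᶜ subset_rfl
    rwa [Measure.toENNRealVectorMeasure_apply_measurable (hs i).compl] at this
  · have hm : MeasurableSet (⋃ i, (s i)ᶜ)ᶜ := (MeasurableSet.iUnion fun i => (hs i).compl).compl
    rw [VectorMeasure.variation_apply_eq_zero hm]
    intro t ht htm
    ext i
    have hts : t ⊆ s i := by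
      intro x hx
      have := ht hx
      simp only [mem_compl_iff, mem_iUnion, not_exists, not_not] at this
      exact this i
    have h1 := hs1 i t hts
    have h2 := congrArg (fun v : SignedMeasure (Rn m) => v t)
      ((component D i).singularPart_add_withDensity_rnDeriv_eq volume)
    simp only [_root_.add_apply] at h2
    rw [h1, zero_add, component_apply,
      withDensityᵥ_apply (SignedMeasure.integrable_rnDeriv _ _) htm] at h2
    rw [singularGradient, _root_.sub_apply,
      withDensityᵥ_apply (integrable_approxGradient Ω u) htm]
    change D t i - (∫ x in t, approxGradient Ω u x) i = 0
    rw [integral_apply_coord (integrable_approxGradient Ω u).integrableOn, ← h2]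
    exact sub_self _

/-- On Lebesgue null sets, `|Dˢu|` and `|Du|` agree. -/
lemma singularGradient_variation_eq_absD {E : Set (Rn m)} (hE : MeasurableSet E)
    (h0 : volume E = 0) : (singularGradient Ω u).variation E = absD Ω u E := by
  have h : (singularGradient Ω u).restrict E = (distribGradient Ω u).restrict E := by
    ext1 t ht
    rw [VectorMeasure.restrict_apply _ hE ht, VectorMeasure.restrict_apply _ hE ht,
      singularGradient, _root_.sub_apply,
      withDensityᵥ_apply (integrable_approxGradient Ω u) (ht.inter hE),
      setIntegral_measure_zero _ (measure_mono_null inter_subset_right h0), sub_zero]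
  have h1 := VectorMeasure.variation_restrict (μ := singularGradient Ω u) hE
  have h2 := VectorMeasure.variation_restrict (μ := distribGradient Ω u) hE
  rw [h, h2] at h1
  have := congrArg (fun μ : Measure (Rn m) => μ univ) h1
  simp only [Measure.restrict_apply_univ] at this
  exact this.symm

lemma absD_le : absD Ω u ≤
    (volume.withDensity fun x => ‖approxGradient Ω u x‖ₑ) + (singularGradient Ω u).variation := by
  rw [absD, distribGradient_eq_add,
    ← Measure.variation_withDensityᵥ (integrable_approxGradient Ω u)]
  exact VectorMeasure.variation_add_le

instance isFiniteMeasure_absD : IsFiniteMeasure (absD Ω u) := isFiniteMeasure_variation _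

/-- Integration of bounded functions against `Du`, by means of the polar decomposition. -/
lemma exists_polar_absD : ∃ σ : Rn m → Rn m, Measurable σ ∧ (∀ᵐ x ∂(absD Ω u), ‖σ x‖ = 1) ∧
    ∀ φ : Rn m → ℝ, Integrable φ (absD Ω u) →
      ∫ᵛ x, φ x ∂•(distribGradient Ω u) = ∫ x, φ x • σ x ∂(absD Ω u) := by
  obtain ⟨σ, hσ, hσ1, hσi, h⟩ := exists_polar (distribGradient Ω u)
  refine ⟨σ, hσ, hσ1, fun φ hφ => ?_⟩
  have h2 := integral_withDensityᵥ hσi (f := φ) (by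
    rw [← Measure.variation_withDensityᵥ hσi, h]
    exact hφ)
  rw [h] at h2
  exact h2

lemma exists_polar_singularGradient : ∃ σ : Rn m → Rn m, Measurable σ ∧
    (∀ᵐ x ∂(singularGradient Ω u).variation, ‖σ x‖ = 1) ∧
    ∀ φ : Rn m → ℝ, Measurable φ → ∀ C : ℝ, (∀ x, |φ x| ≤ C) →
      ∫ᵛ x, φ x ∂•(distribGradient Ω u) = (∫ x, φ x • approxGradient Ω u x)
        + ∫ x, φ x • σ x ∂(singularGradient Ω u).variation := by
  obtain ⟨σ, hσ, hσ1, hσi, h⟩ := exists_polar (singularGradient Ω u)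
  refine ⟨σ, hσ, hσ1, fun φ hφ C hC => ?_⟩
  have hg := integrable_approxGradient Ω u
  have hbd : ∀ μ : Measure (Rn m), IsFiniteMeasure μ → Integrable φ μ := fun μ _ =>
    Integrable.of_bound hφ.aestronglyMeasurable C (Eventually.of_forall hC)
  have hvs := Measure.variation_withDensityᵥ hσi
  rw [h] at hvs
  have h2 := integral_withDensityᵥ hσi (f := φ) (by rw [← hvs]; exact hbd _ inferInstance)
  rw [h] at h2
  have h3 := integral_withDensityᵥ hg (f := φ)
    (hbd _ (isFiniteMeasure_withDensity hg.2.ne))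
  rw [distribGradient_eq_add, VectorMeasure.integral_add_vectorMeasure, h2, h3]
  · exact hbd _ inferInstance
  · exact hbd _ inferInstance

end Decomposition

end BVReg

namespace BVReg

/-! ### Test fields -/

/-- `φ ∈ C_c^∞(W; ℝᵐ)`. -/
structure IsTest {m : ℕ} (W : Set (Rn m)) (φ : Rn m → Rn m) : Prop where
  contDiff : ContDiff ℝ ∞ φ
  hasCompactSupport : HasCompactSupport φ
  tsupport_subset : tsupport φ ⊆ W

/-- The divergence of a vector field. -/
noncomputable def divergence {m : ℕ} (φ : Rn m → Rn m) (x : Rn m) : ℝ :=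
  LinearMap.trace ℝ (Rn m) (fderiv ℝ φ x).toLinearMap

section Test

variable {m : ℕ} {W W' : Set (Rn m)} {φ : Rn m → Rn m}

lemma IsTest.mono (h : IsTest W φ) (hW : W ⊆ W') : IsTest W' φ :=
  ⟨h.contDiff, h.hasCompactSupport, h.tsupport_subset.trans hW⟩

lemma IsTest.continuous (h : IsTest W φ) : Continuous φ := h.contDiff.continuous

lemma IsTest.differentiable (h : IsTest W φ) : Differentiable ℝ φ :=
  h.contDiff.differentiable (by simp)

lemma IsTest.eq_zero (h : IsTest W φ) {x : Rn m} (hx : x ∉ W) : φ x = 0 := by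
  by_contra h0
  exact hx (h.tsupport_subset (subset_tsupport _ h0))

lemma IsTest.contDiff_coord (h : IsTest W φ) (i : Fin m) : ContDiff ℝ ∞ fun x => φ x i :=
  (EuclideanSpace.proj (𝕜 := ℝ) i).contDiff.comp h.contDiff

lemma IsTest.hasCompactSupport_coord (h : IsTest W φ) (i : Fin m) :
    HasCompactSupport fun x => φ x i :=
  h.hasCompactSupport.comp_left (g := fun v : Rn m => v i) rfl

lemma IsTest.tsupport_coord (h : IsTest W φ) (i : Fin m) :
    tsupport (fun x => φ x i) ⊆ W :=
  (closure_mono (Function.support_comp_subset (g := fun v : Rn m => v i) rfl φ)).trans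
    h.tsupport_subset

lemma gradient_coord {f : Rn m → ℝ} {x : Rn m} (i : Fin m) :
    gradient f x i = fderiv ℝ f x (EuclideanSpace.single i 1) := by
  rw [← toDual_gradient (𝕜 := ℝ) (f := f) (x := x), InnerProductSpace.toDual_apply_apply,
    EuclideanSpace.inner_single_right]
  simp

lemma divergence_eq_sum {x : Rn m} (h : DifferentiableAt ℝ φ x) :
    divergence φ x = ∑ i, gradient (fun y => φ y i) x i := by
  rw [divergence, LinearMap.trace_eq_sum_inner _ (EuclideanSpace.basisFun (Fin m) ℝ)]
  refine Finset.sum_congr rfl fun i _ => ?_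
  rw [gradient_coord]
  have : HasFDerivAt (fun y => φ y i)
      ((EuclideanSpace.proj (𝕜 := ℝ) i).comp (fderiv ℝ φ x)) x :=
    (EuclideanSpace.proj (𝕜 := ℝ) i).hasFDerivAt.comp x h.hasFDerivAt
  rw [this.fderiv]
  simp [PiLp.inner_apply]

lemma IsTest.divergence_eq (h : IsTest W φ) (x : Rn m) :
    divergence φ x = ∑ i, gradient (fun y => φ y i) x i :=
  divergence_eq_sum (h.differentiable x)

lemma IsTest.continuous_gradient_coord (h : IsTest W φ) (i : Fin m) :
    Continuous fun x => gradient (fun y => φ y i) x :=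
  (InnerProductSpace.toDual ℝ (Rn m)).symm.continuous.comp
    ((h.contDiff_coord i).continuous_fderiv (by simp))

lemma IsTest.hasCompactSupport_gradient_coord (h : IsTest W φ) (i : Fin m) :
    HasCompactSupport fun x => gradient (fun y => φ y i) x :=
  ((h.hasCompactSupport_coord i).fderiv ℝ).comp_left
    (g := (InnerProductSpace.toDual ℝ (Rn m)).symm) (map_zero _)

lemma IsTest.continuous_divergence (h : IsTest W φ) : Continuous (divergence φ) := by
  have : divergence φ = fun x => ∑ i, gradient (fun y => φ y i) x i := funext h.divergence_eq
  rw [this]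
  exact continuous_finsetSum _ fun i _ =>
    (EuclideanSpace.proj (𝕜 := ℝ) i).continuous.comp (h.continuous_gradient_coord i)

lemma divergence_eq_zero_of_notMem {x : Rn m} (hx : x ∉ tsupport φ) :
    divergence φ x = 0 := by
  rw [divergence, fderiv_of_notMem_tsupport (𝕜 := ℝ) hx]
  simp

lemma IsTest.hasCompactSupport_divergence (h : IsTest W φ) : HasCompactSupport (divergence φ) :=
  HasCompactSupport.intro h.hasCompactSupport fun _ hx => divergence_eq_zero_of_notMem hx

lemma IsTest.exists_bound_divergence (h : IsTest W φ) : ∃ C, ∀ x, ‖divergence φ x‖ ≤ C :=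
  h.continuous_divergence.bounded_above_of_compact_support h.hasCompactSupport_divergence

lemma IsTest.exists_bound (h : IsTest W φ) : ∃ C, ∀ x, ‖φ x‖ ≤ C :=
  h.continuous.bounded_above_of_compact_support h.hasCompactSupport

lemma IsTest.integrable_mul_divergence (h : IsTest W φ) {μ : Measure (Rn m)} {u : Rn m → ℝ}
    (hu : Integrable u μ) : Integrable (fun x => u x * divergence φ x) μ := by
  obtain ⟨C, hC⟩ := h.exists_bound_divergence
  exact hu.mul_bdd h.continuous_divergence.aestronglyMeasurable (Eventually.of_forall hC)

/-- Test functions that multiply a vector. -/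
lemma isTest_smul_const {φ : Rn m → ℝ} (h1 : ContDiff ℝ ∞ φ) (h2 : HasCompactSupport φ)
    (h3 : tsupport φ ⊆ W) (v : Rn m) : IsTest W fun x => φ x • v where
  contDiff := h1.smul contDiff_const
  hasCompactSupport := h2.smul_right
  tsupport_subset := (closure_mono (Function.support_smul_subset_left _ _)).trans h3

end Test

/-! ### Pairing of the distributional gradient with test fields -/

section Pairing

variable {m : ℕ} {Ω : Set (Rn m)} {u : Rn m → ℝ} {φ : Rn m → Rn m}

lemma IsBV.isDistribGradient (h : IsBV Ω u) : IsDistribGradient Ω u (distribGradient Ω u) := by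
  rw [distribGradient, dif_pos h.2]
  exact h.2.choose_spec

lemma IsBV.integral_mul_divergence (h : IsBV Ω u) (hφ : IsTest Ω φ) :
    ∫ x in Ω, u x * divergence φ x =
      - ∑ i, (∫ᵛ x, φ x i ∂•(distribGradient Ω u)) i := by
  have hi : ∀ i, Integrable (fun x => u x • gradient (fun y => φ y i) x) (volume.restrict Ω) := by
    intro i
    obtain ⟨C, hC⟩ := (hφ.continuous_gradient_coord i).bounded_above_of_compact_support
      (hφ.hasCompactSupport_gradient_coord i)
    exact h.1.smul_bdd C (hφ.continuous_gradient_coord i).aestronglyMeasurable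
      (Eventually.of_forall hC)
  have h1 : ∀ i, ∫ x in Ω, u x * gradient (fun y => φ y i) x i
      = -(∫ᵛ x, φ x i ∂•(distribGradient Ω u)) i := by
    intro i
    have := h.isDistribGradient.2 (fun x => φ x i) (hφ.contDiff_coord i)
      (hφ.hasCompactSupport_coord i) (hφ.tsupport_coord i)
    have h2 := congrArg (fun v : Rn m => v i) this
    simp only [PiLp.neg_apply] at h2
    rw [← h2, integral_apply_coord (hi i)]
    rfl
  simp_rw [hφ.divergence_eq, Finset.mul_sum]
  rw [integral_finsetSum _ fun i _ => ?_, ← Finset.sum_neg_distrib]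
  · exact Finset.sum_congr rfl fun i _ => h1 i
  · exact (EuclideanSpace.proj (𝕜 := ℝ) i).integrable_comp (hi i)

lemma sum_integral_smul_coord {μ : Measure (Rn m)} {σ φ : Rn m → Rn m}
    (h : ∀ i, Integrable (fun x => φ x i • σ x) μ) :
    ∑ i, (∫ x, φ x i • σ x ∂μ) i = ∫ x, inner ℝ (φ x) (σ x) ∂μ := by
  have : ∀ x, inner ℝ (φ x) (σ x) = ∑ i, (φ x i • σ x) i := by
    intro x
    simp [PiLp.inner_apply, mul_comm]
  simp_rw [this]
  rw [integral_finsetSum (f := fun i x => (φ x i • σ x) i) _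
    fun i _ => (EuclideanSpace.proj (𝕜 := ℝ) i).integrable_comp (h i)]
  exact Finset.sum_congr rfl fun i _ => integral_apply_coord (h i) i

lemma integrable_of_bound_inner {μ : Measure (Rn m)} {σ φ : Rn m → Rn m} (hφ : Measurable φ) {C : ℝ}
    (hC : ∀ x, ‖φ x‖ ≤ C) (hσ : Integrable σ μ) : Integrable (fun x => inner ℝ (φ x) (σ x)) μ := by
  refine (hσ.norm.const_mul C).mono (hφ.aestronglyMeasurable.inner hσ.aestronglyMeasurable)
    (Eventually.of_forall fun x => ?_)
  refine (norm_inner_le_norm _ _).trans ?_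
  rw [Real.norm_eq_abs]
  refine le_trans ?_ (le_abs_self _)
  gcongr
  exact hC x

lemma IsTest.integrable_coord_smul {W : Set (Rn m)} (hφ : IsTest W φ) {μ : Measure (Rn m)}
    {σ : Rn m → Rn m} (hσ : Integrable σ μ) (i : Fin m) :
    Integrable (fun x => φ x i • σ x) μ := by
  obtain ⟨C, hC⟩ := hφ.exists_bound
  refine hσ.bdd_smul C (hφ.contDiff_coord i).continuous.aestronglyMeasurable
    (Eventually.of_forall fun x => (PiLp.norm_apply_le (φ x) i).trans (hC x))

lemma integrable_of_norm_eq_one {μ : Measure (Rn m)} [IsFiniteMeasure μ] {σ : Rn m → Rn m}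
    (hσ : Measurable σ) (h1 : ∀ᵐ x ∂μ, ‖σ x‖ = 1) : Integrable σ μ :=
  Integrable.of_bound hσ.aestronglyMeasurable 1 (h1.mono fun _ h => h.le)

/-- Integration by parts with the polar decomposition of `Du`. -/
lemma IsBV.exists_polar (h : IsBV Ω u) : ∃ σ : Rn m → Rn m, Measurable σ ∧
    (∀ᵐ x ∂(absD Ω u), ‖σ x‖ = 1) ∧ ∀ φ, IsTest Ω φ →
      ∫ x in Ω, u x * divergence φ x = -∫ x, inner ℝ (φ x) (σ x) ∂(absD Ω u) := by
  obtain ⟨σ, hσ, hσ1, hint⟩ := exists_polar_absD Ω u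
  refine ⟨σ, hσ, hσ1, fun φ hφ => ?_⟩
  rw [h.integral_mul_divergence hφ,
    ← sum_integral_smul_coord (hφ.integrable_coord_smul (integrable_of_norm_eq_one hσ hσ1))]
  congr 1
  refine Finset.sum_congr rfl fun i _ => ?_
  rw [hint _ ((hφ.contDiff_coord i).continuous.integrable_of_hasCompactSupport
    (hφ.hasCompactSupport_coord i))]

/-- Integration by parts with the Lebesgue decomposition of `Du`. -/
lemma IsBV.exists_polar_singular (h : IsBV Ω u) : ∃ σ : Rn m → Rn m, Measurable σ ∧
    (∀ᵐ x ∂(singularGradient Ω u).variation, ‖σ x‖ = 1) ∧ ∀ φ, IsTest Ω φ →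
      ∫ x in Ω, u x * divergence φ x = -((∫ x, inner ℝ (φ x) (approxGradient Ω u x))
        + ∫ x, inner ℝ (φ x) (σ x) ∂(singularGradient Ω u).variation) := by
  obtain ⟨σ, hσ, hσ1, hint⟩ := exists_polar_singularGradient Ω u
  refine ⟨σ, hσ, hσ1, fun φ hφ => ?_⟩
  rw [h.integral_mul_divergence hφ,
    ← sum_integral_smul_coord (hφ.integrable_coord_smul (integrable_of_norm_eq_one hσ hσ1)),
    ← sum_integral_smul_coord (hφ.integrable_coord_smul (integrable_approxGradient Ω u)),
    ← Finset.sum_add_distrib]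
  congr 1
  refine Finset.sum_congr rfl fun i _ => ?_
  obtain ⟨C, hC⟩ := (hφ.contDiff_coord i).continuous.bounded_above_of_compact_support
    (hφ.hasCompactSupport_coord i)
  rw [hint _ (hφ.contDiff_coord i).continuous.measurable C hC]
  rfl

end Pairing

/-! ### Approximation of bounded measurable fields by test fields -/

section Approximation

variable {m : ℕ}

/-- Smooth cutoff functions. -/
lemma exists_smooth_cutoff {K W : Set (Rn m)} (hK : IsCompact K) (hW : IsOpen W) (hKW : K ⊆ W) :
    ∃ χ : Rn m → ℝ, ContDiff ℝ ∞ χ ∧ HasCompactSupport χ ∧ tsupport χ ⊆ W ∧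
      (∀ x, 0 ≤ χ x ∧ χ x ≤ 1) ∧ ∀ x ∈ K, χ x = 1 := by
  obtain ⟨L, hL, hKL, hLW⟩ := exists_compact_between hK hW hKW
  obtain ⟨χ, h0, h1, hχ⟩ := exists_contMDiffMap_zero_one_of_isClosed (n := ⊤)
    (modelWithCornersSelf ℝ (Rn m)) (isOpen_interior (s := L)).isClosed_compl hK.isClosed
    (disjoint_compl_left_iff_subset.2 hKL)
  have hsupp : tsupport χ ⊆ L := by
    refine closure_minimal (fun x hx => ?_) hL.isClosed
    by_contra hxL
    exact hx (h0 fun hx' => hxL (interior_subset hx'))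
  exact ⟨χ, χ.contMDiff.contDiff, hL.of_isClosed_subset (isClosed_tsupport _) hsupp,
    hsupp.trans hLW, fun x => hχ x, fun x hx => h1 hx⟩

/-- Smooth maps into a ball that approximate the retraction onto the ball. -/
lemma exists_smooth_retraction {r : ℝ} (hr : 0 < r) : ∃ Q : ℕ → Rn m → Rn m,
    (∀ k, ContDiff ℝ ∞ (Q k)) ∧ (∀ k z, ‖Q k z‖ ≤ r) ∧
    ∀ (z : ℕ → Rn m) (z₀ : Rn m), ‖z₀‖ ≤ r → Tendsto z atTop (𝓝 z₀) →
      Tendsto (fun k => Q k (z k)) atTop (𝓝 z₀) := by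
  set P : Rn m → Rn m := fun z => (r / max r ‖z‖) • z with hP
  have hmax : ∀ z : Rn m, 0 < max r ‖z‖ := fun z => lt_max_of_lt_left hr
  have hPc : Continuous P :=
    (continuous_const.div (continuous_const.max continuous_norm) fun z => (hmax z).ne').smul
      continuous_id
  have hPr : ∀ z, ‖P z‖ ≤ r := by
    intro z
    rw [hP, norm_smul, Real.norm_of_nonneg (by have := hmax z; positivity), div_mul_eq_mul_div,
      div_le_iff₀ (hmax z)]
    gcongr
    exact le_max_right _ _
  have hδ : ∀ k : ℕ, 0 < 1 / ((k : ℝ) + 1) := fun k => by positivity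
  have hex := fun k : ℕ => hPc.exists_contDiff_approx ⊤ (ε := fun _ => 1 / ((k : ℝ) + 1))
    continuous_const fun _ => hδ k
  choose q hq1 hq2 _ using hex
  -- The smooth approximations overshoot the ball by at most 1/(k+1); the factor rescales them into
  -- it and tends to 1.
  refine ⟨fun k z => (r / (r + 1 / ((k : ℝ) + 1))) • q k z, fun k => (hq1 k).const_smul _, ?_, ?_⟩
  · intro k z
    have := hδ k
    rw [norm_smul, Real.norm_of_nonneg (by positivity), div_mul_eq_mul_div,
      div_le_iff₀ (by positivity)]
    gcongr
    calc ‖q k z‖ = ‖P z + (q k z - P z)‖ := by rw [add_sub_cancel]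
      _ ≤ ‖P z‖ + ‖q k z - P z‖ := norm_add_le _ _
      _ ≤ r + 1 / ((k : ℝ) + 1) := by
          gcongr
          · exact hPr z
          · rw [← dist_eq_norm]; exact (hq2 k z).le
  · intro z z₀ hz₀ hz
    have h0 : Tendsto (fun k : ℕ => 1 / ((k : ℝ) + 1)) atTop (𝓝 0) :=
      tendsto_one_div_add_atTop_nhds_zero_nat
    have h1 : Tendsto (fun k : ℕ => r / (r + 1 / ((k : ℝ) + 1))) atTop (𝓝 1) := by
      have := (tendsto_const_nhds (x := r)).div ((tendsto_const_nhds (x := r)).add h0)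
        (by simpa using hr.ne')
      rw [add_zero, div_self hr.ne'] at this
      exact this
    have h2 : Tendsto (fun k => P (z k)) atTop (𝓝 z₀) := by
      have := (hPc.tendsto z₀).comp hz
      have e : P z₀ = z₀ := by
        simp only [hP]
        rw [max_eq_left hz₀, div_self hr.ne', one_smul]
      rwa [e] at this
    have h3 : Tendsto (fun k => q k (z k)) atTop (𝓝 z₀) := by
      refine tendsto_of_tendsto_of_dist h2 ?_
      refine squeeze_zero (fun _ => dist_nonneg) (fun k => ?_) h0
      rw [dist_comm]
      exact (hq2 k (z k)).le
    simpa using h1.smul h3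

/-- A measurable field with values in a ball is the almost everywhere limit, on an open set `W`, of
test fields on `W` with values in the ball. -/
theorem exists_isTest_tendsto {r : ℝ} (hr : 0 < r) (μ : Measure (Rn m)) [IsFiniteMeasure μ]
    {W : Set (Rn m)} (hW : IsOpen W) {ξ : Rn m → Rn m} (hξ : Measurable ξ) (hξr : ∀ x, ‖ξ x‖ ≤ r) :
    ∃ φ : ℕ → Rn m → Rn m, (∀ k, IsTest W (φ k)) ∧ (∀ k x, ‖φ k x‖ ≤ r) ∧
      ∀ᵐ x ∂μ, x ∈ W → Tendsto (fun k => φ k x) atTop (𝓝 (ξ x)) := by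
  have hL : MemLp ξ 1 μ := MemLp.of_bound hξ.aestronglyMeasurable r (Eventually.of_forall hξr)
  -- Smooth L¹ approximations have a subsequence converging almost everywhere. The retractions then
  -- restore the bound r, and cutoffs along a compact exhaustion of W move the supports into W.
  have hex := fun k : ℕ => hL.exist_eLpNorm_sub_le ENNReal.one_ne_top le_rfl
    (ε := 1 / ((k : ℝ) + 1)) (by positivity)
  choose g _ hg2 hg3 using hex
  have htend : TendstoInMeasure μ g atTop ξ := by
    refine tendstoInMeasure_of_tendsto_eLpNorm one_ne_zero
      (fun k => (hg2 k).continuous.aestronglyMeasurable) hξ.aestronglyMeasurable ?_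
    have h0 : Tendsto (fun k : ℕ => ENNReal.ofReal (1 / ((k : ℝ) + 1))) atTop (𝓝 0) := by
      have := ENNReal.tendsto_ofReal (tendsto_one_div_add_atTop_nhds_zero_nat (𝕜 := ℝ))
      simpa using this
    refine tendsto_of_tendsto_of_tendsto_of_le_of_le tendsto_const_nhds h0 (fun _ => zero_le) ?_
    intro k
    simp only
    rw [eLpNorm_sub_comm]
    exact hg3 k
  obtain ⟨ns, -, hns⟩ := htend.exists_seq_tendsto_ae
  obtain ⟨Q, hQ1, hQ2, hQ3⟩ := exists_smooth_retraction (m := m) hr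
  have : LocallyCompactSpace W := hW.locallyCompactSpace
  let K : CompactExhaustion W := default
  have hcut := fun k : ℕ => exists_smooth_cutoff ((K.isCompact k).image continuous_subtype_val) hW
    (by rintro _ ⟨x, -, rfl⟩; exact x.2)
  choose χ hχ1 hχ2 hχ3 hχ4 hχ5 using hcut
  refine ⟨fun k x => χ k x • Q k (g (ns k) x), fun k => ⟨?_, ?_, ?_⟩, fun k x => ?_, ?_⟩
  · exact (hχ1 k).smul ((hQ1 k).comp (hg2 (ns k)))
  · exact (hχ2 k).smul_right
  · exact (closure_mono (Function.support_smul_subset_left _ _)).trans (hχ3 k)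
  · rw [norm_smul, Real.norm_of_nonneg (hχ4 k x).1]
    calc χ k x * ‖Q k (g (ns k) x)‖ ≤ 1 * r :=
          mul_le_mul (hχ4 k x).2 (hQ2 k _) (norm_nonneg _) zero_le_one
      _ = r := one_mul r
  · filter_upwards [hns] with x hx hxW
    have h1 := hQ3 (fun k => g (ns k) x) (ξ x) (hξr x) hx
    obtain ⟨n, hn⟩ := K.exists_mem ⟨x, hxW⟩
    refine h1.congr' ?_
    filter_upwards [eventually_ge_atTop n] with k hk
    rw [hχ5 k x ⟨⟨x, hxW⟩, K.subset hk hn, rfl⟩, one_smul]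

end Approximation

end BVReg

namespace BVReg

/-! ### The energy measure and its dual description -/

/-- The measure `ψ(‖∇u‖) ℒᵐ + ψ^∞ |Dˢu|` on `Ω`. -/
noncomputable def energyMeasure {m : ℕ} (Ω : Set (Rn m)) (ψ : ℝ → ℝ) (u : Rn m → ℝ) :
    Measure (Rn m) :=
  (volume.restrict Ω).withDensity (fun x => ENNReal.ofReal (ψ ‖approxGradient Ω u x‖))
    + ENNReal.ofReal (recession ψ) • (singularGradient Ω u).variation.restrict Ω

section Energy

variable {m : ℕ} {Ω W : Set (Rn m)} {ψ : ℝ → ℝ} {u v : Rn m → ℝ}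

lemma IsConvexEnergy.measurable_energy (h : IsConvexEnergy ψ) :
    Measurable fun x : Rn m => ψ ‖x‖ := by
  have h1 : Monotone fun t : ℝ => ψ (max t 0) := fun s t hst =>
    h.mono (mem_Ici.2 (le_max_right _ _)) (mem_Ici.2 (le_max_right _ _)) (max_le_max hst le_rfl)
  have h2 : (fun x : Rn m => ψ ‖x‖) = (fun t : ℝ => ψ (max t 0)) ∘ fun x : Rn m => ‖x‖ := by
    ext x
    simp
  rw [h2]
  exact h1.measurable.comp measurable_norm

lemma energyMeasure_apply {E : Set (Rn m)} (hE : MeasurableSet E) (hEΩ : E ⊆ Ω) :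
    energyMeasure Ω ψ u E = (∫⁻ x in E, ENNReal.ofReal (ψ ‖approxGradient Ω u x‖))
      + ENNReal.ofReal (recession ψ) * (singularGradient Ω u).variation E := by
  rw [energyMeasure, Measure.add_apply, withDensity_apply _ hE, Measure.smul_apply,
    Measure.restrict_apply hE, Measure.restrict_restrict hE, inter_eq_self_of_subset_left hEΩ,
    smul_eq_mul]

lemma IsBV.TV_eq (h : IsBV Ω u) (hΩ : IsOpen Ω) : TV Ω ψ u = energyMeasure Ω ψ u Ω := by
  rw [TV, if_pos h, energyMeasure_apply hΩ.measurableSet subset_rfl]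

lemma TV_of_not_isBV (h : ¬ IsBV Ω u) : TV Ω ψ u = ⊤ := by
  rw [TV, if_neg h]

lemma IsConvexEnergy.integrable_energy (h : IsConvexEnergy ψ) :
    Integrable (fun x => ψ ‖approxGradient Ω u x‖) := by
  refine ((integrable_approxGradient Ω u).norm.const_mul (BVReg.recession ψ)).mono
    (h.measurable_energy.comp (measurable_approxGradient Ω u)).aestronglyMeasurable
    (Eventually.of_forall fun x => ?_)
  rw [Real.norm_of_nonneg (h.nonneg (norm_nonneg _)),
    Real.norm_of_nonneg (mul_nonneg h.recession_pos.le (norm_nonneg _))]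
  exact h.le_recession_mul (norm_nonneg _)

lemma IsConvexEnergy.energyMeasure_eq_ofReal (h : IsConvexEnergy ψ) {E : Set (Rn m)}
    (hE : MeasurableSet E) (hEΩ : E ⊆ Ω) :
    energyMeasure Ω ψ u E = ENNReal.ofReal ((∫ x in E, ψ ‖approxGradient Ω u x‖)
      + BVReg.recession ψ * (singularGradient Ω u).variation.real E) := by
  have h0 : ∀ x, 0 ≤ ψ ‖approxGradient Ω u x‖ := fun x => h.nonneg (norm_nonneg _)
  rw [energyMeasure_apply hE hEΩ, ENNReal.ofReal_add (integral_nonneg h0)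
    (mul_nonneg h.recession_pos.le measureReal_nonneg), ENNReal.ofReal_mul h.recession_pos.le,
    ofReal_measureReal, ofReal_integral_eq_lintegral_ofReal h.integrable_energy.integrableOn
    (Eventually.of_forall h0)]

lemma IsConvexEnergy.isFiniteMeasure_energyMeasure (h : IsConvexEnergy ψ) :
    IsFiniteMeasure (energyMeasure Ω ψ u) := by
  have h1 : IsFiniteMeasure ((volume.restrict Ω).withDensity
      (fun x => ENNReal.ofReal (ψ ‖approxGradient Ω u x‖))) := by
    refine isFiniteMeasure_withDensity_ofReal ?_
    exact (h.integrable_energy (Ω := Ω) (u := u)).integrableOn.2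
  have h2 : IsFiniteMeasure (ENNReal.ofReal (BVReg.recession ψ) •
      (singularGradient Ω u).variation.restrict Ω) :=
    Measure.smul_finite _ ENNReal.ofReal_ne_top
  rw [energyMeasure]
  infer_instance

lemma IsConvexEnergy.toReal_energyMeasure (h : IsConvexEnergy ψ) {E : Set (Rn m)}
    (hE : MeasurableSet E) (hEΩ : E ⊆ Ω) :
    (energyMeasure Ω ψ u E).toReal = (∫ x in E, ψ ‖approxGradient Ω u x‖)
      + BVReg.recession ψ * (singularGradient Ω u).variation.real E := by
  rw [h.energyMeasure_eq_ofReal hE hEΩ, ENNReal.toReal_ofReal]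
  exact add_nonneg (integral_nonneg fun x => h.nonneg (norm_nonneg _))
    (mul_nonneg h.recession_pos.le measureReal_nonneg)

/-- This is the source of the exact coefficient ψ^∞ on Lipschitz graphs. -/
lemma energyMeasure_of_null {E : Set (Rn m)} (hE : MeasurableSet E) (hEΩ : E ⊆ Ω)
    (h0 : volume E = 0) :
    energyMeasure Ω ψ u E = ENNReal.ofReal (recession ψ) * absD Ω u E := by
  rw [energyMeasure_apply hE hEΩ, singularGradient_variation_eq_absD Ω u hE h0,
    setLIntegral_measure_zero _ _ h0, zero_add]

lemma IsDualPair.integrableOn_conj {c p : ℝ → ℝ} {r : ℝ} (hd : IsDualPair ψ c p r)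
    (hW : volume W ≠ ⊤) {φ : Rn m → Rn m} (hφ : Measurable φ) (hφr : ∀ x, ‖φ x‖ ≤ r) :
    IntegrableOn (fun x => c ‖φ x‖) W := by
  obtain ⟨B, hB⟩ := isCompact_Icc.exists_bound_of_continuousOn (s := Icc (0 : ℝ) r)
    hd.continuous_conj.continuousOn
  have : IsFiniteMeasure (volume.restrict W) := isFiniteMeasure_restrict.2 hW
  exact Integrable.of_bound (hd.continuous_conj.measurable.comp hφ.norm).aestronglyMeasurable B
    (Eventually.of_forall fun x => hB _ ⟨norm_nonneg _, hφr x⟩)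

lemma IsTest.integral_inner_eq {φ : Rn m → Rn m} (hφ : IsTest W φ) (σ : Rn m → Rn m)
    (μ : Measure (Rn m)) :
    ∫ x, inner ℝ (φ x) (σ x) ∂μ = ∫ x in W, inner ℝ (φ x) (σ x) ∂μ := by
  rw [setIntegral_eq_integral_of_forall_compl_eq_zero]
  intro x hx
  rw [hφ.eq_zero hx, inner_zero_left]

/-- Test fields bound the energy from below. -/
lemma IsBV.le_energyMeasure (h : IsBV Ω u) (hψ : IsConvexEnergy ψ) {c p : ℝ → ℝ}
    (hd : IsDualPair ψ c p (recession ψ)) (hW : MeasurableSet W) (hWΩ : W ⊆ Ω)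
    (hvol : volume W ≠ ⊤) {φ : Rn m → Rn m} (hφ : IsTest W φ) (hφr : ∀ x, ‖φ x‖ ≤ recession ψ) :
    -(∫ x in Ω, u x * divergence φ x) - ∫ x in W, c ‖φ x‖ ≤ (energyMeasure Ω ψ u W).toReal := by
  obtain ⟨σ, hσ, hσ1, hpair⟩ := h.exists_polar_singular
  have hφm := hφ.continuous.measurable
  have hg := integrable_approxGradient Ω u
  rw [hpair φ (hφ.mono hWΩ), neg_neg, hψ.toReal_energyMeasure hW hWΩ,
    hφ.integral_inner_eq _ volume, hφ.integral_inner_eq _ (singularGradient Ω u).variation]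
  have h1 : (∫ x in W, inner ℝ (φ x) (approxGradient Ω u x)) - ∫ x in W, c ‖φ x‖
      ≤ ∫ x in W, ψ ‖approxGradient Ω u x‖ := by
    rw [← integral_sub (integrable_of_bound_inner hφm hφr hg.integrableOn)
      (hd.integrableOn_conj hvol hφm hφr)]
    refine integral_mono ((integrable_of_bound_inner hφm hφr hg.integrableOn).sub
      (hd.integrableOn_conj hvol hφm hφr)) hψ.integrable_energy.integrableOn fun x => ?_
    have := hd.young ‖φ x‖ ‖approxGradient Ω u x‖ (hφr x) (norm_nonneg _)
    have h2 := real_inner_le_norm (φ x) (approxGradient Ω u x)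
    simp only
    linarith
  have h2 : ∫ x in W, inner ℝ (φ x) (σ x) ∂(singularGradient Ω u).variation
      ≤ BVReg.recession ψ * (singularGradient Ω u).variation.real W := by
    have hσi := integrable_of_norm_eq_one hσ hσ1
    calc ∫ x in W, inner ℝ (φ x) (σ x) ∂(singularGradient Ω u).variation
        ≤ ∫ x in W, BVReg.recession ψ ∂(singularGradient Ω u).variation := by
          refine integral_mono_ae (integrable_of_bound_inner hφm hφr hσi.integrableOn)
            (integrable_const _) ?_
          filter_upwards [ae_restrict_of_ae hσ1] with x hx
          refine (real_inner_le_norm _ _).trans ?_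
          rw [hx, mul_one]
          exact hφr x
      _ = _ := by
          rw [setIntegral_const, smul_eq_mul, mul_comm]
  linarith

/-- The energy of an open set is at most any bound for its test fields. -/
theorem IsBV.energyMeasure_le (h : IsBV Ω u) (hψ : IsConvexEnergy ψ) {c p : ℝ → ℝ}
    (hd : IsDualPair ψ c p (recession ψ)) (hW : IsOpen W) (hWΩ : W ⊆ Ω)
    (hvol : volume W ≠ ⊤) {M : ℝ} (hM : ∀ φ : Rn m → Rn m, IsTest W φ →
      (∀ x, ‖φ x‖ ≤ recession ψ) →
      -(∫ x in Ω, u x * divergence φ x) - ∫ x in W, c ‖φ x‖ ≤ M) :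
    energyMeasure Ω ψ u W ≤ ENNReal.ofReal M := by
  classical
  obtain ⟨σ, hσ, hσ1, hpair⟩ := h.exists_polar_singular
  obtain ⟨N, hN, hN0, hNs⟩ := exists_singular_set Ω u
  set ν := (singularGradient Ω u).variation with hν
  set g := approxGradient Ω u with hgdef
  set r := BVReg.recession ψ with hr
  have hg : Integrable g := integrable_approxGradient Ω u
  have hgm : Measurable g := measurable_approxGradient Ω u
  have hσi := integrable_of_norm_eq_one hσ hσ1
  have hr0 : 0 < r := hψ.recession_pos
  -- The optimal field: p(‖g‖) g/‖g‖ gives equality in Young's inequality off N, and rσ pairs to r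
  -- on N. As N is Lebesgue null and carries the singular part, the two choices do not interfere.
  -- The indicator makes the bound r hold everywhere.
  set ξ : Rn m → Rn m := N.piecewise (({x | ‖σ x‖ ≤ 1}).indicator fun x => r • σ x)
    (fun x => p ‖g x‖ • ‖g x‖⁻¹ • g x) with hξ
  have hξm : Measurable ξ := by
    refine Measurable.piecewise hN ((hσ.const_smul r).indicator
      (measurableSet_le hσ.norm measurable_const)) ?_
    exact (hd.mono.measurable.comp hgm.norm).smul (hgm.norm.inv.smul hgm)
  have hξr : ∀ x, ‖ξ x‖ ≤ r := by
    intro x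
    by_cases hx : x ∈ N
    · rw [hξ, piecewise_eq_of_mem _ _ _ hx]
      by_cases h1 : ‖σ x‖ ≤ 1
      · rw [indicator_of_mem (by exact h1), norm_smul, Real.norm_of_nonneg hr0.le]
        nlinarith
      · rw [indicator_of_notMem (by exact h1), norm_zero]
        exact hr0.le
    · rw [hξ, piecewise_eq_of_notMem _ _ _ hx, norm_smul, norm_smul, norm_inv, norm_norm,
        Real.norm_of_nonneg (hd.nonneg _)]
      calc p ‖g x‖ * (‖g x‖⁻¹ * ‖g x‖) ≤ p ‖g x‖ * 1 := by
            gcongr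
            · exact hd.nonneg _
            · exact inv_mul_le_one
        _ ≤ r := by rw [mul_one]; exact hd.le _
  have hfin : IsFiniteMeasure (volume.restrict W) := isFiniteMeasure_restrict.2 hvol
  -- One sequence must converge almost everywhere for both parts of the gradient, hence the sum of
  -- the measures.
  obtain ⟨φ, hφ, hφr, hlim⟩ := exists_isTest_tendsto hr0 (volume.restrict W + ν) hW hξm hξr
  rw [ae_add_measure_iff] at hlim
  have hl1 : ∀ᵐ x ∂volume.restrict W, Tendsto (fun k => φ k x) atTop (𝓝 (ξ x)) := by
    filter_upwards [hlim.1, ae_restrict_mem hW.measurableSet] with x hx hxW using hx hxW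
  have hl2 : ∀ᵐ x ∂ν.restrict W, Tendsto (fun k => φ k x) atTop (𝓝 (ξ x)) := by
    filter_upwards [ae_restrict_of_ae hlim.2, ae_restrict_mem hW.measurableSet] with x hx hxW
      using hx hxW
  have hφm : ∀ k, Measurable (φ k) := fun k => (hφ k).continuous.measurable
  have hbd : ∀ (σ' : Rn m → Rn m) (k : ℕ) (x : Rn m),
      ‖inner ℝ (φ k x) (σ' x)‖ ≤ r * ‖σ' x‖ := fun σ' k x =>
    (norm_inner_le_norm _ _).trans (by gcongr; exact hφr k x)
  have t1 : Tendsto (fun k => ∫ x in W, inner ℝ (φ k x) (g x)) atTop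
      (𝓝 (∫ x in W, inner ℝ (ξ x) (g x))) := by
    refine tendsto_integral_of_dominated_convergence (fun x => r * ‖g x‖)
      (fun k => ((hφm k).inner hgm).aestronglyMeasurable) (hg.norm.const_mul r).integrableOn
      (fun k => Eventually.of_forall (hbd g k)) ?_
    filter_upwards [hl1] with x hx
    exact hx.inner tendsto_const_nhds
  have t2 : Tendsto (fun k => ∫ x in W, inner ℝ (φ k x) (σ x) ∂ν) atTop
      (𝓝 (∫ x in W, inner ℝ (ξ x) (σ x) ∂ν)) := by
    refine tendsto_integral_of_dominated_convergence (fun x => r * ‖σ x‖)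
      (fun k => ((hφm k).inner hσ).aestronglyMeasurable) (hσi.norm.const_mul r).integrableOn
      (fun k => Eventually.of_forall (hbd σ k)) ?_
    filter_upwards [hl2] with x hx
    exact hx.inner tendsto_const_nhds
  obtain ⟨B, hB⟩ := isCompact_Icc.exists_bound_of_continuousOn (s := Icc (0 : ℝ) r)
    hd.continuous_conj.continuousOn
  have t3 : Tendsto (fun k => ∫ x in W, c ‖φ k x‖) atTop (𝓝 (∫ x in W, c ‖ξ x‖)) := by
    refine tendsto_integral_of_dominated_convergence (fun _ => B)
      (fun k => (hd.continuous_conj.measurable.comp (hφm k).norm).aestronglyMeasurable)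
      (integrable_const _)
      (fun k => Eventually.of_forall fun x => hB _ ⟨norm_nonneg _, hφr k x⟩) ?_
    filter_upwards [hl1] with x hx
    exact (hd.continuous_conj.tendsto _).comp hx.norm
  have hle : (∫ x in W, inner ℝ (ξ x) (g x)) + (∫ x in W, inner ℝ (ξ x) (σ x) ∂ν)
      - (∫ x in W, c ‖ξ x‖) ≤ M := by
    refine le_of_tendsto ((t1.add t2).sub t3) (Eventually.of_forall fun k => ?_)
    have := hM (φ k) (hφ k) (hφr k)
    rwa [hpair (φ k) ((hφ k).mono hWΩ), neg_neg, (hφ k).integral_inner_eq _ volume,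
      (hφ k).integral_inner_eq _ ν] at this
  have e1 : (∫ x in W, inner ℝ (ξ x) (g x)) - (∫ x in W, c ‖ξ x‖) = ∫ x in W, ψ ‖g x‖ := by
    rw [← integral_sub (integrable_of_bound_inner hξm hξr hg.integrableOn)
      (hd.integrableOn_conj hvol hξm hξr)]
    refine integral_congr_ae (ae_restrict_of_ae ?_)
    have hNae : ∀ᵐ x, x ∉ N := measure_eq_zero_iff_ae_notMem.1 hN0
    filter_upwards [hNae] with x hx
    have hξx : ξ x = p ‖g x‖ • ‖g x‖⁻¹ • g x := by rw [hξ, piecewise_eq_of_notMem _ _ _ hx]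
    rw [hξx]
    rcases eq_or_ne (g x) 0 with h0 | h0
    · simp [h0, hd.conj_zero, hψ.zero]
    · have hn : ‖g x‖ ≠ 0 := norm_ne_zero_iff.2 h0
      rw [← hd.young_eq ‖g x‖ (norm_nonneg _), norm_smul, norm_smul, norm_inv, norm_norm,
        inv_mul_cancel₀ hn, mul_one, Real.norm_of_nonneg (hd.nonneg _), inner_smul_left,
        inner_smul_left, real_inner_self_eq_norm_sq]
      simp only [conj_trivial]
      field_simp
  have e2 : (∫ x in W, inner ℝ (ξ x) (σ x) ∂ν) = r * ν.real W := by
    have : ∫ x in W, inner ℝ (ξ x) (σ x) ∂ν = ∫ x in W, r ∂ν := by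
      refine integral_congr_ae (ae_restrict_of_ae ?_)
      have hNae : ∀ᵐ x ∂ν, x ∈ N := by
        rw [ae_iff]
        exact hNs
      filter_upwards [hNae, hσ1] with x hx h1
      have hξx : ξ x = r • σ x := by
        rw [hξ, piecewise_eq_of_mem _ _ _ hx, indicator_of_mem]
        exact h1.le
      rw [hξx, inner_smul_left, real_inner_self_eq_norm_sq, h1]
      simp
    rw [this, setIntegral_const, smul_eq_mul, mul_comm]
  rw [hψ.energyMeasure_eq_ofReal hW.measurableSet hWΩ]
  refine ENNReal.ofReal_le_ofReal ?_
  linarith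

end Energy

/-! ### Admissibility -/

section Admissible

variable {m : ℕ} {Ω : Set (Rn m)} {ψ : ℝ → ℝ} {u v : Rn m → ℝ}

lemma isDistribGradient_congr (h : u =ᵐ[volume.restrict Ω] v) :
    IsDistribGradient Ω u = IsDistribGradient Ω v := by
  ext μ
  have : ∀ φ : Rn m → ℝ, ∫ x in Ω, u x • gradient φ x = ∫ x in Ω, v x • gradient φ x := by
    intro φ
    refine integral_congr_ae ?_
    filter_upwards [h] with x hx
    rw [hx]
  simp only [IsDistribGradient, this]

lemma isBV_congr (h : u =ᵐ[volume.restrict Ω] v) : IsBV Ω u ↔ IsBV Ω v := by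
  rw [IsBV, IsBV, isDistribGradient_congr h]
  exact and_congr_left fun _ => integrable_congr h

lemma distribGradient_congr (h : u =ᵐ[volume.restrict Ω] v) :
    distribGradient Ω u = distribGradient Ω v := by
  unfold distribGradient
  rw [isDistribGradient_congr h]

lemma approxGradient_congr (h : u =ᵐ[volume.restrict Ω] v) :
    approxGradient Ω u = approxGradient Ω v := by
  ext1 x
  simp only [approxGradient, distribGradient_congr h]

lemma TV_congr (h : u =ᵐ[volume.restrict Ω] v) : TV Ω ψ u = TV Ω ψ v := by
  by_cases hv : IsBV Ω v
  · rw [TV, TV, if_pos hv, if_pos ((isBV_congr h).2 hv), singularGradient, singularGradient,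
      distribGradient_congr h, approxGradient_congr h]
  · rw [TV_of_not_isBV hv, TV_of_not_isBV (mt (isBV_congr h).1 hv)]

lemma IsBV.linear_comb (hu : IsBV Ω u) (hv : IsBV Ω v) (hΩ : MeasurableSet Ω) (a b : ℝ) :
    IsBV Ω (a • u + b • v) := by
  refine ⟨(hu.1.smul a).add (hv.1.smul b), a • distribGradient Ω u + b • distribGradient Ω v,
    ?_, fun φ h1 h2 h3 => ?_⟩
  · rw [VectorMeasure.variation_apply_eq_zero hΩ.compl]
    intro t ht htm
    have e1 := (VectorMeasure.variation_apply_eq_zero hΩ.compl).1 hu.isDistribGradient.1 t ht htm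
    have e2 := (VectorMeasure.variation_apply_eq_zero hΩ.compl).1 hv.isDistribGradient.1 t ht htm
    rw [_root_.add_apply, _root_.smul_apply, _root_.smul_apply, e1, e2]
    simp
  · have hi : ∀ μ : Measure (Rn m), IsFiniteMeasure μ → Integrable φ μ := fun μ _ =>
      h1.continuous.integrable_of_hasCompactSupport h2
    obtain ⟨C, hC⟩ := Continuous.bounded_above_of_compact_support
      (f := fun x => gradient φ x)
      ((InnerProductSpace.toDual ℝ (Rn m)).symm.continuous.comp
        (h1.continuous_fderiv (by simp)))
      ((h2.fderiv ℝ).comp_left (g := (InnerProductSpace.toDual ℝ (Rn m)).symm) (map_zero _))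
    have hgc : Continuous fun x => gradient φ x :=
      (InnerProductSpace.toDual ℝ (Rn m)).symm.continuous.comp (h1.continuous_fderiv (by simp))
    have hint : ∀ w : Rn m → ℝ, IntegrableOn w Ω →
        Integrable (fun x => w x • gradient φ x) (volume.restrict Ω) := by
      intro w hw
      exact Integrable.smul_bdd hw C hgc.aestronglyMeasurable (Eventually.of_forall hC)
    have e : ∀ x, (a • u + b • v) x • gradient φ x
        = a • (u x • gradient φ x) + b • (v x • gradient φ x) := by
      intro x
      simp only [Pi.add_apply, Pi.smul_apply, smul_eq_mul, add_smul, mul_smul]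
    simp_rw [e]
    rw [integral_add (f := fun x => a • (u x • gradient φ x))
      (g := fun x => b • (v x • gradient φ x))
      ((hint u hu.1).smul a) ((hint v hv.1).smul b), integral_smul, integral_smul,
      hu.isDistribGradient.2 φ h1 h2 h3, hv.isDistribGradient.2 φ h1 h2 h3,
      VectorMeasure.integral_add_vectorMeasure, VectorMeasure.integral_smul_vectorMeasure,
      VectorMeasure.integral_smul_vectorMeasure, neg_add, smul_neg, smul_neg]
    · exact hi _ (isFiniteMeasure_variation _)
    · exact hi _ (isFiniteMeasure_variation _)

/-- A supremum of expressions affine in u. Zero weights are treated first, so that an infinite value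
makes the right-hand side infinite. -/
lemma TV_convex (hψ : IsConvexEnergy ψ) (hΩ : IsOpen Ω) (hvol : volume Ω ≠ ⊤) {a b : ℝ}
    (ha : 0 ≤ a) (hb : 0 ≤ b) (hab : a + b = 1) :
    TV Ω ψ (a • u + b • v) ≤ ENNReal.ofReal a * TV Ω ψ u + ENNReal.ofReal b * TV Ω ψ v := by
  obtain ⟨c, p, hd⟩ := hψ.exists_isDualPair
  rcases ha.eq_or_lt with rfl | ha
  · obtain rfl : b = 1 := by linarith
    simp
  rcases hb.eq_or_lt with rfl | hb
  · obtain rfl : a = 1 := by linarith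
    simp
  by_cases hu : IsBV Ω u
  swap
  · rw [TV_of_not_isBV hu, ENNReal.mul_top (by simpa using ha), top_add]
    exact le_top
  by_cases hv : IsBV Ω v
  swap
  · rw [TV_of_not_isBV hv, ENNReal.mul_top (by simpa using hb), add_top]
    exact le_top
  have := hψ.isFiniteMeasure_energyMeasure (Ω := Ω) (u := u)
  have := hψ.isFiniteMeasure_energyMeasure (Ω := Ω) (u := v)
  rw [hu.TV_eq hΩ, hv.TV_eq hΩ, (hu.linear_comb hv hΩ.measurableSet a b).TV_eq hΩ]
  refine ((hu.linear_comb hv hΩ.measurableSet a b).energyMeasure_le hψ hd hΩ subset_rfl hvol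
    (M := a * (energyMeasure Ω ψ u Ω).toReal + b * (energyMeasure Ω ψ v Ω).toReal) ?_).trans_eq ?_
  · intro φ hφ hφr
    have h1 := hu.le_energyMeasure hψ hd hΩ.measurableSet subset_rfl hvol hφ hφr
    have h2 := hv.le_energyMeasure hψ hd hΩ.measurableSet subset_rfl hvol hφ hφr
    have e : ∫ x in Ω, (a • u + b • v) x * divergence φ x
        = a * (∫ x in Ω, u x * divergence φ x) + b * ∫ x in Ω, v x * divergence φ x := by
      rw [← integral_const_mul, ← integral_const_mul,
        ← integral_add ((hφ.integrable_mul_divergence hu.1).const_mul a)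
          ((hφ.integrable_mul_divergence hv.1).const_mul b)]
      congr 1
      ext x
      simp only [Pi.add_apply, Pi.smul_apply, smul_eq_mul]
      ring
    rw [e]
    have h1' := mul_le_mul_of_nonneg_left h1 ha.le
    have h2' := mul_le_mul_of_nonneg_left h2 hb.le
    have : b = 1 - a := by linarith
    subst this
    linarith
  · rw [ENNReal.ofReal_add (by positivity) (by positivity), ENNReal.ofReal_mul ha.le,
      ENNReal.ofReal_mul hb.le, ENNReal.ofReal_toReal (measure_ne_top _ _),
      ENNReal.ofReal_toReal (measure_ne_top _ _)]

lemma tendsto_integral_mul_of_normL1 {w : ℕ → Rn m → ℝ} {w₀ b : Rn m → ℝ}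
    (hw : ∀ k, IntegrableOn (w k) Ω) (hw₀ : IntegrableOn w₀ Ω)
    (hlim : Tendsto (fun k => normL1 Ω (w k - w₀)) atTop (𝓝 0))
    (hb : AEStronglyMeasurable b (volume.restrict Ω)) {C : ℝ} (hC : ∀ x, ‖b x‖ ≤ C) :
    Tendsto (fun k => ∫ x in Ω, w k x * b x) atTop (𝓝 (∫ x in Ω, w₀ x * b x)) := by
  have hbC : ∀ᵐ x ∂volume.restrict Ω, ‖b x‖ ≤ C := Eventually.of_forall hC
  refine tendsto_integral_of_L1 _ (hw₀.mul_bdd hb hbC).aestronglyMeasurable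
    (Eventually.of_forall fun k => (hw k).mul_bdd hb hbC) ?_
  have h1 : Tendsto (fun k => normL1 Ω (w k - w₀) * ENNReal.ofReal C) atTop (𝓝 0) := by
    have := ENNReal.Tendsto.mul_const hlim (b := ENNReal.ofReal C)
      (Or.inr ENNReal.ofReal_ne_top)
    rwa [zero_mul] at this
  refine tendsto_of_tendsto_of_tendsto_of_le_of_le tendsto_const_nhds h1 (fun _ => zero_le) ?_
  intro k
  simp only
  rw [normL1, ← lintegral_mul_const' _ _ ENNReal.ofReal_ne_top]
  refine lintegral_mono fun x => ?_
  simp only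
  rw [← sub_mul, enorm_mul, ← ofReal_norm (b x)]
  gcongr
  · exact le_rfl
  · exact hC x

/-- A supremum of L¹-continuous functionals; strong L¹ convergence suffices, without convergence of
the gradients. -/
lemma TV_lsc (hψ : IsConvexEnergy ψ) (hΩ : IsOpen Ω) (hvol : volume Ω ≠ ⊤) {w : ℕ → Rn m → ℝ}
    {w₀ : Rn m → ℝ} (hw : ∀ k, IsBV Ω (w k)) (hw₀ : IsBV Ω w₀)
    (hlim : Tendsto (fun k => normL1 Ω (w k - w₀)) atTop (𝓝 0)) :
    TV Ω ψ w₀ ≤ liminf (fun k => TV Ω ψ (w k)) atTop := by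
  obtain ⟨c, p, hd⟩ := hψ.exists_isDualPair
  set L := liminf (fun k => TV Ω ψ (w k)) atTop with hL
  rcases eq_or_ne L ⊤ with h | h
  · rw [h]; exact le_top
  rw [hw₀.TV_eq hΩ, ← ENNReal.ofReal_toReal h]
  refine hw₀.energyMeasure_le hψ hd hΩ subset_rfl hvol fun φ hφ hφr => ?_
  rw [← ENNReal.ofReal_le_iff_le_toReal h]
  obtain ⟨C, hC⟩ := hφ.exists_bound_divergence
  have h1 := tendsto_integral_mul_of_normL1 (fun k => (hw k).1) hw₀.1 hlim
    hφ.continuous_divergence.aestronglyMeasurable hC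
  have h2 := ENNReal.tendsto_ofReal (h1.neg.sub_const (∫ x in Ω, c ‖φ x‖))
  rw [← h2.liminf_eq]
  refine liminf_le_liminf (Eventually.of_forall fun k => ?_)
  have := hψ.isFiniteMeasure_energyMeasure (Ω := Ω) (u := w k)
  rw [(hw k).TV_eq hΩ]
  exact ENNReal.ofReal_le_of_le_toReal
    ((hw k).le_energyMeasure hψ hd hΩ.measurableSet subset_rfl hvol hφ hφr)

lemma IsBV.totalVariation_le (h : IsBV Ω u) :
    totalVariation Ω u ≤ absD Ω u Ω := by
  obtain ⟨σ, hσ, hσ1, hpair⟩ := h.exists_polar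
  refine iSup_le fun φ => iSup_le fun h1 => iSup_le fun h2 => iSup_le fun h3 => iSup_le fun h4 => ?_
  have hφ : IsTest Ω φ := ⟨h1, h2, h3⟩
  refine ENNReal.ofReal_le_of_le_toReal ?_
  change ∫ x in Ω, u x * divergence φ x ≤ _
  rw [hpair φ hφ, hφ.integral_inner_eq, ← integral_neg]
  have hσi := integrable_of_norm_eq_one hσ hσ1
  calc ∫ x in Ω, -inner ℝ (φ x) (σ x) ∂(absD Ω u) ≤ ∫ x in Ω, 1 ∂(absD Ω u) := by
        refine integral_mono_ae (integrable_of_bound_inner hφ.continuous.measurable h4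
          hσi.integrableOn).neg (integrable_const _) ?_
        filter_upwards [ae_restrict_of_ae hσ1] with x hx
        have := (abs_le.1 (abs_real_inner_le_norm (φ x) (σ x))).1
        rw [hx, mul_one] at this
        have := h4 x
        linarith
    _ = _ := by
        rw [setIntegral_const, smul_eq_mul, mul_one]
        rfl

lemma TV_coercive (hψ : IsConvexEnergy ψ) (hΩ : IsOpen Ω) (hvol : volume Ω ≠ ⊤) :
    ∃ C : ℝ, 0 < C ∧ ∀ u, IntegrableOn u Ω →
      totalVariation Ω u ≤ ENNReal.ofReal C * (1 + normL1 Ω u + TV Ω ψ u) := by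
  obtain ⟨c₀, hc₀, hle⟩ := hψ.exists_le_add
  have hr := hψ.recession_pos
  set r := BVReg.recession ψ with hrdef
  -- Integrating r t ≤ ψ(t) + c₀ gives r |Du|(Ω) ≤ TV + c₀ |Ω|.
  refine ⟨r⁻¹ * (1 + c₀ * volume.real Ω), by positivity, fun u _ => ?_⟩
  by_cases hu : IsBV Ω u
  swap
  · rw [TV_of_not_isBV hu, add_top, ENNReal.mul_top]
    · exact le_top
    · simp only [ne_eq, ENNReal.ofReal_eq_zero, not_le]
      positivity
  refine hu.totalVariation_le.trans ?_
  set X := energyMeasure Ω ψ u Ω with hX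
  have key : ENNReal.ofReal r * absD Ω u Ω ≤ X + ENNReal.ofReal (c₀ * volume.real Ω) := by
    calc ENNReal.ofReal r * absD Ω u Ω
        ≤ ENNReal.ofReal r * ((∫⁻ x in Ω, ‖approxGradient Ω u x‖ₑ)
          + (singularGradient Ω u).variation Ω) := by
          gcongr
          have := absD_le Ω u Ω
          rwa [Measure.add_apply, withDensity_apply _ hΩ.measurableSet] at this
      _ = (∫⁻ x in Ω, ENNReal.ofReal (r * ‖approxGradient Ω u x‖))
          + ENNReal.ofReal r * (singularGradient Ω u).variation Ω := by
          rw [mul_add, ← lintegral_const_mul' _ _ ENNReal.ofReal_ne_top]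
          congr 2
          ext x
          rw [ENNReal.ofReal_mul hr.le, ofReal_norm]
      _ ≤ (∫⁻ x in Ω, (ENNReal.ofReal (ψ ‖approxGradient Ω u x‖) + ENNReal.ofReal c₀))
          + ENNReal.ofReal r * (singularGradient Ω u).variation Ω := by
          gcongr with x
          rw [← ENNReal.ofReal_add (hψ.nonneg (norm_nonneg _)) hc₀]
          exact ENNReal.ofReal_le_ofReal (hle _ (norm_nonneg _))
      _ = X + ENNReal.ofReal (c₀ * volume.real Ω) := by
          rw [lintegral_add_right _ measurable_const, setLIntegral_const, hX,
            energyMeasure_apply hΩ.measurableSet subset_rfl, ENNReal.ofReal_mul hc₀,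
            ofReal_measureReal hvol, add_right_comm]
  have h2 : absD Ω u Ω = ENNReal.ofReal r⁻¹ * (ENNReal.ofReal r * absD Ω u Ω) := by
    rw [← mul_assoc, ← ENNReal.ofReal_mul (by positivity), inv_mul_cancel₀ hr.ne',
      ENNReal.ofReal_one, one_mul]
  rw [h2, hu.TV_eq hΩ, ← hX, ENNReal.ofReal_mul (by positivity), mul_assoc]
  gcongr ENNReal.ofReal r⁻¹ * ?_
  refine key.trans ?_
  rw [ENNReal.ofReal_add zero_le_one (by positivity), ENNReal.ofReal_one]
  calc X + ENNReal.ofReal (c₀ * volume.real Ω)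
      ≤ (1 + normL1 Ω u + X) + ENNReal.ofReal (c₀ * volume.real Ω) * (1 + normL1 Ω u + X) := by
        gcongr
        · exact le_add_self
        · calc ENNReal.ofReal (c₀ * volume.real Ω)
              = ENNReal.ofReal (c₀ * volume.real Ω) * 1 := (mul_one _).symm
            _ ≤ _ := by
              gcongr
              rw [add_assoc]
              exact le_self_add
    _ = _ := by ring

theorem isAdmissible_TV (hψ : IsConvexEnergy ψ) (hΩ : IsOpen Ω) (hvol : volume Ω ≠ ⊤) :
    IsAdmissible Ω (TV Ω ψ) where
  congr _ _ _ h := TV_congr h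
  convex _ _ _ _ _ _ ha hb hab := TV_convex hψ hΩ hvol ha hb hab
  lsc _ _ h := TV_lsc hψ hΩ hvol h.1 h.2.1 h.2.2.1
  coercive := TV_coercive hψ hΩ hvol

end Admissible

end BVReg

namespace BVReg

/-! ### A criterion for bounded variation -/

/-- A linear functional that is bounded with respect to a seminorm pulled back from a Hilbert space
is represented by an element of the Hilbert space. -/
lemma exists_inner_eq {V H : Type*} [AddCommGroup V] [Module ℝ V] [NormedAddCommGroup H]
    [InnerProductSpace ℝ H] [CompleteSpace H] (ι : V →ₗ[ℝ] H) (ℓ : V →ₗ[ℝ] ℝ) {C : ℝ}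
    (hC : ∀ v, |ℓ v| ≤ C * ‖ι v‖) : ∃ h : H, ∀ v, ℓ v = inner ℝ h (ι v) := by
  -- The bound makes ℓ vanish on the kernel of ι, so ℓ factors through a bounded functional on the
  -- range; Hahn–Banach extends it and Riesz represents it.
  obtain ⟨g, hg⟩ := ι.rangeRestrict.exists_rightInverse_of_surjective
    (LinearMap.range_eq_top.2 ι.surjective_rangeRestrict)
  have hg' : ∀ y : LinearMap.range ι, ι (g y) = y := fun y =>
    congrArg Subtype.val (LinearMap.congr_fun hg y)
  have hker : ∀ v, ι v = 0 → ℓ v = 0 := fun v hv => by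
    have := hC v
    rw [hv, norm_zero, mul_zero] at this
    exact abs_nonpos_iff.1 this
  have hb : ∀ y : LinearMap.range ι, ‖(ℓ.comp g) y‖ ≤ C * ‖y‖ := fun y => by
    have := hC (g y)
    rwa [hg' y] at this
  obtain ⟨F, hF, -⟩ := exists_extension_norm_eq (LinearMap.range ι)
    ((ℓ.comp g).mkContinuous C hb)
  refine ⟨(InnerProductSpace.toDual ℝ H).symm F, fun v => ?_⟩
  rw [InnerProductSpace.toDual_symm_apply]
  have h1 := hF ⟨ι v, LinearMap.mem_range_self ι v⟩
  simp only [LinearMap.mkContinuous_apply, LinearMap.comp_apply] at h1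
  rw [h1]
  have h2 := hker (v - g ⟨ι v, LinearMap.mem_range_self ι v⟩) (by rw [map_sub, hg', sub_self])
  rw [map_sub, sub_eq_zero] at h2
  exact h2

section Criterion

variable {m : ℕ} {Ω : Set (Rn m)}

/-- The space of test fields on `Ω`. -/
def testSubmodule (Ω : Set (Rn m)) : Submodule ℝ (Rn m → Rn m) where
  carrier := {φ | IsTest Ω φ}
  zero_mem' := ⟨contDiff_const, HasCompactSupport.zero, by simp [tsupport, Function.support_zero]⟩
  add_mem' {φ χ} h1 h2 := ⟨h1.contDiff.add h2.contDiff,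
    h1.hasCompactSupport.add h2.hasCompactSupport,
    (tsupport_add φ χ).trans (union_subset h1.tsupport_subset h2.tsupport_subset)⟩
  smul_mem' a φ h := ⟨h.contDiff.const_smul a, h.hasCompactSupport.smul_left (f := fun _ => a),
    (closure_mono (Function.support_const_smul_subset a φ)).trans h.tsupport_subset⟩

lemma divergence_add {φ χ : Rn m → Rn m} (hφ : Differentiable ℝ φ) (hχ : Differentiable ℝ χ)
    (x : Rn m) : divergence (φ + χ) x = divergence φ x + divergence χ x := by
  rw [divergence, divergence, divergence, fderiv_add (hφ x) (hχ x),
    ContinuousLinearMap.toLinearMap_add, map_add]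

lemma divergence_smul {φ : Rn m → Rn m} (hφ : Differentiable ℝ φ) (a : ℝ)
    (x : Rn m) : divergence (a • φ) x = a * divergence φ x := by
  rw [divergence, divergence, fderiv_const_smul (hφ x),
    ContinuousLinearMap.toLinearMap_smul, map_smul, smul_eq_mul]

lemma divergence_smul_single {φ : Rn m → ℝ} (hφ : Differentiable ℝ φ) (i : Fin m) (x : Rn m) :
    divergence (fun x => φ x • (EuclideanSpace.single i (1 : ℝ) : Rn m)) x = gradient φ x i := by
  classical
  rw [divergence_eq_sum ((hφ x).smul_const _), Finset.sum_eq_single i]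
  · have : (fun y => (φ y • (EuclideanSpace.single i (1 : ℝ) : Rn m)) i) = φ := by
      ext y
      simp
    rw [this]
  · intro j _ hj
    have : (fun y => (φ y • (EuclideanSpace.single i (1 : ℝ) : Rn m)) j) = fun _ => 0 := by
      ext y
      simp [hj]
    rw [this, gradient_coord]
    simp
  · simp

/-- A function whose distributional gradient is dominated by a finite measure is of bounded
variation. -/
theorem isBV_of_abs_le {w : Rn m → ℝ} (hΩ : IsOpen Ω) (hw : IntegrableOn w Ω)
    (μ : Measure (Rn m)) [IsFiniteMeasure μ]
    (h : ∀ φ, IsTest Ω φ → |∫ x in Ω, w x * divergence φ x| ≤ ∫ x, ‖φ x‖ ∂μ) : IsBV Ω w := by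
  have hmem : ∀ φ : testSubmodule Ω, MemLp (φ : Rn m → Rn m) 2 μ := fun φ =>
    φ.2.continuous.memLp_of_hasCompactSupport φ.2.hasCompactSupport
  -- As μ is finite, the L¹(μ) bound implies an L²(μ) bound. The functional is thus represented by
  -- some η ∈ L²(μ) ⊆ L¹(μ), and -η μ restricted to Ω is the gradient.
  let ι : testSubmodule Ω →ₗ[ℝ] Lp (Rn m) 2 μ :=
    { toFun := fun φ => (hmem φ).toLp
      map_add' := fun φ χ => MemLp.toLp_add (hmem φ) (hmem χ)
      map_smul' := fun a φ => MemLp.toLp_const_smul a (hmem φ) }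
  let ℓ : testSubmodule Ω →ₗ[ℝ] ℝ :=
    { toFun := fun φ => ∫ x in Ω, w x * divergence φ x
      map_add' := fun φ χ => by
        rw [← integral_add (φ.2.integrable_mul_divergence hw) (χ.2.integrable_mul_divergence hw)]
        congr 1
        ext x
        rw [Submodule.coe_add, divergence_add φ.2.differentiable χ.2.differentiable, mul_add]
      map_smul' := fun a φ => by
        rw [RingHom.id_apply, smul_eq_mul, ← integral_const_mul]
        congr 1
        ext x
        rw [Submodule.coe_smul, divergence_smul φ.2.differentiable]
        ring }
  have hbound : ∀ φ : testSubmodule Ω,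
      |ℓ φ| ≤ (μ univ ^ (1 / (1 : ℝ≥0∞).toReal - 1 / (2 : ℝ≥0∞).toReal)).toReal * ‖ι φ‖ := by
    intro φ
    refine (h φ φ.2).trans ?_
    have h1 : ∫ x, ‖(φ : Rn m → Rn m) x‖ ∂μ = (eLpNorm (φ : Rn m → Rn m) 1 μ).toReal := by
      rw [eLpNorm_one_eq_lintegral_enorm,
        integral_norm_eq_lintegral_enorm φ.2.continuous.aestronglyMeasurable]
    have h2 := eLpNorm_le_eLpNorm_mul_rpow_measure_univ (μ := μ) (p := 1) (q := 2)
      (by norm_num) φ.2.continuous.aestronglyMeasurable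
    have hfin : μ univ ^ (1 / (1 : ℝ≥0∞).toReal - 1 / (2 : ℝ≥0∞).toReal) ≠ ⊤ :=
      ENNReal.rpow_ne_top_of_nonneg (by norm_num) (measure_ne_top μ univ)
    rw [h1, show ‖ι φ‖ = (eLpNorm (φ : Rn m → Rn m) 2 μ).toReal from Lp.norm_toLp _ (hmem φ),
      mul_comm, ← ENNReal.toReal_mul]
    exact ENNReal.toReal_mono (ENNReal.mul_ne_top (hmem φ).2.ne hfin) h2
  obtain ⟨η, hη⟩ := exists_inner_eq ι ℓ hbound
  have hηi : Integrable η μ := (Lp.memLp η).integrable (by norm_num)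
  have hηn : Integrable (fun x => -η x) (μ.restrict Ω) := hηi.neg.integrableOn
  have hpair : ∀ φ, IsTest Ω φ → ∫ x in Ω, w x * divergence φ x = ∫ x, inner ℝ (η x) (φ x) ∂μ := by
    intro φ hφ
    refine (hη ⟨φ, hφ⟩).trans ?_
    rw [L2.inner_def]
    refine integral_congr_ae ?_
    filter_upwards [(hmem ⟨φ, hφ⟩).coeFn_toLp] with x hx
    rw [show (ι ⟨φ, hφ⟩ : Rn m → Rn m) x = φ x from hx]
  refine ⟨hw, (μ.restrict Ω).withDensityᵥ (fun x => -η x), ?_, fun φ h1 h2 h3 => ?_⟩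
  · rw [Measure.variation_withDensityᵥ hηn]
    exact withDensity_absolutelyContinuous _ _ (by
      rw [Measure.restrict_apply hΩ.measurableSet.compl, compl_inter_self, measure_empty])
  · have hφi : ∀ μ : Measure (Rn m), IsFiniteMeasure μ → Integrable φ μ := fun μ _ =>
      h1.continuous.integrable_of_hasCompactSupport h2
    rw [integral_withDensityᵥ hηn
      (hφi _ (isFiniteMeasure_withDensity hηn.2.ne))]
    have hgc : Continuous fun x => gradient φ x :=
      (InnerProductSpace.toDual ℝ (Rn m)).symm.continuous.comp (h1.continuous_fderiv (by simp))
    obtain ⟨C, hC⟩ := hgc.bounded_above_of_compact_support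
      ((h2.fderiv ℝ).comp_left (g := (InnerProductSpace.toDual ℝ (Rn m)).symm) (map_zero _))
    have hi1 : Integrable (fun x => w x • gradient φ x) (volume.restrict Ω) :=
      Integrable.smul_bdd hw C hgc.aestronglyMeasurable (Eventually.of_forall hC)
    obtain ⟨C', hC'⟩ := h1.continuous.bounded_above_of_compact_support h2
    have hi2 : Integrable (fun x => φ x • -η x) (μ.restrict Ω) :=
      hηn.bdd_smul C' h1.continuous.aestronglyMeasurable
        (Eventually.of_forall hC')
    ext i
    have htest := isTest_smul_const h1 h2 h3 (EuclideanSpace.single i (1 : ℝ))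
    have h4 := hpair _ htest
    simp_rw [divergence_smul_single (h1.differentiable (by simp))] at h4
    rw [PiLp.neg_apply, integral_apply_coord hi1, integral_apply_coord hi2, ← integral_neg]
    refine Eq.trans ?_ (h4.trans ?_)
    · rfl
    · rw [setIntegral_eq_integral_of_forall_compl_eq_zero]
      · congr 1
        ext x
        simp [inner_smul_right, EuclideanSpace.inner_single_right]
      · intro x hx
        have : φ x = 0 := by
          by_contra h0
          exact hx (h3 (subset_tsupport _ h0))
        simp [this]

end Criterion

/-! ### Integration by parts for Lipschitz functions -/

section Lipschitz

variable {m : ℕ} {Ω : Set (Rn m)}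

lemma LipschitzOnWith.ae_differentiableAt_of_isOpen {F : Type*} [NormedAddCommGroup F]
    [NormedSpace ℝ F] [FiniteDimensional ℝ F] {K : ℝ≥0} {f : Rn m → F} (hΩ : IsOpen Ω)
    (hf : LipschitzOnWith K f Ω) : ∀ᵐ x ∂volume.restrict Ω, DifferentiableAt ℝ f x := by
  filter_upwards [ae_restrict_of_ae (hf.ae_differentiableWithinAt_of_mem (μ := volume)),
    ae_restrict_mem hΩ.measurableSet] with x hx hxΩ
  exact (hx hxΩ).differentiableAt (hΩ.mem_nhds hxΩ)

/-- Extend w to a Lipschitz function on the whole space, integrate by parts in each coordinate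
against the compactly supported components of φ, and identify line derivatives with the gradient by
Rademacher's theorem. The extension does not matter, since φ vanishes outside Ω. -/
theorem integral_mul_divergence_of_lipschitzOn {K : ℝ≥0} {w : Rn m → ℝ} (hΩ : IsOpen Ω)
    (hw : LipschitzOnWith K w Ω) {φ : Rn m → Rn m} (hφ : IsTest Ω φ) :
    Integrable (fun x => inner ℝ (φ x) (gradient w x)) (volume.restrict Ω) ∧
    ∫ x in Ω, w x * divergence φ x = -∫ x in Ω, inner ℝ (φ x) (gradient w x) := by
  obtain ⟨f, hf, hfw⟩ := hw.extend_real
  have hgrad : ∀ x ∈ Ω, gradient w x = gradient f x := by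
    intro x hx
    have : w =ᶠ[𝓝 x] f := by
      filter_upwards [hΩ.mem_nhds hx] with y hy using hfw hy
    rw [gradient, gradient, this.fderiv_eq]
  have hlip : ∀ i, ∃ D : ℝ≥0, LipschitzWith D fun x => φ x i := fun i =>
    ⟨_, ((hφ.contDiff_coord i).of_le (by exact_mod_cast le_top)).lipschitzWith_of_hasCompactSupport
      (hφ.hasCompactSupport_coord i) one_ne_zero |>.choose_spec⟩
  choose D hD using hlip
  have hibp : ∀ i, ∫ x, lineDeriv ℝ f x (EuclideanSpace.single i 1) * φ x i
      = -∫ x, f x * gradient (fun y => φ y i) x i := by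
    intro i
    rw [LipschitzWith.integral_lineDeriv_mul_eq hf (hD i) (hφ.hasCompactSupport_coord i),
      ← integral_neg]
    congr 1
    ext x
    rw [((hφ.contDiff_coord i).differentiable (by simp) x).lineDeriv_eq_fderiv, map_neg,
      gradient_coord]
    ring
  have hint : ∀ i, Integrable fun x => lineDeriv ℝ f x (EuclideanSpace.single i 1) * φ x i := by
    intro i
    have h1 : MemLp (fun x => lineDeriv ℝ f x (EuclideanSpace.single i 1)) ∞ volume :=
      hf.memLp_lineDeriv _
    exact ((hφ.contDiff_coord i).continuous.integrable_of_hasCompactSupport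
      (hφ.hasCompactSupport_coord i)).mul_of_top_right h1
  have hae : ∀ᵐ x, inner ℝ (φ x) (gradient f x)
      = ∑ i, lineDeriv ℝ f x (EuclideanSpace.single i 1) * φ x i := by
    filter_upwards [hf.ae_differentiableAt] with x hx
    rw [PiLp.inner_apply]
    refine Finset.sum_congr rfl fun i _ => ?_
    rw [hx.lineDeriv_eq_fderiv, gradient_coord]
    simp
  have hint2 : Integrable fun x => inner ℝ (φ x) (gradient f x) :=
    (integrable_finsetSum _ fun i _ => hint i).congr (hae.mono fun x hx => hx.symm)
  refine ⟨hint2.integrableOn.congr ?_, ?_⟩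
  · filter_upwards [ae_restrict_mem hΩ.measurableSet] with x hx
    rw [hgrad x hx]
  have e1 : ∫ x in Ω, inner ℝ (φ x) (gradient w x) = ∫ x, inner ℝ (φ x) (gradient f x) := by
    rw [← setIntegral_eq_integral_of_forall_compl_eq_zero (s := Ω)
      (f := fun x => inner ℝ (φ x) (gradient f x))]
    · refine setIntegral_congr_fun hΩ.measurableSet fun x hx => ?_
      rw [hgrad x hx]
    · intro x hx
      rw [hφ.eq_zero hx, inner_zero_left]
  have e2 : ∫ x in Ω, w x * divergence φ x = ∫ x, f x * divergence φ x := by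
    rw [← setIntegral_eq_integral_of_forall_compl_eq_zero (s := Ω)
      (f := fun x => f x * divergence φ x)]
    · refine setIntegral_congr_fun hΩ.measurableSet fun x hx => ?_
      rw [hfw hx]
    · intro x hx
      rw [divergence_eq_zero_of_notMem fun h => hx (hφ.tsupport_subset h), mul_zero]
  rw [e1, e2, integral_congr_ae hae, integral_finsetSum _ fun i _ => hint i]
  simp_rw [hibp, hφ.divergence_eq, Finset.mul_sum]
  rw [integral_finsetSum, Finset.sum_neg_distrib, neg_neg]
  intro i _
  exact (hf.continuous.mul ((EuclideanSpace.proj (𝕜 := ℝ) i).continuous.comp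
    (hφ.continuous_gradient_coord i))).integrable_of_hasCompactSupport
    (((hφ.hasCompactSupport_gradient_coord i).comp_left (g := fun v : Rn m => v i) rfl).mul_left)

end Lipschitz

end BVReg

namespace BVReg

/-! ### Mollification of functions of bounded variation -/

section Mollify

variable {m : ℕ} {Ω : Set (Rn m)} {u : Rn m → ℝ}

/-- The mollification of the extension of `u` by zero. -/
noncomputable def mollify (ρ : ContDiffBump (0 : Rn m)) (Ω : Set (Rn m)) (u : Rn m → ℝ) :
    Rn m → ℝ :=
  convolution (ρ.normed volume) (Ω.indicator u) (ContinuousLinearMap.lsmul ℝ ℝ) volume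

variable (ρ : ContDiffBump (0 : Rn m))

lemma contDiff_mollify (hΩ : MeasurableSet Ω) (hu : IntegrableOn u Ω) :
    ContDiff ℝ ∞ (mollify ρ Ω u) :=
  ρ.hasCompactSupport_normed.contDiff_convolution_left (n := ⊤) _ ρ.contDiff_normed
    ((integrable_indicator_iff hΩ).2 hu).locallyIntegrable

lemma hasCompactSupport_mollify (hb : Bornology.IsBounded Ω) :
    HasCompactSupport (mollify ρ Ω u) :=
  ρ.hasCompactSupport_normed.convolution _
    (HasCompactSupport.of_support_subset_isCompact hb.isCompact_closure
      (support_indicator_subset.trans subset_closure))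

lemma exists_lipschitzWith_mollify (hΩ : MeasurableSet Ω) (hb : Bornology.IsBounded Ω)
    (hu : IntegrableOn u Ω) : ∃ K : ℝ≥0, LipschitzWith K (mollify ρ Ω u) :=
  ContDiff.lipschitzWith_of_hasCompactSupport (hasCompactSupport_mollify ρ hb)
    (contDiff_mollify ρ hΩ hu) (by simp)

lemma mollify_apply (hΩ : MeasurableSet Ω) (x : Rn m) :
    mollify ρ Ω u x = ∫ y in Ω, ρ.normed volume (x - y) * u y := by
  rw [mollify, convolution_lsmul_swap, ← integral_indicator hΩ]
  refine integral_congr_ae (Eventually.of_forall fun y => ?_)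
  by_cases hy : y ∈ Ω <;> simp [hy]

lemma divergence_smul_const {φ : Rn m → ℝ} {x : Rn m} (h : DifferentiableAt ℝ φ x) (e : Rn m) :
    divergence (fun y => φ y • e) x = fderiv ℝ φ x e := by
  rw [divergence, (h.hasFDerivAt.smul_const e).fderiv]
  exact LinearMap.trace_smulRight _ _

variable {ρ} in
lemma isTest_kernel {W : Set (Rn m)} {x : Rn m} (hx : Metric.closedBall x ρ.rOut ⊆ W) (e : Rn m) :
    IsTest W fun y => ρ.normed volume (x - y) • e := by
  have h0 : Function.support (fun y => ρ.normed volume (x - y)) ⊆ Metric.closedBall x ρ.rOut := by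
    intro y hy
    have : x - y ∈ Function.support (ρ.normed (volume : Measure (Rn m))) := hy
    rw [ρ.support_normed_eq, mem_ball_zero_iff] at this
    rw [mem_closedBall_iff_norm', ]
    exact this.le
  refine isTest_smul_const (ρ.contDiff_normed (n := ⊤).comp (contDiff_const.sub contDiff_id))
    (HasCompactSupport.of_support_subset_isCompact (isCompact_closedBall x ρ.rOut) h0) ?_ e
  exact (closure_minimal h0 Metric.isClosed_closedBall).trans hx

/-- The gradient of the mollification, tested against a vector. -/
lemma inner_gradient_mollify (hΩ : MeasurableSet Ω) (hu : IntegrableOn u Ω) (x e : Rn m) :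
    inner ℝ e (gradient (mollify ρ Ω u) x) =
      -∫ y in Ω, u y * divergence (fun y => ρ.normed volume (x - y) • e) y := by
  have hf : Integrable (Ω.indicator u) := (integrable_indicator_iff hΩ).2 hu
  have hρ1 : ContDiff ℝ 1 (ρ.normed (volume : Measure (Rn m))) := ρ.contDiff_normed (n := 1)
  have hd := ρ.hasCompactSupport_normed.hasFDerivAt_convolution_left (μ := volume)
    (ContinuousLinearMap.lsmul ℝ ℝ) hρ1 hf.locallyIntegrable x
  have hex := (ρ.hasCompactSupport_normed (μ := (volume : Measure (Rn m)))).fderiv ℝ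
    |>.convolutionExists_left ((ContinuousLinearMap.lsmul ℝ ℝ : ℝ →L[ℝ] ℝ →L[ℝ] ℝ).precompL (Rn m))
      (hρ1.continuous_fderiv (by simp)) hf.locallyIntegrable x
  have hint := hex.integrable_swap
  rw [real_inner_comm, gradient, mollify, hd.fderiv, InnerProductSpace.toDual_symm_apply,
    convolution_eq_swap, ContinuousLinearMap.integral_apply hint, ← integral_neg,
    ← integral_indicator hΩ]
  refine integral_congr_ae (Eventually.of_forall fun y => ?_)
  have hdiff : HasFDerivAt (fun y => ρ.normed volume (x - y))
      (-(fderiv ℝ (ρ.normed volume) (x - y))) y := by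
    have := ((hρ1.differentiable (by simp)) (x - y)).hasFDerivAt.comp y
      ((hasFDerivAt_id y).const_sub x)
    exact this.congr_fderiv (by ext; simp)
  simp only [ContinuousLinearMap.precompL_apply, ContinuousLinearMap.lsmul_apply, smul_eq_mul]
  by_cases hy : y ∈ Ω
  · rw [indicator_of_mem hy, indicator_of_mem hy, divergence_smul_const hdiff.differentiableAt,
      hdiff.fderiv]
    simp [mul_comm]
  · simp [hy]

variable {ρ} in
-- When the ball lies in Ω, the kernel times the direction of the gradient is a test field on Ω, so
-- the jump of the zero extension across the boundary is not seen.
lemma IsBV.norm_gradient_mollify_le (h : IsBV Ω u) (hΩ : MeasurableSet Ω) {x : Rn m}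
    (hx : Metric.closedBall x ρ.rOut ⊆ Ω) :
    ENNReal.ofReal ‖gradient (mollify ρ Ω u) x‖ ≤
      ∫⁻ y, ENNReal.ofReal (ρ.normed volume (x - y)) ∂(absD Ω u) := by
  obtain ⟨σ, hσ, hσ1, hpair⟩ := h.exists_polar
  set G := gradient (mollify ρ Ω u) x with hG
  have hρc : Continuous fun y : Rn m => ρ.normed volume (x - y) :=
    ρ.continuous_normed.comp (continuous_const.sub continuous_id)
  have hρi : Integrable (fun y : Rn m => ρ.normed volume (x - y)) (absD Ω u) := by
    obtain ⟨C, hC⟩ := ρ.continuous_normed.bounded_above_of_compact_support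
      (ρ.hasCompactSupport_normed (μ := (volume : Measure (Rn m))))
    exact Integrable.of_bound hρc.aestronglyMeasurable C (Eventually.of_forall fun y => hC _)
  rw [← ofReal_integral_eq_lintegral_ofReal hρi (Eventually.of_forall fun y => ρ.nonneg_normed _)]
  refine ENNReal.ofReal_le_ofReal ?_
  rcases eq_or_ne G 0 with h0 | h0
  · rw [h0, norm_zero]
    exact integral_nonneg fun y => ρ.nonneg_normed _
  have hn : ‖G‖ ≠ 0 := norm_ne_zero_iff.2 h0
  have hT := isTest_kernel hx (‖G‖⁻¹ • G)
  have key := inner_gradient_mollify ρ hΩ h.1 x (‖G‖⁻¹ • G)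
  rw [hpair _ hT, neg_neg, ← hG, inner_smul_left, real_inner_self_eq_norm_sq] at key
  have e1 : ‖G‖ = ∫ y, inner ℝ (ρ.normed volume (x - y) • (‖G‖⁻¹ • G)) (σ y) ∂(absD Ω u) := by
    rw [← key]
    simp only [conj_trivial]
    field_simp
  rw [e1]
  refine integral_mono_ae ?_ hρi ?_
  · obtain ⟨C, hC⟩ := hT.exists_bound
    exact integrable_of_bound_inner hT.continuous.measurable hC (integrable_of_norm_eq_one hσ hσ1)
  filter_upwards [hσ1] with y hy
  refine (real_inner_le_norm _ _).trans ?_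
  rw [hy, norm_smul, norm_smul, norm_inv, norm_norm, inv_mul_cancel₀ hn,
    Real.norm_of_nonneg (ρ.nonneg_normed _)]
  simp

variable {ρ} in
-- Jensen's inequality for the energy measure. Test with the kernel times ξ = p(‖G‖) G/‖G‖, for
-- which Young's inequality is an equality at G. Under the integral, Young's inequality bounds the
-- absolutely continuous part and ‖ξ‖ ≤ ψ^∞ the singular part; the conjugate terms cancel since the
-- kernel has integral one.
lemma IsBV.energy_gradient_mollify_le (h : IsBV Ω u) (hΩ : MeasurableSet Ω) {ψ : ℝ → ℝ}
    (hψ : IsConvexEnergy ψ) {x : Rn m} (hx : Metric.closedBall x ρ.rOut ⊆ Ω) :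
    ENNReal.ofReal (ψ ‖gradient (mollify ρ Ω u) x‖) ≤
      ∫⁻ y, ENNReal.ofReal (ρ.normed volume (x - y)) ∂(energyMeasure Ω ψ u) := by
  obtain ⟨c, p, hd⟩ := hψ.exists_isDualPair
  obtain ⟨σ, hσ, hσ1, hpair⟩ := h.exists_polar_singular
  have hr := hψ.recession_pos
  set r := BVReg.recession ψ with hrdef
  set G := gradient (mollify ρ Ω u) x with hG
  set k : Rn m → ℝ := fun y => ρ.normed volume (x - y) with hk
  have hk0 : ∀ y, 0 ≤ k y := fun y => ρ.nonneg_normed _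
  have hkc : Continuous k := ρ.continuous_normed.comp (continuous_const.sub continuous_id)
  obtain ⟨C, hC⟩ : ∃ C, ∀ y, ‖k y‖ ≤ C := by
    obtain ⟨C, hC⟩ := ρ.continuous_normed.bounded_above_of_compact_support
      (ρ.hasCompactSupport_normed (μ := (volume : Measure (Rn m))))
    exact ⟨C, fun y => hC _⟩
  have hkΩ : ∀ y ∉ Ω, k y = 0 := by
    intro y hy
    by_contra h0
    have : x - y ∈ Function.support (ρ.normed (volume : Measure (Rn m))) := h0
    rw [ρ.support_normed_eq, mem_ball_zero_iff] at this
    exact hy (hx (by rw [mem_closedBall_iff_norm']; exact this.le))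
  have hkv : Integrable k := ρ.integrable_normed.comp_sub_left x
  have hk1 : ∫ y, k y = 1 := by
    rw [hk, integral_sub_left_eq_self (ρ.normed volume) volume x, ρ.integral_normed]
  set ν := (singularGradient Ω u).variation with hν
  set g := approxGradient Ω u with hgdef
  have hg := integrable_approxGradient Ω u
  have hkν : Integrable k ν :=
    Integrable.of_bound hkc.aestronglyMeasurable C (Eventually.of_forall hC)
  have hkψ : Integrable (fun y => k y * ψ ‖g y‖) :=
    hψ.integrable_energy.bdd_mul hkc.aestronglyMeasurable (Eventually.of_forall hC)
  -- the right-hand side as a real number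
  have hrhs : ∫⁻ y, ENNReal.ofReal (k y) ∂(energyMeasure Ω ψ u)
      = ENNReal.ofReal ((∫ y, k y * ψ ‖g y‖) + r * ∫ y, k y ∂ν) := by
    have hres : ∀ μ : Measure (Rn m), ∀ F : Rn m → ℝ≥0∞,
        ∫⁻ y in Ω, ENNReal.ofReal (k y) * F y ∂μ = ∫⁻ y, ENNReal.ofReal (k y) * F y ∂μ := by
      intro μ F
      rw [← lintegral_indicator hΩ]
      refine lintegral_congr fun y => ?_
      by_cases hy : y ∈ Ω
      · simp [hy]
      · simp [hy, hkΩ y hy]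
    have e2 := hres ν 1
    simp only [Pi.one_apply, mul_one] at e2
    have hm : Measurable fun y => ENNReal.ofReal (ψ ‖g y‖) :=
      (hψ.measurable_energy.comp (measurable_approxGradient Ω u)).ennreal_ofReal
    rw [energyMeasure, lintegral_add_measure, lintegral_smul_measure,
      lintegral_withDensity_eq_lintegral_mul _ hm
        hkc.measurable.ennreal_ofReal, ← hν, e2]
    have e1 := hres volume fun y => ENNReal.ofReal (ψ ‖g y‖)
    simp only [Pi.mul_apply, mul_comm (ENNReal.ofReal (ψ _))] at e1 ⊢
    rw [e1, ENNReal.ofReal_add (integral_nonneg fun y => mul_nonneg (hk0 y)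
      (hψ.nonneg (norm_nonneg _))) (mul_nonneg hr.le (integral_nonneg hk0)),
      ENNReal.ofReal_mul hr.le, smul_eq_mul,
      ofReal_integral_eq_lintegral_ofReal hkν (Eventually.of_forall hk0),
      ofReal_integral_eq_lintegral_ofReal hkψ (Eventually.of_forall fun y =>
        mul_nonneg (hk0 y) (hψ.nonneg (norm_nonneg _)))]
    congr 1
    exact lintegral_congr fun y => (ENNReal.ofReal_mul (hk0 y)).symm
  change _ ≤ ∫⁻ y, ENNReal.ofReal (k y) ∂(energyMeasure Ω ψ u)
  rw [hrhs]
  refine ENNReal.ofReal_le_ofReal ?_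
  set s := p ‖G‖ with hs
  have hs0 : 0 ≤ s := hd.nonneg _
  have hsr : s ≤ r := hd.le _
  set ξ : Rn m := (s / ‖G‖) • G with hξ
  have hξn : ‖ξ‖ ≤ s := by
    rw [hξ, norm_smul, Real.norm_of_nonneg (by positivity)]
    rcases eq_or_ne ‖G‖ 0 with h0 | h0
    · rw [h0]; simpa using hs0
    · rw [div_mul_cancel₀ _ h0]
  have hξG : inner ℝ ξ G = s * ‖G‖ := by
    rw [hξ, inner_smul_left, real_inner_self_eq_norm_sq]
    rcases eq_or_ne ‖G‖ 0 with h0 | h0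
    · rw [h0]; simp
    · simp only [conj_trivial]; field_simp
  have hT : IsTest Ω fun y => k y • ξ := isTest_kernel hx ξ
  have key := inner_gradient_mollify ρ hΩ h.1 x ξ
  rw [hpair _ hT, neg_neg, ← hG, hξG] at key
  rw [← hd.young_eq _ (norm_nonneg G), ← hs, key]
  obtain ⟨B, hB⟩ := hT.exists_bound
  have i1 : ∫ y, inner ℝ (k y • ξ) (g y) ≤ (∫ y, k y * ψ ‖g y‖) + c s := by
    have : (∫ y, k y * ψ ‖g y‖) + c s = ∫ y, (k y * ψ ‖g y‖ + k y * c s) := by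
      rw [integral_add hkψ (hkv.mul_const _), integral_mul_const, hk1, one_mul]
    rw [this]
    refine integral_mono (integrable_of_bound_inner hT.continuous.measurable hB hg)
      (hkψ.add (hkv.mul_const _)) fun y => ?_
    have hy := hd.young _ _ hsr (norm_nonneg (g y))
    calc inner ℝ (k y • ξ) (g y) ≤ ‖k y • ξ‖ * ‖g y‖ := real_inner_le_norm _ _
      _ = k y * (‖ξ‖ * ‖g y‖) := by rw [norm_smul, Real.norm_of_nonneg (hk0 y), mul_assoc]
      _ ≤ k y * (s * ‖g y‖) := by gcongr; exact hk0 y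
      _ ≤ k y * (ψ ‖g y‖ + c s) := mul_le_mul_of_nonneg_left (by linarith) (hk0 y)
      _ = _ := by ring
  have i2 : ∫ y, inner ℝ (k y • ξ) (σ y) ∂ν ≤ r * ∫ y, k y ∂ν := by
    rw [← integral_const_mul]
    refine integral_mono_ae (integrable_of_bound_inner hT.continuous.measurable hB
      (integrable_of_norm_eq_one hσ hσ1)) (hkν.const_mul _) ?_
    filter_upwards [hσ1] with y hy
    refine (real_inner_le_norm _ _).trans ?_
    rw [hy, norm_smul, Real.norm_of_nonneg (hk0 y), mul_one, mul_comm]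
    exact mul_le_mul_of_nonneg_right (hξn.trans hsr) (hk0 y)
  linarith

lemma lintegral_kernel (y : Rn m) : ∫⁻ x, ENNReal.ofReal (ρ.normed volume (x - y)) = 1 := by
  rw [lintegral_sub_right_eq_self (fun x => ENNReal.ofReal (ρ.normed volume x)) y,
    ← ofReal_integral_eq_lintegral_ofReal ρ.integrable_normed
      (Eventually.of_forall fun y => ρ.nonneg_normed _), ρ.integral_normed, ENNReal.ofReal_one]

lemma measurable_kernel : Measurable fun z : Rn m × Rn m =>
    ENNReal.ofReal (ρ.normed volume (z.1 - z.2)) :=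
  (ρ.continuous_normed.comp (continuous_fst.sub continuous_snd)).measurable.ennreal_ofReal

lemma measurable_kernel_left (x : Rn m) :
    Measurable fun y : Rn m => ENNReal.ofReal (ρ.normed volume (x - y)) :=
  (ρ.continuous_normed.comp (continuous_const.sub continuous_id)).measurable.ennreal_ofReal

lemma measurable_kernel_right (y : Rn m) :
    Measurable fun x : Rn m => ENNReal.ofReal (ρ.normed volume (x - y)) :=
  (ρ.continuous_normed.comp (continuous_id.sub continuous_const)).measurable.ennreal_ofReal

/-- Tonelli moves the averaging onto x, where the kernel has mass one; since it only sees points at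
distance less than `rOut`, h may be replaced by h₂. -/
lemma setLIntegral_mul_kernel_le {M : Measure (Rn m)} [SFinite M] {S : Set (Rn m)}
    (hS : MeasurableSet S) {h h₂ : Rn m → ℝ≥0∞} (hh : Measurable h)
    (hle : ∀ x ∈ S, ∀ y, dist x y < ρ.rOut → h x ≤ h₂ y) :
    ∫⁻ x in S, h x * ∫⁻ y, ENNReal.ofReal (ρ.normed volume (x - y)) ∂M ≤ ∫⁻ y, h₂ y ∂M := by
  have hk := measurable_kernel ρ
  have hsw : ∫⁻ x in S, h x * ∫⁻ y, ENNReal.ofReal (ρ.normed volume (x - y)) ∂M =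
      ∫⁻ y, ∫⁻ x in S, h x * ENNReal.ofReal (ρ.normed volume (x - y)) ∂volume ∂M := by
    rw [lintegral_lintegral_swap ((hh.comp measurable_snd).mul
      (hk.comp measurable_swap)).aemeasurable]
    refine lintegral_congr fun x => ?_
    exact (lintegral_const_mul _ (measurable_kernel_left ρ x)).symm
  rw [hsw]
  refine lintegral_mono fun y => ?_
  calc ∫⁻ x in S, h x * ENNReal.ofReal (ρ.normed volume (x - y))
      ≤ ∫⁻ x in S, h₂ y * ENNReal.ofReal (ρ.normed volume (x - y)) := by
        refine setLIntegral_mono' hS fun x hx => ?_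
        by_cases hxy : dist x y < ρ.rOut
        · gcongr
          exact hle x hx y hxy
        · have : ρ.normed volume (x - y) = 0 := by
            by_contra h0
            have : x - y ∈ Function.support (ρ.normed (volume : Measure (Rn m))) := h0
            rw [ρ.support_normed_eq, mem_ball_zero_iff, ← dist_eq_norm] at this
            exact hxy this
          simp [this]
    _ ≤ ∫⁻ x, h₂ y * ENNReal.ofReal (ρ.normed volume (x - y)) := setLIntegral_le_lintegral _ _
    _ = h₂ y := by
        rw [lintegral_const_mul _ (measurable_kernel_right ρ y), lintegral_kernel, mul_one]

lemma lintegral_mollify_le (hΩ : MeasurableSet Ω) (hu : IntegrableOn u Ω) :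
    ∫⁻ x, ‖mollify ρ Ω u x‖ₑ ≤ normL1 Ω u := by
  have hm : AEMeasurable (fun x => ‖u x‖ₑ) (volume.restrict Ω) := hu.aestronglyMeasurable.enorm
  set M : Measure (Rn m) := (volume.restrict Ω).withDensity fun x => ‖u x‖ₑ with hM
  have h1 : ∀ x, ‖mollify ρ Ω u x‖ₑ ≤ ∫⁻ y, ENNReal.ofReal (ρ.normed volume (x - y)) ∂M := by
    intro x
    rw [mollify_apply ρ hΩ, hM, lintegral_withDensity_eq_lintegral_mul₀ hm
      (measurable_kernel_left ρ x).aemeasurable]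
    refine (enorm_integral_le_lintegral_enorm _).trans (lintegral_mono fun y => ?_)
    rw [enorm_mul, Real.enorm_of_nonneg (ρ.nonneg_normed _), mul_comm]
    rfl
  have hfin : IsFiniteMeasure M := isFiniteMeasure_withDensity hu.2.ne
  have h2 := setLIntegral_mul_kernel_le ρ (M := M) MeasurableSet.univ
    (h := fun _ => 1) (h₂ := fun _ => 1) measurable_const (fun _ _ _ _ => le_rfl)
  simp only [one_mul, Measure.restrict_univ, lintegral_const] at h2
  refine (lintegral_mono h1).trans (h2.trans ?_)
  rw [hM, withDensity_apply _ MeasurableSet.univ, Measure.restrict_univ, normL1]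

/-- The Riesz–Scheffé argument: Fatou's lemma for ‖f‖ + ‖v k‖ - ‖v k - f‖, whose pointwise limit is
2‖f‖. -/
lemma tendsto_lintegral_enorm_sub {α : Type*} [MeasurableSpace α] {μ : Measure α} {f : α → ℝ}
    {v : ℕ → α → ℝ} (hf : Integrable f μ) (hv : ∀ k, AEStronglyMeasurable (v k) μ)
    (hle : ∀ k, ∫⁻ x, ‖v k x‖ₑ ∂μ ≤ ∫⁻ x, ‖f x‖ₑ ∂μ)
    (hlim : ∀ᵐ x ∂μ, Tendsto (fun k => v k x) atTop (𝓝 (f x))) :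
    Tendsto (fun k => ∫⁻ x, ‖v k x - f x‖ₑ ∂μ) atTop (𝓝 0) := by
  set F := ∫⁻ x, ‖f x‖ₑ ∂μ with hF
  have hFt : F ≠ ⊤ := hf.2.ne
  set a : ℕ → α → ℝ≥0∞ := fun k x => (‖f x‖ₑ + ‖v k x‖ₑ) - ‖v k x - f x‖ₑ with ha
  have hfm : AEMeasurable (fun x => ‖f x‖ₑ) μ := hf.1.enorm
  have hdm : ∀ k, AEMeasurable (fun x => ‖v k x - f x‖ₑ) μ := fun k => ((hv k).sub hf.1).enorm
  have ham : ∀ k, AEMeasurable (a k) μ := fun k => (hfm.add (hv k).enorm).sub (hdm k)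
  have hsum : ∀ k, ∫⁻ x, a k x ∂μ + ∫⁻ x, ‖v k x - f x‖ₑ ∂μ ≤ 2 * F := by
    intro k
    rw [← lintegral_add_right' _ (hdm k)]
    have : ∀ x, a k x + ‖v k x - f x‖ₑ = ‖f x‖ₑ + ‖v k x‖ₑ := fun x =>
      tsub_add_cancel_of_le ((enorm_sub_le).trans (add_comm _ _).le)
    simp only [this]
    rw [lintegral_add_left' hfm, two_mul]
    gcongr
    exact hle k
  have hfatou : 2 * F ≤ liminf (fun k => ∫⁻ x, a k x ∂μ) atTop := by
    refine le_trans (le_of_eq ?_) (lintegral_liminf_le' ham)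
    rw [hF, ← lintegral_const_mul'' _ hfm]
    refine lintegral_congr_ae ?_
    filter_upwards [hlim] with x hx
    refine (Tendsto.liminf_eq ?_).symm
    have h1 : Tendsto (fun k => ‖v k x - f x‖ₑ) atTop (𝓝 0) := by
      simpa using (hx.sub_const (f x)).enorm
    have h2 := ENNReal.Tendsto.sub (tendsto_const_nhds (x := ‖f x‖ₑ) |>.add hx.enorm) h1
      (Or.inr ENNReal.zero_ne_top)
    rw [two_mul]
    simpa [ha] using h2
  rw [ENNReal.tendsto_nhds_zero]
  intro ε hε
  rcases eq_or_ne F 0 with h0 | h0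
  · refine Eventually.of_forall fun k => ?_
    have := hsum k
    rw [h0, mul_zero, nonpos_iff_eq_zero, add_eq_zero] at this
    rw [this.2]
    exact zero_le
  have h2F : 2 * F ≠ ⊤ := ENNReal.mul_ne_top (by simp) hFt
  have hlt : 2 * F - ε < liminf (fun k => ∫⁻ x, a k x ∂μ) atTop :=
    (ENNReal.sub_lt_self h2F (by simpa using h0) hε.ne').trans_le hfatou
  filter_upwards [eventually_lt_of_lt_liminf hlt] with k hk
  have hak : ∫⁻ x, a k x ∂μ ≠ ⊤ := ne_top_of_le_ne_top h2F (le_self_add.trans (hsum k))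
  refine (ENNReal.add_le_add_iff_left hak).1 ((hsum k).trans ?_)
  exact tsub_le_iff_right.1 hk.le

/-- Mollifications converge almost everywhere as long as the ratio of the radii stays bounded (here
it is 2); as they do not increase the L¹ norm, convergence in L¹ follows. -/
theorem exists_mollify_tendsto (hΩ : MeasurableSet Ω) (hu : IntegrableOn u Ω) :
    ∃ ρ : ℕ → ContDiffBump (0 : Rn m), Tendsto (fun k => (ρ k).rOut) atTop (𝓝 0) ∧
      Tendsto (fun k => normL1 Ω (mollify (ρ k) Ω u - u)) atTop (𝓝 0) := by
  refine ⟨fun k => ⟨1 / (2 * ((k : ℝ) + 1)), 1 / ((k : ℝ) + 1), by positivity,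
    one_div_lt_one_div_of_lt (by positivity) (by linarith [k.cast_nonneg (α := ℝ)])⟩, ?_, ?_⟩
  · exact tendsto_one_div_add_atTop_nhds_zero_nat
  set ρ : ℕ → ContDiffBump (0 : Rn m) := fun k => ⟨1 / (2 * ((k : ℝ) + 1)), 1 / ((k : ℝ) + 1),
    by positivity, one_div_lt_one_div_of_lt (by positivity)
      (by linarith [k.cast_nonneg (α := ℝ)])⟩ with hρ
  have hf : Integrable (Ω.indicator u) := (integrable_indicator_iff hΩ).2 hu
  have h1 := ContDiffBump.ae_convolution_tendsto_right_of_locallyIntegrable (φ := ρ)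
    (l := atTop) (K := 2) (μ := volume) tendsto_one_div_add_atTop_nhds_zero_nat
    (Eventually.of_forall fun k => by
      change 1 / ((k : ℝ) + 1) ≤ 2 * (1 / (2 * ((k : ℝ) + 1)))
      field_simp; exact le_rfl) hf.locallyIntegrable
  refine tendsto_lintegral_enorm_sub hu
    (fun k => (contDiff_mollify (ρ k) hΩ hu).continuous.aestronglyMeasurable)
    (fun k => (setLIntegral_le_lintegral _ _).trans (lintegral_mollify_le (ρ k) hΩ hu)) ?_
  filter_upwards [ae_restrict_of_ae h1, ae_restrict_mem hΩ] with x hx hxΩ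
  rwa [indicator_of_mem hxΩ] at hx

end Mollify

end BVReg

namespace BVReg

/-! ### Lipschitz images of null sets -/

section Lipschitz

variable {m : ℕ}

/-- Both measures are translation invariant, hence proportional with a nonzero factor. -/
lemma volume_eq_zero_iff_hausdorffMeasure (E : Set (Rn m)) :
    volume E = 0 ↔ Measure.hausdorffMeasure (m : ℝ) E = 0 := by
  rw [Measure.isAddLeftInvariant_eq_smul (volume : Measure (Rn m))
      (Measure.hausdorffMeasure (m : ℝ)), Measure.smul_apply, ENNReal.smul_def, smul_eq_mul,
    mul_eq_zero, or_iff_right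
      (by simpa using Measure.addHaarScalarFactor_volume_hausdorffMeasure_ne_zero m)]

lemma volume_image_eq_zero {K : ℝ≥0} {f : Rn m → Rn m} {N : Set (Rn m)}
    (hf : LipschitzOnWith K f N) (hN : volume N = 0) : volume (f '' N) = 0 := by
  rw [volume_eq_zero_iff_hausdorffMeasure] at hN ⊢
  have := hf.hausdorffMeasure_image_le (d := (m : ℝ)) (Nat.cast_nonneg m)
  rw [hN, mul_zero] at this
  exact le_antisymm this bot_le

end Lipschitz

/-! ### Bi-Lipschitz transformations: change of variables and pointwise bounds -/

namespace BiLipTransf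

variable {m : ℕ} {Ω : Set (Rn m)} (γ : BiLipTransf Ω)

/-- The inverse transformation. -/
def symm : BiLipTransf Ω :=
  ⟨γ.inv, γ.map, γ.mapsTo_inv, γ.mapsTo, γ.invOn.symm, γ.lipschitz_inv, γ.lipschitz⟩

lemma inv_map {x : Rn m} (hx : x ∈ Ω) : γ.inv (γ.map x) = x := γ.invOn.1 hx

lemma map_inv {x : Rn m} (hx : x ∈ Ω) : γ.map (γ.inv x) = x := γ.invOn.2 hx

lemma injOn : InjOn γ.map Ω := γ.invOn.1.injOn

lemma continuousOn : ContinuousOn γ.map Ω := by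
  obtain ⟨K, hK⟩ := γ.lipschitz
  exact hK.continuousOn

lemma continuousOn_inv : ContinuousOn γ.inv Ω := γ.symm.continuousOn

lemma image_subset {E : Set (Rn m)} (hE : E ⊆ Ω) : γ.map '' E ⊆ Ω :=
  (image_mono hE).trans γ.mapsTo.image_subset

lemma image_self : γ.map '' Ω = Ω :=
  (γ.image_subset subset_rfl).antisymm fun y hy => ⟨γ.inv y, γ.mapsTo_inv hy, γ.map_inv hy⟩

lemma image_eq {E : Set (Rn m)} (hE : E ⊆ Ω) : γ.map '' E = Ω ∩ γ.inv ⁻¹' E := by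
  ext y
  constructor
  · rintro ⟨x, hx, rfl⟩
    exact ⟨γ.mapsTo (hE hx), by rw [mem_preimage, γ.inv_map (hE hx)]; exact hx⟩
  · rintro ⟨hy, hyE⟩
    exact ⟨γ.inv y, hyE, γ.map_inv hy⟩

lemma isOpen_image (hΩ : IsOpen Ω) {W : Set (Rn m)} (hW : IsOpen W) (hWΩ : W ⊆ Ω) :
    IsOpen (γ.map '' W) := by
  rw [γ.image_eq hWΩ]
  exact γ.continuousOn_inv.isOpen_inter_preimage hΩ hW

lemma measurableSet_image {E : Set (Rn m)} (hE : MeasurableSet E) (hEΩ : E ⊆ Ω) :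
    MeasurableSet (γ.map '' E) :=
  hE.image_of_continuousOn_injOn (γ.continuousOn.mono hEΩ) (γ.injOn.mono hEΩ)

lemma volume_image_eq_zero {N : Set (Rn m)} (hN : N ⊆ Ω) (h0 : volume N = 0) :
    volume (γ.map '' N) = 0 := by
  obtain ⟨K, hK⟩ := γ.lipschitz
  exact BVReg.volume_image_eq_zero (hK.mono hN) h0

lemma ae_inv {p : Rn m → Prop} (hΩ : MeasurableSet Ω) (h : ∀ᵐ x ∂volume.restrict Ω, p x) :
    ∀ᵐ y ∂volume.restrict Ω, p (γ.inv y) := by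
  rw [ae_restrict_iff' hΩ, ae_iff] at h ⊢
  refine measure_mono_null ?_ (γ.volume_image_eq_zero (N := {x | ¬ (x ∈ Ω → p x)}) ?_ h)
  · intro y hy
    simp only [mem_ofPred_eq, Classical.not_imp] at hy
    exact ⟨γ.inv y, by simpa using ⟨γ.mapsTo_inv hy.1, hy.2⟩, γ.map_inv hy.1⟩
  · intro x hx
    simp only [mem_ofPred_eq, Classical.not_imp] at hx
    exact hx.1

lemma ae_map {p : Rn m → Prop} (hΩ : MeasurableSet Ω) (h : ∀ᵐ x ∂volume.restrict Ω, p x) :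
    ∀ᵐ y ∂volume.restrict Ω, p (γ.map y) := γ.symm.ae_inv hΩ h

lemma ae_differentiableAt (hΩ : IsOpen Ω) :
    ∀ᵐ x ∂volume.restrict Ω, DifferentiableAt ℝ γ.map x := by
  obtain ⟨K, hK⟩ := γ.lipschitz
  exact hK.ae_differentiableAt_of_isOpen hΩ

lemma ae_differentiableAt_inv (hΩ : IsOpen Ω) :
    ∀ᵐ x ∂volume.restrict Ω, DifferentiableAt ℝ γ.inv (γ.map x) :=
  γ.ae_map hΩ.measurableSet (γ.symm.ae_differentiableAt hΩ)

/-- Change of variables. -/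
lemma setLIntegral_image (hΩ : IsOpen Ω) {E : Set (Rn m)} (hE : MeasurableSet E) (hEΩ : E ⊆ Ω)
    (F : Rn m → ℝ≥0∞) :
    ∫⁻ y in γ.map '' E, F y = ∫⁻ x in E, ENNReal.ofReal (γ.jac x) * F (γ.map x) := by
  -- The points of non-differentiability and their image are null, so the formula for differentiable
  -- injective maps applies to the rest.
  set D : Set (Rn m) := {x | DifferentiableAt ℝ γ.map x} with hD
  have hDm : MeasurableSet D := measurableSet_of_differentiableAt ℝ γ.map
  have hnull : volume (E \ D) = 0 := by
    have h := γ.ae_differentiableAt hΩ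
    rw [ae_restrict_iff' hΩ.measurableSet, ae_iff] at h
    refine measure_mono_null (fun x hx => ?_) h
    simpa [hD] using ⟨hEΩ hx.1, hx.2⟩
  have himg : volume (γ.map '' (E \ D)) = 0 :=
    γ.volume_image_eq_zero (sdiff_subset.trans hEΩ) hnull
  have e1 : γ.map '' E =ᵐ[volume] γ.map '' (E ∩ D) := by
    rw [← inter_union_sdiff E D, image_union, inter_union_sdiff]
    exact union_ae_eq_left_of_ae_eq_empty (ae_eq_empty.2 himg)
  have e2 : (E : Set (Rn m)) =ᵐ[volume] (E ∩ D : Set (Rn m)) := by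
    conv_lhs => rw [← inter_union_sdiff E D]
    exact union_ae_eq_left_of_ae_eq_empty (ae_eq_empty.2 hnull)
  rw [setLIntegral_congr e1, setLIntegral_congr e2,
    lintegral_image_eq_lintegral_abs_det_fderiv_mul volume (hE.inter hDm)
      (fun x hx => hx.2.hasFDerivAt.hasFDerivWithinAt)
      (γ.injOn.mono (inter_subset_left.trans hEΩ))]
  rfl

/-- Derivatives need γ to be the identity on a neighbourhood; this is why the closure of U enters
the estimates. -/
lemma fderiv_map_of_isIdOff {U : Set (Rn m)} (hΩ : IsOpen Ω) (h : γ.IsIdOff U) {x : Rn m}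
    (hx : x ∈ Ω \ closure U) : fderiv ℝ γ.map x = ContinuousLinearMap.id ℝ (Rn m) := by
  have : γ.map =ᶠ[𝓝 x] id := by
    filter_upwards [(hΩ.sdiff isClosed_closure).mem_nhds hx] with y hy
    exact h y ⟨hy.1, fun hU => hy.2 (subset_closure hU)⟩
  rw [this.fderiv_eq, fderiv_id]

lemma isIdOff_symm {U : Set (Rn m)} (h : γ.IsIdOff U) : γ.symm.IsIdOff U := fun x hx => by
  have : γ.inv (γ.map x) = x := γ.inv_map hx.1
  rwa [h x hx] at this

lemma jac_of_isIdOff {U : Set (Rn m)} (hΩ : IsOpen Ω) (h : γ.IsIdOff U) {x : Rn m}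
    (hx : x ∈ Ω \ closure U) : γ.jac x = 1 := by
  rw [jac, γ.fderiv_map_of_isIdOff hΩ h hx]
  simp [ContinuousLinearMap.det]

lemma gradInv_of_isIdOff {U : Set (Rn m)} (hΩ : IsOpen Ω) (h : γ.IsIdOff U) {x : Rn m}
    (hx : x ∈ Ω \ closure U) : γ.gradInv x = ContinuousLinearMap.id ℝ (Rn m) := by
  rw [gradInv, h x ⟨hx.1, fun hU => hx.2 (subset_closure hU)⟩]
  have := γ.symm.fderiv_map_of_isIdOff hΩ (γ.isIdOff_symm h) hx
  change fderiv ℝ γ.inv x = _ at this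
  rw [this, ContinuousLinearMap.adjoint_id]

variable {γ} {γ₁ γ₂ : BiLipTransf Ω}

lemma ae_norm_lipJac_le (hG : compG γ₁ γ₂ ≠ ⊤) : ∀ᵐ x ∂volume.restrict Ω, ∀ v,
    ‖γ₁.lipJac x v‖ + ‖γ₂.lipJac x v‖ ≤ (2 + (compG γ₁ γ₂).toReal) * ‖v‖ := by
  filter_upwards [ENNReal.ae_le_essSup (μ := volume.restrict Ω) fun x =>
    ⨆ (v : Rn m) (_ : ‖v‖ = 1),
      ENNReal.ofReal (‖γ₁.lipJac x v‖ + ‖γ₂.lipJac x v‖ - 2 * ‖v‖)] with x hx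
  have h1 : ∀ v : Rn m, ‖v‖ = 1 →
      ‖γ₁.lipJac x v‖ + ‖γ₂.lipJac x v‖ ≤ 2 + (compG γ₁ γ₂).toReal := by
    intro v hv
    have h2 : ENNReal.ofReal (‖γ₁.lipJac x v‖ + ‖γ₂.lipJac x v‖ - 2 * ‖v‖) ≤ compG γ₁ γ₂ :=
      (le_iSup₂ (f := fun (v : Rn m) (_ : ‖v‖ = 1) =>
        ENNReal.ofReal (‖γ₁.lipJac x v‖ + ‖γ₂.lipJac x v‖ - 2 * ‖v‖)) v hv).trans hx
    have := (ENNReal.ofReal_le_iff_le_toReal hG).1 h2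
    rw [hv] at this
    linarith
  intro v
  rcases eq_or_ne v 0 with rfl | hv
  · simp
  have hn : 0 < ‖v‖ := norm_pos_iff.2 hv
  have h3 := h1 (‖v‖⁻¹ • v) (by rw [norm_smul, norm_inv, norm_norm, inv_mul_cancel₀ hn.ne'])
  rw [map_smul, map_smul, norm_smul, norm_smul, norm_inv, norm_norm, ← mul_add] at h3
  rwa [inv_mul_le_iff₀ hn, mul_comm] at h3

lemma ae_abs_jac_le (hJ : compJ γ₁ γ₂ ≠ ⊤) : ∀ᵐ x ∂volume.restrict Ω,
    |γ₁.jac x + γ₂.jac x - 2| ≤ (compJ γ₁ γ₂).toReal := by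
  filter_upwards [ENNReal.ae_le_essSup (μ := volume.restrict Ω) fun x =>
    ENNReal.ofReal |γ₁.jac x + γ₂.jac x - 2|] with x hx
  exact (ENNReal.ofReal_le_iff_le_toReal hJ).1 hx

lemma ae_norm_gradInv_sub_le (hD : γ.distId ≠ ⊤) : ∀ᵐ x ∂volume.restrict Ω,
    ‖γ.gradInv x - ContinuousLinearMap.id ℝ (Rn m)‖ ≤ γ.distId.toReal := by
  filter_upwards [ENNReal.ae_le_essSup (μ := volume.restrict Ω) fun x =>
    ‖γ.gradInv x - ContinuousLinearMap.id ℝ (Rn m)‖ₑ] with x hx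
  rw [← toReal_enorm]
  exact ENNReal.toReal_mono hD hx

lemma ne_top_of_compT_lt_one (h : compT γ₁ γ₂ < 1) :
    compG γ₁ γ₂ ≠ ⊤ ∧ compJ γ₁ γ₂ ≠ ⊤ ∧ γ₁.distId ≠ ⊤ ∧ γ₂.distId ≠ ⊤ := by
  have h' : compT γ₁ γ₂ ≠ ⊤ := (h.trans ENNReal.one_lt_top).ne
  simp only [compT, ne_eq, ENNReal.add_eq_top, ENNReal.pow_eq_top_iff, not_or] at h'
  simp only [OfNat.ofNat_ne_zero, not_false_eq_true, and_true] at h'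
  exact ⟨h'.1.1.1, h'.1.1.2, h'.1.2, h'.2⟩

lemma toReal_compT (h : compT γ₁ γ₂ < 1) : (compT γ₁ γ₂).toReal = (compG γ₁ γ₂).toReal
    + (compJ γ₁ γ₂).toReal + γ₁.distId.toReal ^ 2 + γ₂.distId.toReal ^ 2 := by
  obtain ⟨h1, h2, h3, h4⟩ := ne_top_of_compT_lt_one h
  rw [compT]
  generalize compG γ₁ γ₂ = a, compJ γ₁ γ₂ = b, γ₁.distId = c, γ₂.distId = d at *
  rw [ENNReal.toReal_add (by finiteness) (by finiteness),
    ENNReal.toReal_add (by finiteness) (by finiteness), ENNReal.toReal_add h1 h2,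
    ENNReal.toReal_pow, ENNReal.toReal_pow]

lemma toReal_compT_lt_one (h : compT γ₁ γ₂ < 1) : (compT γ₁ γ₂).toReal < 1 := by
  simpa using (ENNReal.toReal_lt_toReal (h.trans ENNReal.one_lt_top).ne ENNReal.one_ne_top).2 h

lemma jac_nonneg (x : Rn m) : 0 ≤ γ.jac x := abs_nonneg _

lemma norm_lipJac (x v : Rn m) : ‖γ.lipJac x v‖ = γ.jac x * ‖γ.gradInv x v‖ := by
  rw [lipJac, smul_apply, norm_smul, Real.norm_of_nonneg (jac_nonneg x)]

/-- The pointwise estimates that follow from a small comparison constant. -/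
structure PointwiseBounds (γ₁ γ₂ : BiLipTransf Ω) (G J D₁ D₂ : ℝ) (x : Rn m) : Prop where
  norm_le : ∀ v, γ₁.jac x * ‖γ₁.gradInv x v‖ + γ₂.jac x * ‖γ₂.gradInv x v‖ ≤ (2 + G) * ‖v‖
  jac_le : |γ₁.jac x + γ₂.jac x - 2| ≤ J
  fst_le : ∀ v, |‖γ₁.gradInv x v‖ - ‖v‖| ≤ D₁ * ‖v‖
  snd_le : ∀ v, |‖γ₂.gradInv x v‖ - ‖v‖| ≤ D₂ * ‖v‖

lemma ae_pointwiseBounds (h : compT γ₁ γ₂ < 1) : ∀ᵐ x ∂volume.restrict Ω,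
    PointwiseBounds γ₁ γ₂ (compG γ₁ γ₂).toReal (compJ γ₁ γ₂).toReal γ₁.distId.toReal
      γ₂.distId.toReal x := by
  obtain ⟨h1, h2, h3, h4⟩ := ne_top_of_compT_lt_one h
  have key : ∀ (A : Rn m →L[ℝ] Rn m) (D : ℝ), ‖A - ContinuousLinearMap.id ℝ (Rn m)‖ ≤ D →
      ∀ v, |‖A v‖ - ‖v‖| ≤ D * ‖v‖ := by
    intro A D hA v
    refine (abs_norm_sub_norm_le _ _).trans ?_
    have := (A - ContinuousLinearMap.id ℝ (Rn m)).le_of_opNorm_le hA v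
    simpa using this
  filter_upwards [ae_norm_lipJac_le h1, ae_abs_jac_le h2, ae_norm_gradInv_sub_le h3,
    ae_norm_gradInv_sub_le h4] with x a1 a2 a3 a4
  exact ⟨fun v => by simpa only [norm_lipJac] using a1 v, a2, key _ _ a3, key _ _ a4⟩

end BiLipTransf

end BVReg

namespace BVReg

/-- If f is not integrable, its integral is zero by convention, so no integrability is required. -/
lemma ofReal_integral_le_lintegral {α : Type*} [MeasurableSpace α] (μ : Measure α) (f : α → ℝ) :
    ENNReal.ofReal (∫ x, f x ∂μ) ≤ ∫⁻ x, ENNReal.ofReal (f x) ∂μ := by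
  by_cases hf : Integrable f μ
  · rw [integral_eq_lintegral_pos_part_sub_lintegral_neg_part hf]
    refine (ENNReal.ofReal_le_ofReal (sub_le_self _ ENNReal.toReal_nonneg)).trans ?_
    exact ENNReal.ofReal_toReal_le
  · rw [integral_undef hf, ENNReal.ofReal_zero]
    exact bot_le

/-! ### Gradients of compositions -/

section Gradient

variable {m : ℕ}

/-- Compare difference quotients along h; θ need not be differentiable at g(y), so the chain rule is
unavailable. -/
lemma abs_fderiv_comp_le {θ : ℝ → ℝ} (hθ : LipschitzWith 1 θ) {g : Rn m → ℝ} {y : Rn m}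
    (hg : DifferentiableAt ℝ g y) (hF : DifferentiableAt ℝ (θ ∘ g) y) (h : Rn m) :
    |fderiv ℝ (θ ∘ g) y h| ≤ |fderiv ℝ g y h| := by
  have h1 := (hF.hasFDerivAt.hasLineDerivAt h).tendsto_slope_zero.abs
  have h2 := (hg.hasFDerivAt.hasLineDerivAt h).tendsto_slope_zero.abs
  refine le_of_tendsto_of_tendsto h1 h2 (Eventually.of_forall fun t => ?_)
  simp only [smul_eq_mul, abs_mul]
  refine mul_le_mul_of_nonneg_left ?_ (abs_nonneg _)
  have := hθ.dist_le_mul (g (y + t • h)) (g y)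
  simpa [Real.dist_eq] using this

lemma norm_gradient_comp_le {θ : ℝ → ℝ} (hθ : LipschitzWith 1 θ) {v : Rn m → ℝ} {T : Rn m → Rn m}
    {y : Rn m} (hv : DifferentiableAt ℝ v (T y)) (hT : DifferentiableAt ℝ T y) :
    ‖gradient (θ ∘ v ∘ T) y‖ ≤
      ‖ContinuousLinearMap.adjoint (fderiv ℝ T y) (gradient v (T y))‖ := by
  rw [gradient, LinearIsometryEquiv.norm_map]
  refine ContinuousLinearMap.opNorm_le_bound _ (norm_nonneg _) fun h => ?_
  -- Without differentiability the gradient is zero by convention and the bound is trivial.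
  by_cases hF : DifferentiableAt ℝ (θ ∘ v ∘ T) y
  · refine (abs_fderiv_comp_le hθ (hv.comp y hT) hF h).trans ?_
    rw [fderiv_comp y hv hT, ContinuousLinearMap.comp_apply]
    have : fderiv ℝ v (T y) (fderiv ℝ T y h) =
        inner ℝ (ContinuousLinearMap.adjoint (fderiv ℝ T y) (gradient v (T y))) h := by
      rw [ContinuousLinearMap.adjoint_inner_left, gradient, InnerProductSpace.toDual_symm_apply]
    rw [this]
    exact abs_real_inner_le_norm _ _
  · rw [fderiv_zero_of_not_differentiableAt hF]
    simp only [zero_apply, norm_zero]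
    positivity

end Gradient

/-! ### Test fields for transformed smooth functions -/

section Push

variable {m : ℕ} {Ω : Set (Rn m)} {θ : ℝ → ℝ} {u v : Rn m → ℝ}

namespace BiLipTransf

variable (γ : BiLipTransf Ω)

lemma ae_norm_gradient_push_le (hΩ : IsOpen Ω) (hθ : LipschitzWith 1 θ)
    (hv : Differentiable ℝ v) : ∀ᵐ x ∂volume.restrict Ω,
      ‖gradient (θ ∘ γ.push v) (γ.map x)‖ ≤ ‖γ.gradInv x (gradient v x)‖ := by
  filter_upwards [γ.ae_differentiableAt_inv hΩ, ae_restrict_mem hΩ.measurableSet] with x hx hxΩ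
  have := norm_gradient_comp_le hθ (hv (γ.inv (γ.map x))) hx
  rwa [γ.inv_map hxΩ] at this

lemma exists_lipschitzOnWith_push (hθ : LipschitzWith 1 θ) {K : ℝ≥0} (hv : LipschitzWith K v) :
    ∃ K', LipschitzOnWith K' (θ ∘ γ.push v) Ω := by
  obtain ⟨K₂, hK₂⟩ := γ.lipschitz_inv
  exact ⟨_, (hθ.comp hv).comp_lipschitzOnWith hK₂⟩

lemma setLIntegral_comp_inv (hΩ : IsOpen Ω) (F : Rn m → ℝ≥0∞) :
    ∫⁻ y in Ω, F (γ.inv y) = ∫⁻ x in Ω, ENNReal.ofReal (γ.jac x) * F x := by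
  have h := γ.setLIntegral_image hΩ hΩ.measurableSet subset_rfl fun y => F (γ.inv y)
  rw [γ.image_self] at h
  rw [h]
  refine setLIntegral_congr_fun hΩ.measurableSet fun x hx => ?_
  simp only [γ.inv_map hx]

lemma setLIntegral_comp_inv_le (hΩ : IsOpen Ω) {C : ℝ}
    (hJ : ∀ᵐ x ∂volume.restrict Ω, γ.jac x ≤ C) (F : Rn m → ℝ≥0∞) :
    ∫⁻ y in Ω, F (γ.inv y) ≤ ENNReal.ofReal C * ∫⁻ x in Ω, F x := by
  rw [γ.setLIntegral_comp_inv hΩ, ← lintegral_const_mul' _ _ ENNReal.ofReal_ne_top]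
  refine lintegral_mono_ae ?_
  filter_upwards [hJ] with x hx
  gcongr

lemma normL1_push_sub_le (hΩ : IsOpen Ω) (hθ : LipschitzWith 1 θ) {C : ℝ}
    (hJ : ∀ᵐ x ∂volume.restrict Ω, γ.jac x ≤ C) :
    normL1 Ω (θ ∘ γ.push v - θ ∘ γ.push u) ≤ ENNReal.ofReal C * normL1 Ω (v - u) := by
  refine le_trans (lintegral_mono fun y => ?_)
    (γ.setLIntegral_comp_inv_le hΩ hJ fun x => ‖(v - u) x‖ₑ)
  have := hθ (v (γ.inv y)) (u (γ.inv y))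
  rw [ENNReal.coe_one, one_mul, edist_eq_enorm_sub, edist_eq_enorm_sub] at this
  exact this

lemma integrableOn_push (hΩ : IsOpen Ω) (hvol : volume Ω ≠ ⊤) (hθ : LipschitzWith 1 θ) {C : ℝ}
    (hJ : ∀ᵐ x ∂volume.restrict Ω, γ.jac x ≤ C) (hu : IntegrableOn u Ω) :
    IntegrableOn (θ ∘ γ.push u) Ω := by
  have hfin : IsFiniteMeasure (volume.restrict Ω) := isFiniteMeasure_restrict.2 hvol
  have hm : AEStronglyMeasurable (γ.push u) (volume.restrict Ω) := by
    obtain ⟨u', hu', hae⟩ := hu.1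
    refine AEStronglyMeasurable.congr (f := u' ∘ γ.inv) ?_ ?_
    · exact (hu'.measurable.comp_aemeasurable
        (γ.continuousOn_inv.aemeasurable hΩ.measurableSet)).aestronglyMeasurable
    · filter_upwards [γ.ae_inv hΩ.measurableSet hae] with y hy
      exact hy.symm
  have hi : Integrable (γ.push u) (volume.restrict Ω) := by
    refine ⟨hm, (γ.setLIntegral_comp_inv_le hΩ hJ fun x => ‖u x‖ₑ).trans_lt ?_⟩
    exact ENNReal.mul_lt_top ENNReal.ofReal_lt_top hu.2
  refine (hi.norm.add (integrable_const |θ 0|)).mono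
    (hθ.continuous.comp_aestronglyMeasurable hm) (Eventually.of_forall fun y => ?_)
  have h1 := hθ.dist_le_mul (γ.push u y) 0
  simp only [NNReal.coe_one, one_mul, Real.dist_eq, sub_zero] at h1
  simp only [Function.comp_apply, Pi.add_apply, Real.norm_eq_abs]
  refine le_trans ?_ (le_abs_self _)
  have h2 := abs_add_le (θ (γ.push u y) - θ 0) (θ 0)
  rw [sub_add_cancel] at h2
  linarith

variable {φ : Rn m → Rn m}

/-- Integrate by parts and substitute y = γ(x); the Jacobian and the chain rule combine into ‖L_γ
∇v‖. -/
lemma ofReal_abs_integral_push_le (hΩ : IsOpen Ω) (hθ : LipschitzWith 1 θ) {K : ℝ≥0}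
    (hK : LipschitzWith K v) (hv : Differentiable ℝ v) (hφ : IsTest Ω φ) {S : Set (Rn m)}
    (hS : MeasurableSet S) (hSΩ : S ⊆ Ω) (hφS : tsupport φ ⊆ γ.map '' S) :
    ENNReal.ofReal |∫ y in Ω, (θ ∘ γ.push v) y * divergence φ y| ≤
      ∫⁻ x in S, ENNReal.ofReal (‖φ (γ.map x)‖ * (γ.jac x * ‖γ.gradInv x (gradient v x)‖)) := by
  obtain ⟨K', hK'⟩ := γ.exists_lipschitzOnWith_push hθ hK
  rw [(integral_mul_divergence_of_lipschitzOn hΩ hK' hφ).2, abs_neg]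
  have h0 : ∀ y ∈ Ω \ γ.map '' S, inner ℝ (φ y) (gradient (θ ∘ γ.push v) y) = 0 := by
    intro y hy
    rw [image_eq_zero_of_notMem_tsupport (fun h => hy.2 (hφS h)), inner_zero_left]
  rw [setIntegral_eq_of_subset_of_forall_sdiff_eq_zero hΩ.measurableSet
    (γ.image_subset hSΩ) h0]
  refine (ENNReal.ofReal_le_ofReal (abs_integral_le_integral_abs)).trans
    ((ofReal_integral_le_lintegral _ _).trans ?_)
  rw [γ.setLIntegral_image hΩ hS hSΩ]
  refine lintegral_mono_ae ?_
  filter_upwards [ae_restrict_of_ae_restrict_of_subset hSΩ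
    (γ.ae_norm_gradient_push_le hΩ hθ hv)] with x hx
  rw [← ENNReal.ofReal_mul (jac_nonneg x)]
  refine ENNReal.ofReal_le_ofReal ?_
  calc γ.jac x * |inner ℝ (φ (γ.map x)) (gradient (θ ∘ γ.push v) (γ.map x))|
      ≤ γ.jac x * (‖φ (γ.map x)‖ * ‖γ.gradInv x (gradient v x)‖) := by
        refine mul_le_mul_of_nonneg_left ?_ (jac_nonneg x)
        refine (abs_real_inner_le_norm _ _).trans ?_
        gcongr
    _ = _ := by ring

/-- The same substitution, with Young's inequality removing φ. Since c(0) = 0, all integrals reduce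
to S, which can be chosen compact and so leaves room for mollification inside W. -/
lemma ofReal_test_push_le (hΩ : IsOpen Ω) (hvol : volume Ω ≠ ⊤) (hθ : LipschitzWith 1 θ)
    {K : ℝ≥0} (hK : LipschitzWith K v) (hv : Differentiable ℝ v) {ψ : ℝ → ℝ}
    (hψ : IsConvexEnergy ψ) {c p : ℝ → ℝ} (hd : IsDualPair ψ c p (recession ψ))
    {S W : Set (Rn m)} (hS : MeasurableSet S) (hSW : S ⊆ W) (hWΩ : W ⊆ Ω) (hW : MeasurableSet W)
    (hφ : IsTest (γ.map '' W) φ) (hφr : ∀ x, ‖φ x‖ ≤ recession ψ)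
    (hφS : tsupport φ ⊆ γ.map '' S) :
    ENNReal.ofReal (-(∫ y in Ω, (θ ∘ γ.push v) y * divergence φ y)
        - ∫ y in γ.map '' W, c ‖φ y‖) ≤
      ∫⁻ x in S, ENNReal.ofReal (γ.jac x * ψ ‖γ.gradInv x (gradient v x)‖) := by
  obtain ⟨K', hK'⟩ := γ.exists_lipschitzOnWith_push hθ hK
  have hφΩ : IsTest Ω φ := hφ.mono (γ.image_subset hWΩ)
  obtain ⟨hint, hibp⟩ := integral_mul_divergence_of_lipschitzOn hΩ hK' hφΩ
  have hSΩ := hSW.trans hWΩ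
  have hγS := γ.measurableSet_image hS hSΩ
  have hout : ∀ y, y ∉ γ.map '' S → φ y = 0 := fun y hy =>
    image_eq_zero_of_notMem_tsupport (fun h => hy (hφS h))
  have hci : IntegrableOn (fun y => c ‖φ y‖) (γ.map '' S) :=
    hd.integrableOn_conj (ne_top_of_le_ne_top hvol (measure_mono (γ.image_subset hSΩ)))
      hφ.continuous.measurable hφr
  rw [hibp, neg_neg, setIntegral_eq_of_subset_of_forall_sdiff_eq_zero hΩ.measurableSet
      (γ.image_subset hSΩ) (fun y hy => by rw [hout y hy.2, inner_zero_left]),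
    setIntegral_eq_of_subset_of_forall_sdiff_eq_zero (γ.measurableSet_image hW hWΩ)
      (image_mono hSW) (fun y hy => by rw [hout y hy.2, norm_zero, hd.conj_zero]),
    ← integral_sub (IntegrableOn.mono_set hint (γ.image_subset hSΩ)) hci]
  refine (ofReal_integral_le_lintegral _ _).trans ?_
  rw [γ.setLIntegral_image hΩ hS hSΩ]
  refine lintegral_mono_ae ?_
  filter_upwards [ae_restrict_of_ae_restrict_of_subset hSΩ
    (γ.ae_norm_gradient_push_le hΩ hθ hv)] with x hx
  rw [← ENNReal.ofReal_mul (jac_nonneg x)]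
  refine ENNReal.ofReal_le_ofReal (mul_le_mul_of_nonneg_left ?_ (jac_nonneg x))
  have h1 := hd.young _ _ (hφr (γ.map x))
    (norm_nonneg (gradient (θ ∘ γ.push v) (γ.map x)))
  have h2 := real_inner_le_norm (φ (γ.map x)) (gradient (θ ∘ γ.push v) (γ.map x))
  have h3 := hψ.mono (mem_Ici.2 (norm_nonneg _)) (mem_Ici.2 (norm_nonneg _)) hx
  linarith

end BiLipTransf

end Push

end BVReg

namespace BVReg

/-! ### Transformed functions of bounded variation -/

section Push

variable {m : ℕ} {Ω : Set (Rn m)} {θ : ℝ → ℝ} {u : Rn m → ℝ}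

lemma integrable_mollify (ρ : ContDiffBump (0 : Rn m)) (hΩ : MeasurableSet Ω)
    (hb : Bornology.IsBounded Ω) (hu : IntegrableOn u Ω) : Integrable (mollify ρ Ω u) :=
  (contDiff_mollify ρ hΩ hu).continuous.integrable_of_hasCompactSupport
    (hasCompactSupport_mollify ρ hb)

namespace BiLipTransf

variable (γ : BiLipTransf Ω)

lemma tendsto_integral_push (hΩ : IsOpen Ω) (hvol : volume Ω ≠ ⊤) (hθ : LipschitzWith 1 θ) {C : ℝ}
    (hJ : ∀ᵐ x ∂volume.restrict Ω, γ.jac x ≤ C) (hu : IntegrableOn u Ω) {v : ℕ → Rn m → ℝ}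
    (hv : ∀ k, IntegrableOn (v k) Ω) (hlim : Tendsto (fun k => normL1 Ω (v k - u)) atTop (𝓝 0))
    {φ : Rn m → Rn m} (hφ : IsTest Ω φ) :
    Tendsto (fun k => ∫ y in Ω, (θ ∘ γ.push (v k)) y * divergence φ y) atTop
      (𝓝 (∫ y in Ω, (θ ∘ γ.push u) y * divergence φ y)) := by
  obtain ⟨B, hB⟩ := hφ.exists_bound_divergence
  refine tendsto_integral_mul_of_normL1 (fun k => γ.integrableOn_push hΩ hvol hθ hJ (hv k))
    (γ.integrableOn_push hΩ hvol hθ hJ hu) ?_ hφ.continuous_divergence.aestronglyMeasurable hB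
  have h1 : Tendsto (fun k => ENNReal.ofReal C * normL1 Ω (v k - u)) atTop (𝓝 0) := by
    simpa using ENNReal.Tendsto.const_mul hlim (Or.inr ENNReal.ofReal_ne_top)
  exact tendsto_of_tendsto_of_tendsto_of_le_of_le tendsto_const_nhds h1 (fun _ => bot_le)
    fun k => γ.normL1_push_sub_le hΩ hθ hJ

lemma isCompact_preimage {φ : Rn m → Rn m} {W : Set (Rn m)} (hWΩ : W ⊆ Ω)
    (hφ : IsTest (γ.map '' W) φ) :
    IsCompact (γ.inv '' tsupport φ) ∧ γ.inv '' tsupport φ ⊆ W ∧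
      γ.map '' (γ.inv '' tsupport φ) = tsupport φ := by
  have hsub := hφ.tsupport_subset.trans (γ.image_subset hWΩ)
  refine ⟨hφ.hasCompactSupport.isCompact.image_of_continuousOn (γ.continuousOn_inv.mono hsub),
    ?_, ?_⟩
  · rintro _ ⟨y, hy, rfl⟩
    obtain ⟨x, hx, rfl⟩ := hφ.tsupport_subset hy
    rwa [γ.inv_map (hWΩ hx)]
  · rw [image_image]
    exact (image_congr fun y hy => γ.map_inv (hsub hy)).trans (image_id _)

end BiLipTransf

lemma exists_closedBall_subset {S : Set (Rn m)} (hS : IsCompact S) (hΩ : IsOpen Ω) (hSΩ : S ⊆ Ω) :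
    ∃ δ > 0, ∀ x ∈ S, ∀ r < δ, Metric.closedBall x r ⊆ Ω := by
  obtain ⟨δ, hδ, hsub⟩ := hS.exists_cthickening_subset_open hΩ hSΩ
  refine ⟨δ, hδ, fun x hx r hr => ?_⟩
  exact ((Metric.closedBall_subset_closedBall hr.le).trans
    (Metric.closedBall_subset_cthickening hx δ)).trans hsub

/-- Composition with a 1-Lipschitz function and a bi-Lipschitz transformation preserves `BV`. -/
theorem IsBV.push (hu : IsBV Ω u) (hΩ : IsOpen Ω) (hb : Bornology.IsBounded Ω)
    (hθ : LipschitzWith 1 θ) (γ : BiLipTransf Ω) {C : ℝ} (hC : 0 ≤ C)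
    (hJ : ∀ᵐ x ∂volume.restrict Ω, γ.jac x ≤ C)
    (hL : ∀ᵐ x ∂volume.restrict Ω, ∀ v, γ.jac x * ‖γ.gradInv x v‖ ≤ C * ‖v‖) :
    IsBV Ω (θ ∘ γ.push u) := by
  have hvol : volume Ω ≠ ⊤ := hb.measure_lt_top.ne
  have hwi := γ.integrableOn_push hΩ hvol hθ hJ hu.1
  have hγm : AEMeasurable γ.map ((absD Ω u).restrict Ω) :=
    γ.continuousOn.aemeasurable hΩ.measurableSet
  -- The measure that dominates the gradient is C times the image of |Du| under γ.
  set μ : Measure (Rn m) := ENNReal.ofReal C • ((absD Ω u).restrict Ω).map γ.map with hμ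
  have hμf : IsFiniteMeasure μ := Measure.smul_finite _ ENNReal.ofReal_ne_top
  refine isBV_of_abs_le hΩ hwi μ fun φ hφ => ?_
  have hφm : Measurable fun y => ENNReal.ofReal ‖φ y‖ :=
    hφ.continuous.norm.measurable.ennreal_ofReal
  have hφi : Integrable (fun x => ‖φ x‖) μ :=
    (hφ.continuous.integrable_of_hasCompactSupport hφ.hasCompactSupport).norm
  rw [← ENNReal.ofReal_le_ofReal_iff (integral_nonneg fun _ => norm_nonneg _),
    ofReal_integral_eq_lintegral_ofReal hφi (Eventually.of_forall fun _ => norm_nonneg _),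
    hμ, lintegral_smul_measure, lintegral_map' hφm.aemeasurable hγm, smul_eq_mul]
  -- the mollified problem
  obtain ⟨ρ, hρ0, hρ1⟩ := exists_mollify_tendsto hΩ.measurableSet hu.1
  have hφ' : IsTest (γ.map '' Ω) φ := by rwa [γ.image_self]
  obtain ⟨hS, hSΩ, hSφ⟩ := γ.isCompact_preimage subset_rfl hφ'
  set S := γ.inv '' tsupport φ with hSdef
  obtain ⟨δ, hδ, hball⟩ := exists_closedBall_subset hS hΩ hSΩ
  obtain ⟨L₁, hL₁⟩ := ContDiff.lipschitzWith_of_hasCompactSupport hφ.hasCompactSupport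
    (hφ.contDiff.of_le (m := 1) (by exact_mod_cast le_top)) one_ne_zero
  obtain ⟨L₂, hL₂⟩ := γ.lipschitz
  set L : ℝ := L₁ * L₂ with hLdef
  -- Evaluating φ ∘ γ at y instead of x costs L times the mollification radius, which disappears in
  -- the limit.
  have hφL : ∀ x ∈ Ω, ∀ y ∈ Ω, ‖φ (γ.map x)‖ ≤ ‖φ (γ.map y)‖ + L * dist x y := by
    intro x hx y hy
    have h1 := hL₁.dist_le_mul (γ.map x) (γ.map y)
    have h2 := hL₂.dist_le_mul x hx y hy
    have h3 := norm_le_norm_add_norm_sub' (φ (γ.map x)) (φ (γ.map y))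
    rw [dist_eq_norm] at h1
    have h4 : (L₁ : ℝ) * dist (γ.map x) (γ.map y) ≤ L₁ * (L₂ * dist x y) := by gcongr
    rw [← mul_assoc] at h4
    linarith
  set h : Rn m → ℝ≥0∞ := S.indicator fun x => ENNReal.ofReal ‖φ (γ.map x)‖ with hh
  have hhm : Measurable h := by
    have hc : ContinuousOn (fun x => ENNReal.ofReal ‖φ (γ.map x)‖) S :=
      ENNReal.continuous_ofReal.comp_continuousOn
        (hφ.continuous.norm.comp_continuousOn (γ.continuousOn.mono hSΩ))
    classical
    rw [hh, ← piecewise_eq_indicator]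
    exact hc.measurable_piecewise continuousOn_const hS.measurableSet
  have hbound : ∀ᶠ k in atTop,
      ENNReal.ofReal |∫ y in Ω, (θ ∘ γ.push (mollify (ρ k) Ω u)) y * divergence φ y| ≤
        ENNReal.ofReal C * (∫⁻ x in Ω, ENNReal.ofReal ‖φ (γ.map x)‖ ∂(absD Ω u)
          + ENNReal.ofReal (L * (ρ k).rOut) * absD Ω u univ) := by
    filter_upwards [hρ0.eventually_lt_const hδ] with k hk
    obtain ⟨K, hK⟩ := exists_lipschitzWith_mollify (ρ k) hΩ.measurableSet hb hu.1
    refine (γ.ofReal_abs_integral_push_le hΩ hθ hK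
      ((contDiff_mollify (ρ k) hΩ.measurableSet hu.1).differentiable (by simp)) hφ
      hS.measurableSet hSΩ hSφ.ge).trans ?_
    have e1 : ∫⁻ x in S, ENNReal.ofReal (‖φ (γ.map x)‖ * (γ.jac x
          * ‖γ.gradInv x (gradient (mollify (ρ k) Ω u) x)‖)) ≤
        ENNReal.ofReal C * ∫⁻ x in S, h x *
          ∫⁻ y, ENNReal.ofReal ((ρ k).normed volume (x - y)) ∂(absD Ω u) := by
      rw [← lintegral_const_mul' _ _ ENNReal.ofReal_ne_top]
      refine lintegral_mono_ae ?_
      filter_upwards [ae_restrict_of_ae_restrict_of_subset hSΩ hL,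
        ae_restrict_mem hS.measurableSet] with x hx hxS
      rw [ENNReal.ofReal_mul (norm_nonneg _), hh, indicator_of_mem hxS, ← mul_assoc,
        mul_comm (ENNReal.ofReal C), mul_assoc]
      gcongr
      refine (ENNReal.ofReal_le_ofReal (hx _)).trans ?_
      rw [ENNReal.ofReal_mul hC]
      gcongr
      exact hu.norm_gradient_mollify_le hΩ.measurableSet (hball x hxS _ hk)
    refine e1.trans ?_
    gcongr
    refine (setLIntegral_mul_kernel_le (ρ k) hS.measurableSet hhm (h₂ := fun y =>
      Ω.indicator (fun y => ENNReal.ofReal ‖φ (γ.map y)‖) y + ENNReal.ofReal (L * (ρ k).rOut))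
      fun x hx y hxy => ?_).trans ?_
    · have hyΩ : y ∈ Ω := hball x hx _ hk (by
        rw [Metric.mem_closedBall, dist_comm]; exact hxy.le)
      rw [hh, indicator_of_mem hx, indicator_of_mem hyΩ,
        ← ENNReal.ofReal_add (norm_nonneg _) (by have := (ρ k).rOut_pos; positivity)]
      refine ENNReal.ofReal_le_ofReal ((hφL x (hSΩ hx) y hyΩ).trans ?_)
      have : 0 ≤ L := by positivity
      gcongr
    · rw [lintegral_add_right _ measurable_const, lintegral_const,
        lintegral_indicator hΩ.measurableSet]
  have hlim1 := (γ.tendsto_integral_push hΩ hvol hθ hJ hu.1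
    (fun k => (integrable_mollify (ρ k) hΩ.measurableSet hb hu.1).integrableOn) hρ1 hφ).abs
  have hlim2 : Tendsto (fun k => ENNReal.ofReal C *
      (∫⁻ x in Ω, ENNReal.ofReal ‖φ (γ.map x)‖ ∂(absD Ω u)
        + ENNReal.ofReal (L * (ρ k).rOut) * absD Ω u univ)) atTop
      (𝓝 (ENNReal.ofReal C * (∫⁻ x in Ω, ENNReal.ofReal ‖φ (γ.map x)‖ ∂(absD Ω u)
        + 0 * absD Ω u univ))) := by
    refine ENNReal.Tendsto.const_mul (tendsto_const_nhds.add (ENNReal.Tendsto.mul_const ?_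
      (Or.inr (measure_ne_top _ _)))) (Or.inr ENNReal.ofReal_ne_top)
    have : Tendsto (fun k => L * (ρ k).rOut) atTop (𝓝 0) := by simpa using hρ0.const_mul L
    simpa using ENNReal.tendsto_ofReal this
  rw [zero_mul, add_zero] at hlim2
  exact le_of_tendsto_of_tendsto (ENNReal.tendsto_ofReal hlim1) hlim2 hbound

end Push

end BVReg

namespace BVReg

/-! ### Comparison of energies for a pair of transformations -/

section EnergyPush

variable {m : ℕ} {Ω : Set (Rn m)} {θ ψ : ℝ → ℝ} {u : Rn m → ℝ} {γ₁ γ₂ : BiLipTransf Ω}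

/-- Two transformations are comparable for `ψ` up to the error `κ` on `Z`. -/
structure AreComparable (γ₁ γ₂ : BiLipTransf Ω) (ψ : ℝ → ℝ) (κ : ℝ) (Z : Set (Rn m)) : Prop where
  nonneg : 0 ≤ κ
  energy_le : ∀ᵐ x ∂volume.restrict Ω, ∀ g, γ₁.jac x * ψ ‖γ₁.gradInv x g‖
    + γ₂.jac x * ψ ‖γ₂.gradInv x g‖ ≤ 2 * ψ ‖g‖ + κ * Z.indicator (fun _ => ‖g‖) x
  jac_le : ∀ᵐ x ∂volume.restrict Ω, γ₁.jac x ≤ 3 ∧ γ₂.jac x ≤ 3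
  lipJac_le : ∀ᵐ x ∂volume.restrict Ω, ∀ v, γ₁.jac x * ‖γ₁.gradInv x v‖ ≤ 3 * ‖v‖ ∧
    γ₂.jac x * ‖γ₂.gradInv x v‖ ≤ 3 * ‖v‖

variable {κ : ℝ} {Z : Set (Rn m)}

lemma setLIntegral_kernel_le {M : Measure (Rn m)} [SFinite M] (ρ : ContDiffBump (0 : Rn m))
    {S : Set (Rn m)} (hS : MeasurableSet S) :
    ∫⁻ x in S, ∫⁻ y, ENNReal.ofReal (ρ.normed volume (x - y)) ∂M ≤
      M (Metric.cthickening ρ.rOut S) := by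
  have h := setLIntegral_mul_kernel_le ρ (M := M) hS (h := fun _ => 1)
    (h₂ := (Metric.cthickening ρ.rOut S).indicator 1) measurable_const fun x hx y hxy => by
      rw [indicator_of_mem, Pi.one_apply]
      exact Metric.closedBall_subset_cthickening hx _ (by
        rw [Metric.mem_closedBall, dist_comm]; exact hxy.le)
  simp only [one_mul] at h
  rwa [lintegral_indicator_one Metric.isClosed_cthickening.measurableSet] at h

/-- Test fields for the transformed functions are controlled by the energy of `u`. -/
lemma AreComparable.test_le (h : AreComparable γ₁ γ₂ ψ κ Z) (hu : IsBV Ω u) (hΩ : IsOpen Ω)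
    (hb : Bornology.IsBounded Ω) (hθ : LipschitzWith 1 θ) (hψ : IsConvexEnergy ψ)
    (hZ : IsClosed Z) {c p : ℝ → ℝ} (hd : IsDualPair ψ c p (recession ψ)) {W : Set (Rn m)}
    (hW : IsOpen W) (hWΩ : W ⊆ Ω) {φ₁ φ₂ : Rn m → Rn m} (hφ₁ : IsTest (γ₁.map '' W) φ₁)
    (hφ₂ : IsTest (γ₂.map '' W) φ₂) (hr₁ : ∀ x, ‖φ₁ x‖ ≤ recession ψ)
    (hr₂ : ∀ x, ‖φ₂ x‖ ≤ recession ψ) :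
    ENNReal.ofReal (-(∫ y in Ω, (θ ∘ γ₁.push u) y * divergence φ₁ y)
        - ∫ y in γ₁.map '' W, c ‖φ₁ y‖) +
      ENNReal.ofReal (-(∫ y in Ω, (θ ∘ γ₂.push u) y * divergence φ₂ y)
        - ∫ y in γ₂.map '' W, c ‖φ₂ y‖) ≤
      2 * energyMeasure Ω ψ u W + ENNReal.ofReal κ * absD Ω u (W ∩ Z) := by
  have hvol : volume Ω ≠ ⊤ := hb.measure_lt_top.ne
  have hfin := hψ.isFiniteMeasure_energyMeasure (Ω := Ω) (u := u)
  have hJ₁ : ∀ᵐ x ∂volume.restrict Ω, γ₁.jac x ≤ 3 := h.jac_le.mono fun _ hx => hx.1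
  have hJ₂ : ∀ᵐ x ∂volume.restrict Ω, γ₂.jac x ≤ 3 := h.jac_le.mono fun _ hx => hx.2
  obtain ⟨hS₁, hS₁W, hS₁φ⟩ := γ₁.isCompact_preimage hWΩ hφ₁
  obtain ⟨hS₂, hS₂W, hS₂φ⟩ := γ₂.isCompact_preimage hWΩ hφ₂
  -- Both test fields, pulled back, live on this compact subset of W, so for small radii all the
  -- balls involved lie in Ω.
  set S := γ₁.inv '' tsupport φ₁ ∪ γ₂.inv '' tsupport φ₂ with hSdef
  have hS : IsCompact S := hS₁.union hS₂
  have hSW : S ⊆ W := union_subset hS₁W hS₂W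
  have hSΩ := hSW.trans hWΩ
  obtain ⟨ρ, hρ0, hρ1⟩ := exists_mollify_tendsto hΩ.measurableSet hu.1
  obtain ⟨δ, hδ, hball⟩ := exists_closedBall_subset hS hΩ hSΩ
  have hbound : ∀ᶠ k in atTop,
      ENNReal.ofReal (-(∫ y in Ω, (θ ∘ γ₁.push (mollify (ρ k) Ω u)) y * divergence φ₁ y)
        - ∫ y in γ₁.map '' W, c ‖φ₁ y‖) +
      ENNReal.ofReal (-(∫ y in Ω, (θ ∘ γ₂.push (mollify (ρ k) Ω u)) y * divergence φ₂ y)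
        - ∫ y in γ₂.map '' W, c ‖φ₂ y‖) ≤
      2 * energyMeasure Ω ψ u (Metric.cthickening (ρ k).rOut S) +
        ENNReal.ofReal κ * absD Ω u (Metric.cthickening (ρ k).rOut (S ∩ Z)) := by
    filter_upwards [hρ0.eventually_lt_const hδ] with k hk
    obtain ⟨K, hK⟩ := exists_lipschitzWith_mollify (ρ k) hΩ.measurableSet hb hu.1
    have hcd := contDiff_mollify (ρ k) hΩ.measurableSet hu.1
    set v := mollify (ρ k) Ω u with hv
    have hvd : Differentiable ℝ v := hcd.differentiable (by simp)
    have hvm : Measurable (gradient v) :=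
      ((InnerProductSpace.toDual ℝ (Rn m)).symm.continuous.comp
        (hcd.continuous_fderiv (by simp))).measurable
    have t1 := γ₁.ofReal_test_push_le hΩ hvol hθ hK hvd hψ hd hS.measurableSet hSW hWΩ
      hW.measurableSet hφ₁ hr₁ (hS₁φ.ge.trans (image_mono subset_union_left))
    have t2 := γ₂.ofReal_test_push_le hΩ hvol hθ hK hvd hψ hd hS.measurableSet hSW hWΩ
      hW.measurableSet hφ₂ hr₂ (hS₂φ.ge.trans (image_mono subset_union_right))
    refine (add_le_add t1 t2).trans ((le_lintegral_add _ _).trans ?_)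
    have e1 : ∫⁻ x in S, (ENNReal.ofReal (γ₁.jac x * ψ ‖γ₁.gradInv x (gradient v x)‖)
          + ENNReal.ofReal (γ₂.jac x * ψ ‖γ₂.gradInv x (gradient v x)‖)) ≤
        ∫⁻ x in S, (2 * ENNReal.ofReal (ψ ‖gradient v x‖)
          + Z.indicator (fun x => ENNReal.ofReal κ * ENNReal.ofReal ‖gradient v x‖) x) := by
      refine lintegral_mono_ae ?_
      filter_upwards [ae_restrict_of_ae_restrict_of_subset hSΩ h.energy_le] with x hx
      rw [← ENNReal.ofReal_add
        (mul_nonneg (BiLipTransf.jac_nonneg x) (hψ.nonneg (norm_nonneg _)))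
        (mul_nonneg (BiLipTransf.jac_nonneg x) (hψ.nonneg (norm_nonneg _)))]
      refine (ENNReal.ofReal_le_ofReal (hx _)).trans (ENNReal.ofReal_add_le.trans ?_)
      rw [ENNReal.ofReal_mul zero_le_two, ENNReal.ofReal_ofNat, ENNReal.ofReal_mul h.nonneg]
      gcongr
      by_cases hxZ : x ∈ Z <;> simp [hxZ]
    refine e1.trans ?_
    have hmψ : Measurable fun x => 2 * ENNReal.ofReal (ψ ‖gradient v x‖) :=
      (hψ.measurable_energy.comp hvm).ennreal_ofReal.const_mul 2
    rw [lintegral_add_left hmψ, lintegral_const_mul' _ _ (by simp),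
      setLIntegral_indicator hZ.measurableSet, lintegral_const_mul' _ _ ENNReal.ofReal_ne_top,
      inter_comm Z S]
    gcongr
    · refine le_trans ?_ (setLIntegral_kernel_le (ρ k) hS.measurableSet)
      exact setLIntegral_mono' hS.measurableSet fun x hx =>
        hu.energy_gradient_mollify_le hΩ.measurableSet hψ (hball x hx _ hk)
    · refine le_trans ?_ (setLIntegral_kernel_le (ρ k) (hS.inter_right hZ).measurableSet)
      exact setLIntegral_mono' (hS.inter_right hZ).measurableSet fun x hx =>
        hu.norm_gradient_mollify_le hΩ.measurableSet (hball x hx.1 _ hk)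
  have hvi := fun k => (integrable_mollify (ρ k) hΩ.measurableSet hb hu.1).integrableOn (s := Ω)
  have hlim1 := ENNReal.tendsto_ofReal ((γ₁.tendsto_integral_push hΩ hvol hθ hJ₁ hu.1 hvi hρ1
    (hφ₁.mono (γ₁.image_subset hWΩ))).neg.sub_const (∫ y in γ₁.map '' W, c ‖φ₁ y‖))
  have hlim2 := ENNReal.tendsto_ofReal ((γ₂.tendsto_integral_push hΩ hvol hθ hJ₂ hu.1 hvi hρ1
    (hφ₂.mono (γ₂.image_subset hWΩ))).neg.sub_const (∫ y in γ₂.map '' W, c ‖φ₂ y‖))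
  have hlim3 := (tendsto_measure_cthickening_of_isCompact (μ := energyMeasure Ω ψ u) hS).comp hρ0
  have hlim4 := (tendsto_measure_cthickening_of_isCompact (μ := absD Ω u)
    (hS.inter_right hZ)).comp hρ0
  refine (le_of_tendsto_of_tendsto (hlim1.add hlim2)
    ((ENNReal.Tendsto.const_mul hlim3 (Or.inr (by simp))).add
      (ENNReal.Tendsto.const_mul hlim4 (Or.inr ENNReal.ofReal_ne_top))) hbound).trans ?_
  gcongr

lemma AreComparable.isBV_push (h : AreComparable γ₁ γ₂ ψ κ Z) (hu : IsBV Ω u) (hΩ : IsOpen Ω)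
    (hb : Bornology.IsBounded Ω) (hθ : LipschitzWith 1 θ) :
    IsBV Ω (θ ∘ γ₁.push u) ∧ IsBV Ω (θ ∘ γ₂.push u) :=
  ⟨hu.push hΩ hb hθ γ₁ zero_le_three (h.jac_le.mono fun _ hx => hx.1)
      (h.lipJac_le.mono fun _ hx v => (hx v).1),
    hu.push hΩ hb hθ γ₂ zero_le_three (h.jac_le.mono fun _ hx => hx.2)
      (h.lipJac_le.mono fun _ hx v => (hx v).2)⟩

/-- The bound for pairs of test fields survives taking suprema in φ₂ and then in φ₁. Zero fields
show that each term alone is at most M, so that it can be subtracted in `ℝ≥0∞`. -/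
lemma AreComparable.energyMeasure_le_of_isOpen (h : AreComparable γ₁ γ₂ ψ κ Z) (hu : IsBV Ω u)
    (hΩ : IsOpen Ω) (hb : Bornology.IsBounded Ω) (hθ : LipschitzWith 1 θ) (hψ : IsConvexEnergy ψ)
    (hZ : IsClosed Z) {W : Set (Rn m)} (hW : IsOpen W) (hWΩ : W ⊆ Ω) :
    energyMeasure Ω ψ (θ ∘ γ₁.push u) (γ₁.map '' W)
      + energyMeasure Ω ψ (θ ∘ γ₂.push u) (γ₂.map '' W) ≤
      2 * energyMeasure Ω ψ u W + ENNReal.ofReal κ * absD Ω u (W ∩ Z) := by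
  obtain ⟨c, p, hd⟩ := hψ.exists_isDualPair
  obtain ⟨hw₁, hw₂⟩ := h.isBV_push hu hΩ hb hθ
  have hvol : volume Ω ≠ ⊤ := hb.measure_lt_top.ne
  have hfin := hψ.isFiniteMeasure_energyMeasure (Ω := Ω) (u := u)
  have hv : ∀ γ : BiLipTransf Ω, volume (γ.map '' W) ≠ ⊤ := fun γ =>
    ne_top_of_le_ne_top hvol (measure_mono (γ.image_subset hWΩ))
  have key := fun φ₁ φ₂ hφ₁ hφ₂ hr₁ hr₂ => h.test_le hu hΩ hb hθ hψ hZ hd hW hWΩ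
    (φ₁ := φ₁) (φ₂ := φ₂) hφ₁ hφ₂ hr₁ hr₂
  set M := 2 * energyMeasure Ω ψ u W + ENNReal.ofReal κ * absD Ω u (W ∩ Z) with hM
  have hMt : M ≠ ⊤ := by
    have := measure_ne_top (energyMeasure Ω ψ u) W
    have := measure_ne_top (absD Ω u) (W ∩ Z)
    finiteness
  -- one function at a time
  have step : ∀ (γ : BiLipTransf Ω) (w : Rn m → ℝ), IsBV Ω w → ∀ a : ℝ≥0∞, a ≤ M →
      (∀ φ, IsTest (γ.map '' W) φ → (∀ x, ‖φ x‖ ≤ recession ψ) →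
        a + ENNReal.ofReal (-(∫ y in Ω, w y * divergence φ y) - ∫ y in γ.map '' W, c ‖φ y‖) ≤ M) →
      a + energyMeasure Ω ψ w (γ.map '' W) ≤ M := by
    intro γ w hw a haM ha
    have hat : a ≠ ⊤ := ne_top_of_le_ne_top hMt haM
    have h1 : energyMeasure Ω ψ w (γ.map '' W) ≤ ENNReal.ofReal (M - a).toReal := by
      refine hw.energyMeasure_le hψ hd (γ.isOpen_image hΩ hW hWΩ) (γ.image_subset hWΩ) (hv γ)
        fun φ hφ hφr => ?_
      rw [← ENNReal.ofReal_le_iff_le_toReal (ENNReal.sub_ne_top hMt)]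
      exact ENNReal.le_sub_of_add_le_left hat (ha φ hφ hφr)
    rw [ENNReal.ofReal_toReal (ENNReal.sub_ne_top hMt)] at h1
    calc a + energyMeasure Ω ψ w (γ.map '' W) ≤ a + (M - a) := by gcongr
      _ = M := add_tsub_cancel_of_le haM
  have zero_test : IsTest (γ₁.map '' W) (0 : Rn m → Rn m) :=
    ⟨contDiff_const, HasCompactSupport.zero, by simp⟩
  have h2 : ∀ φ₁, IsTest (γ₁.map '' W) φ₁ → (∀ x, ‖φ₁ x‖ ≤ recession ψ) →
      ENNReal.ofReal (-(∫ y in Ω, (θ ∘ γ₁.push u) y * divergence φ₁ y)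
        - ∫ y in γ₁.map '' W, c ‖φ₁ y‖) + energyMeasure Ω ψ (θ ∘ γ₂.push u) (γ₂.map '' W) ≤ M := by
    intro φ₁ hφ₁ hr₁
    refine step γ₂ _ hw₂ _ ?_ fun φ₂ hφ₂ hr₂ => key φ₁ φ₂ hφ₁ hφ₂ hr₁ hr₂
    refine le_self_add.trans (key φ₁ 0 hφ₁ ⟨contDiff_const, HasCompactSupport.zero, by simp⟩ hr₁
      fun x => ?_)
    simpa using hψ.recession_pos.le
  rw [add_comm]
  refine step γ₁ _ hw₁ _ (le_add_self.trans (h2 0 zero_test fun x => ?_)) fun φ₁ hφ₁ hr₁ => ?_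
  · simpa using hψ.recession_pos.le
  · rw [add_comm]
    exact h2 φ₁ hφ₁ hr₁

/-- The energies of the transformed functions, on a Borel set. -/
theorem AreComparable.energyMeasure_le (h : AreComparable γ₁ γ₂ ψ κ Z) (hu : IsBV Ω u)
    (hΩ : IsOpen Ω) (hb : Bornology.IsBounded Ω) (hθ : LipschitzWith 1 θ) (hψ : IsConvexEnergy ψ)
    (hZ : IsClosed Z) {B : Set (Rn m)} (hBΩ : B ⊆ Ω) :
    energyMeasure Ω ψ (θ ∘ γ₁.push u) (γ₁.map '' B)
      + energyMeasure Ω ψ (θ ∘ γ₂.push u) (γ₂.map '' B) ≤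
      2 * energyMeasure Ω ψ u B + ENNReal.ofReal κ * absD Ω u (B ∩ Z) := by
  have hfin := hψ.isFiniteMeasure_energyMeasure (Ω := Ω) (u := u)
  set N : Measure (Rn m) := (2 : ℝ≥0∞) • energyMeasure Ω ψ u
    + ENNReal.ofReal κ • (absD Ω u).restrict Z with hN
  have hNf : IsFiniteMeasure N := by
    have h1 : IsFiniteMeasure ((2 : ℝ≥0∞) • energyMeasure Ω ψ u) :=
      Measure.smul_finite _ (by simp)
    have h2 : IsFiniteMeasure (ENNReal.ofReal κ • (absD Ω u).restrict Z) :=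
      Measure.smul_finite _ ENNReal.ofReal_ne_top
    rw [hN]
    infer_instance
  have hNB : ∀ E, N E = 2 * energyMeasure Ω ψ u E + ENNReal.ofReal κ * absD Ω u (E ∩ Z) := by
    intro E
    rw [hN, Measure.add_apply, Measure.smul_apply, Measure.smul_apply,
      Measure.restrict_apply' hZ.measurableSet, smul_eq_mul, smul_eq_mul]
  rw [← hNB]
  refine ENNReal.le_of_forall_pos_le_add fun ε hε _ => ?_
  -- The right-hand side is a finite measure of B, so outer regularity reduces the claim to open
  -- sets.
  obtain ⟨W, hBW, hW, hWN⟩ := B.exists_isOpen_le_add N (ENNReal.coe_pos.2 hε).ne'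
  refine le_trans ?_ hWN
  have hBW' : B ⊆ W ∩ Ω := subset_inter hBW hBΩ
  calc _ ≤ energyMeasure Ω ψ (θ ∘ γ₁.push u) (γ₁.map '' (W ∩ Ω))
        + energyMeasure Ω ψ (θ ∘ γ₂.push u) (γ₂.map '' (W ∩ Ω)) := by gcongr
    _ ≤ N (W ∩ Ω) := by
        rw [hNB]
        exact h.energyMeasure_le_of_isOpen hu hΩ hb hθ hψ hZ (hW.inter hΩ) inter_subset_right
    _ ≤ N W := measure_mono inter_subset_left

end EnergyPush

end BVReg

namespace BVReg

/-! ### Lipschitz graphs are Borel null sets -/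

section Graph

variable {m : ℕ} {Γ : Set (Rn m)}

/-- A continuous injective image of a Borel set; the inner product with z recovers g(v), and then v.
-/
lemma IsLipschitzGraph.measurableSet (h : IsLipschitzGraph Γ) : MeasurableSet Γ := by
  obtain ⟨z, hz, V, K, g, hV, hg, rfl⟩ := h
  refine hV.measurableSet.image_of_continuousOn_injOn ?_ ?_
  · exact continuous_subtype_val.continuousOn.add (hg.continuousOn.smul continuousOn_const)
  · intro v _ w _ hvw
    have hin : ∀ x : (ℝ ∙ z)ᗮ, inner ℝ z (x : Rn m) = 0 := fun x =>
      Submodule.mem_orthogonal_singleton_iff_inner_right.1 x.2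
    have h1 := congrArg (inner ℝ z) hvw
    simp only [inner_add_right, hin, inner_smul_right, real_inner_self_eq_norm_sq, hz] at h1
    have h2 : g v = g w := by simpa using h1
    simp only [h2, add_left_inj] at hvw
    exact Subtype.ext hvw

/-- A Lipschitz image of a subset of z^⊥ has Hausdorff dimension at most m - 1. -/
lemma IsLipschitzGraph.volume_eq_zero (h : IsLipschitzGraph Γ) : volume Γ = 0 := by
  obtain ⟨z, hz, V, K, g, hV, hg, rfl⟩ := h
  rw [volume_eq_zero_iff_hausdorffMeasure]
  have hz0 : z ≠ 0 := fun h0 => by simp [h0] at hz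
  have hL : LipschitzOnWith (1 + K * ‖z‖₊) (fun v : (ℝ ∙ z)ᗮ => (v : Rn m) + g v • z) V := by
    refine (LipschitzWith.subtype_val _).lipschitzOnWith.add ?_
    refine LipschitzOnWith.of_dist_le_mul fun x hx y hy => ?_
    rw [dist_eq_norm, ← sub_smul, norm_smul, ← dist_eq_norm, NNReal.coe_mul, coe_nnnorm,
      mul_right_comm]
    exact mul_le_mul_of_nonneg_right (hg.dist_le_mul x hx y hy) (norm_nonneg _)
  have hdim : dimH ((fun v : (ℝ ∙ z)ᗮ => (v : Rn m) + g v • z) '' V) < (m : ℝ≥0) := by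
    refine (hL.dimH_image_le.trans (dimH_mono (subset_univ V))).trans_lt ?_
    rw [Real.dimH_univ_eq_finrank]
    have h1 := Submodule.finrank_add_finrank_orthogonal (𝕜 := ℝ) (ℝ ∙ z)
    rw [finrank_span_singleton hz0, finrank_euclideanSpace_fin] at h1
    exact_mod_cast (by omega : Module.finrank ℝ (ℝ ∙ z)ᗮ < m)
  have h := hausdorffMeasure_of_dimH_lt hdim
  rwa [NNReal.coe_natCast] at h

end Graph

/-! ### Double-Lipschitz comparability of the energy -/

section Comparability

variable {m : ℕ} {Ω : Set (Rn m)} {ψ : ℝ → ℝ}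

/-- On the closure of U this is the comparison of numbers; elsewhere both transformations are
locally the identity and there is no error. T < 1 bounds J and G by 1, which gives the constants 3.
-/
lemma IsConvexEnergy.exists_areComparable (hψ : IsConvexEnergy ψ) (hΩ : IsOpen Ω) :
    ∃ R : ℝ, 0 ≤ R ∧ ∀ (U : Set (Rn m)) (γ₁ γ₂ : BiLipTransf Ω), γ₁.IsIdOff U → γ₂.IsIdOff U →
      γ₁.compT γ₂ < 1 → AreComparable γ₁ γ₂ ψ (R * (γ₁.compT γ₂).toReal) (closure U) := by
  obtain ⟨R, hR, hcmp⟩ := hψ.exists_comparison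
  refine ⟨R, hR, fun U γ₁ γ₂ h₁ h₂ hT => ?_⟩
  have hpt := BiLipTransf.ae_pointwiseBounds hT
  have hlt := BiLipTransf.toReal_compT_lt_one hT
  have hTeq := BiLipTransf.toReal_compT hT
  set G := (γ₁.compG γ₂).toReal with hG
  set J := (γ₁.compJ γ₂).toReal with hJ
  set D₁ := γ₁.distId.toReal with hD₁
  set D₂ := γ₂.distId.toReal with hD₂
  have hG0 : 0 ≤ G := ENNReal.toReal_nonneg
  have hJ0 : 0 ≤ J := ENNReal.toReal_nonneg
  have hD₁0 := sq_nonneg D₁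
  have hD₂0 := sq_nonneg D₂
  have hj : ∀ (γ : BiLipTransf Ω) x, 0 ≤ γ.jac x := fun γ x => BiLipTransf.jac_nonneg x
  refine ⟨mul_nonneg hR ENNReal.toReal_nonneg, ?_, ?_, ?_⟩
  · filter_upwards [hpt, ae_restrict_mem hΩ.measurableSet] with x hx hxΩ g
    by_cases hxU : x ∈ closure U
    · rw [indicator_of_mem hxU, hTeq]
      exact hcmp ‖g‖ _ _ _ _ G J D₁ D₂ (norm_nonneg _) (norm_nonneg _) (norm_nonneg _)
        (hj _ _) (hj _ _) hG0 (hTeq ▸ hlt) (hx.norm_le g) hx.jac_le (hx.fst_le g) (hx.snd_le g)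
    · rw [γ₁.jac_of_isIdOff hΩ h₁ ⟨hxΩ, hxU⟩, γ₂.jac_of_isIdOff hΩ h₂ ⟨hxΩ, hxU⟩,
        γ₁.gradInv_of_isIdOff hΩ h₁ ⟨hxΩ, hxU⟩, γ₂.gradInv_of_isIdOff hΩ h₂ ⟨hxΩ, hxU⟩,
        indicator_of_notMem hxU]
      simp only [ContinuousLinearMap.id_apply]
      linarith
  · filter_upwards [hpt] with x hx
    have := (abs_le.1 hx.jac_le).2
    have := hj γ₁ x
    have := hj γ₂ x
    constructor <;> linarith
  · filter_upwards [hpt] with x hx v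
    have h1 := hx.norm_le v
    have h2 := mul_nonneg (hj γ₁ x) (norm_nonneg (γ₁.gradInv x v))
    have h3 := mul_nonneg (hj γ₂ x) (norm_nonneg (γ₂.gradInv x v))
    have h4 : (2 + G) * ‖v‖ ≤ 3 * ‖v‖ := by
      refine mul_le_mul_of_nonneg_right ?_ (norm_nonneg _)
      linarith
    constructor <;> linarith

lemma IsBV.TV_ne_top {u : Rn m → ℝ} (h : IsBV Ω u) (hΩ : IsOpen Ω) (hψ : IsConvexEnergy ψ) :
    TV Ω ψ u ≠ ⊤ := by
  have := hψ.isFiniteMeasure_energyMeasure (Ω := Ω) (u := u)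
  rw [h.TV_eq hΩ]
  exact measure_ne_top _ _

/-- Comparison of the energies on a Borel set, for real numbers. -/
lemma AreComparable.real_energyMeasure_le {u : Rn m → ℝ} {γ₁ γ₂ : BiLipTransf Ω} {κ : ℝ}
    {Z : Set (Rn m)} (h : AreComparable γ₁ γ₂ ψ κ Z) (hu : IsBV Ω u) (hΩ : IsOpen Ω)
    (hb : Bornology.IsBounded Ω) (hψ : IsConvexEnergy ψ) (hZ : IsClosed Z) {B : Set (Rn m)}
    (hBΩ : B ⊆ Ω) :
    (energyMeasure Ω ψ (γ₁.push u)).real (γ₁.map '' B)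
      + (energyMeasure Ω ψ (γ₂.push u)).real (γ₂.map '' B) ≤
      2 * (energyMeasure Ω ψ u).real B + κ * (absD Ω u).real (B ∩ Z) := by
  have hfin := fun w => hψ.isFiniteMeasure_energyMeasure (Ω := Ω) (u := w)
  have h1 := h.energyMeasure_le hu hΩ hb LipschitzWith.id hψ hZ hBΩ
  simp only [Function.id_comp] at h1
  have h2 := ENNReal.toReal_mono (by finiteness) h1
  rw [ENNReal.toReal_add (measure_ne_top _ _) (measure_ne_top _ _),
    ENNReal.toReal_add (by finiteness) (by finiteness), ENNReal.toReal_mul, ENNReal.toReal_mul,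
    ENNReal.toReal_ofReal h.nonneg, ENNReal.toReal_ofNat] at h2
  exact h2

theorem isDoubleLipschitzComparable_TV (hψ : IsConvexEnergy ψ) (hΩ : IsOpen Ω)
    (hb : Bornology.IsBounded Ω) : IsDoubleLipschitzComparable Ω (TV Ω ψ) := by
  obtain ⟨R, hR, hcmp⟩ := hψ.exists_areComparable hΩ
  refine ⟨R, hR, fun u hu U hU hUΩ γ₁ γ₂ h₁ h₂ hT => ?_⟩
  have hc := hcmp U γ₁ γ₂ h₁ h₂ hT
  obtain ⟨hw₁, hw₂⟩ := hc.isBV_push hu hΩ hb LipschitzWith.id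
  rw [Function.id_comp] at hw₁ hw₂
  refine ⟨⟨hu.TV_ne_top hΩ hψ, hw₁.TV_ne_top hΩ hψ, hw₂.TV_ne_top hΩ hψ⟩, ?_⟩
  have h1 := hc.real_energyMeasure_le hu hΩ hb hψ isClosed_closure subset_rfl
  rw [γ₁.image_self, γ₂.image_self] at h1
  rw [hu.TV_eq hΩ, hw₁.TV_eq hΩ, hw₂.TV_eq hΩ]
  have h2 : (absD Ω u).real (Ω ∩ closure U) ≤ (absD Ω u).real (closure U) :=
    measureReal_mono inter_subset_right
  have h3 := mul_le_mul_of_nonneg_left h2 hc.nonneg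
  simp only [Measure.real] at h1 h3 ⊢
  linarith

/-- Split each energy along Γ or its image. The parts on these null sets are exactly ψ^∞ times the
total variation measure and form the second term; only Ω ∖ Γ has to be estimated. -/
theorem isSeparablyDoubleLipschitzComparable_TV (hψ : IsConvexEnergy ψ) (hΩ : IsOpen Ω)
    (hb : Bornology.IsBounded Ω) : IsSeparablyDoubleLipschitzComparable Ω (TV Ω ψ) := by
  obtain ⟨R, hR, hcmp⟩ := hψ.exists_areComparable hΩ
  refine ⟨R, BVReg.recession ψ, hR, hψ.recession_pos.le,
    fun u hu U hU hUΩ γ₁ γ₂ h₁ h₂ hT Γ hΓ => ?_⟩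
  have hc := hcmp U γ₁ γ₂ h₁ h₂ hT
  obtain ⟨hw₁, hw₂⟩ := hc.isBV_push hu hΩ hb LipschitzWith.id
  rw [Function.id_comp] at hw₁ hw₂
  refine ⟨⟨hu.TV_ne_top hΩ hψ, hw₁.TV_ne_top hΩ hψ, hw₂.TV_ne_top hΩ hψ⟩, ?_⟩
  have hfin := fun w => hψ.isFiniteMeasure_energyMeasure (Ω := Ω) (u := w)
  have hΓΩm : MeasurableSet (Γ ∩ Ω) := hΓ.measurableSet.inter hΩ.measurableSet
  have hΓΩ0 : volume (Γ ∩ Ω) = 0 := measure_mono_null inter_subset_left hΓ.volume_eq_zero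
  have hBm : MeasurableSet (Ω \ Γ) := hΩ.measurableSet.diff hΓ.measurableSet
  have hunion : (Ω \ Γ) ∪ (Γ ∩ Ω) = Ω := by rw [inter_comm, union_comm, inter_union_sdiff]
  have hsplit : ∀ (γ : BiLipTransf Ω) (w : Rn m → ℝ), IsBV Ω w → (TV Ω ψ w).toReal =
      (energyMeasure Ω ψ w).real (γ.map '' (Ω \ Γ))
        + BVReg.recession ψ * (absD Ω w).real (γ.map '' (Γ ∩ Ω)) := by
    intro γ w hw
    have hm := γ.measurableSet_image hΓΩm inter_subset_right
    have hdisj : Disjoint (γ.map '' (Ω \ Γ)) (γ.map '' (Γ ∩ Ω)) := by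
      rw [disjoint_iff_inter_eq_empty, ← γ.injOn.image_inter sdiff_subset inter_subset_right,
        (disjoint_sdiff_left.mono_right inter_subset_left).inter_eq, image_empty]
    have h1 := measureReal_union (μ := energyMeasure Ω ψ w) hdisj hm
    rw [← image_union, hunion, γ.image_self] at h1
    rw [hw.TV_eq hΩ, ← Measure.real, h1]
    congr 1
    rw [Measure.real, energyMeasure_of_null hm (γ.image_subset inter_subset_right)
      (γ.volume_image_eq_zero inter_subset_right hΓΩ0), ENNReal.toReal_mul,
      ENNReal.toReal_ofReal hψ.recession_pos.le, Measure.real]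
  have hu' : (TV Ω ψ u).toReal = (energyMeasure Ω ψ u).real (Ω \ Γ)
      + BVReg.recession ψ * (absD Ω u).real Γ := by
    have h1 := measureReal_union (μ := energyMeasure Ω ψ u)
      (disjoint_sdiff_left.mono_right inter_subset_left : Disjoint (Ω \ Γ) (Γ ∩ Ω)) hΓΩm
    rw [hunion] at h1
    rw [hu.TV_eq hΩ, ← Measure.real, h1]
    congr 1
    have h2 : absD Ω u (Γ ∩ Ω) = absD Ω u Γ := measure_inter_conull hu.isDistribGradient.1
    rw [Measure.real, energyMeasure_of_null hΓΩm inter_subset_right hΓΩ0, ENNReal.toReal_mul,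
      ENNReal.toReal_ofReal hψ.recession_pos.le, h2, Measure.real]
  have h1 := hc.real_energyMeasure_le hu hΩ hb hψ isClosed_closure (sdiff_subset : Ω \ Γ ⊆ Ω)
  have h2 : (absD Ω u).real (Ω \ Γ ∩ closure U) ≤ (absD Ω u).real (closure U \ Γ) :=
    measureReal_mono fun x hx => ⟨hx.2, hx.1.2⟩
  have h3 := mul_le_mul_of_nonneg_left h2 hc.nonneg
  rw [hsplit γ₁ _ hw₁, hsplit γ₂ _ hw₂, hu']
  linarith

end Comparability

/-! ### Truncation and boundedness of minimisers -/

section Boundedness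

variable {m : ℕ} {Ω : Set (Rn m)} {ψ θ : ℝ → ℝ} {u f : Rn m → ℝ} {φ : ℝ → ℝ≥0∞}

/-- The identity transformation. -/
def BiLipTransf.refl (Ω : Set (Rn m)) : BiLipTransf Ω :=
  ⟨id, id, mapsTo_id _, mapsTo_id _, ⟨fun _ _ => rfl, fun _ _ => rfl⟩,
    ⟨1, LipschitzWith.id.lipschitzOnWith⟩, ⟨1, LipschitzWith.id.lipschitzOnWith⟩⟩

/-- With two copies of the identity and no error, the comparison theorem says that left composition
with θ does not increase the energy. -/
lemma areComparable_refl : AreComparable (BiLipTransf.refl Ω) (BiLipTransf.refl Ω) ψ 0 ∅ := by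
  have h1 : ∀ x, (BiLipTransf.refl Ω).jac x = 1 := fun x => by
    change |(fderiv ℝ id x).det| = 1
    rw [fderiv_id]
    simp [ContinuousLinearMap.det]
  have h2 : ∀ x, (BiLipTransf.refl Ω).gradInv x = ContinuousLinearMap.id ℝ (Rn m) := fun x => by
    change ContinuousLinearMap.adjoint (fderiv ℝ id _) = _
    rw [fderiv_id, ContinuousLinearMap.adjoint_id]
  refine ⟨le_rfl, Eventually.of_forall fun x g => ?_, Eventually.of_forall fun x => ?_,
    Eventually.of_forall fun x v => ?_⟩
  · rw [h1, h2, ContinuousLinearMap.id_apply]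
    linarith
  · rw [h1]
    norm_num
  · rw [h1, h2, ContinuousLinearMap.id_apply]
    have := norm_nonneg v
    constructor <;> linarith

/-- The energy decreases under composition with 1-Lipschitz functions. -/
theorem IsBV.TV_comp_le (hu : IsBV Ω u) (hΩ : IsOpen Ω) (hb : Bornology.IsBounded Ω)
    (hθ : LipschitzWith 1 θ) (hψ : IsConvexEnergy ψ) :
    IsBV Ω (θ ∘ u) ∧ TV Ω ψ (θ ∘ u) ≤ TV Ω ψ u := by
  have hc : AreComparable (BiLipTransf.refl Ω) (BiLipTransf.refl Ω) ψ 0 ∅ := areComparable_refl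
  have hw : IsBV Ω (θ ∘ u) := (hc.isBV_push hu hΩ hb hθ).1
  refine ⟨hw, ?_⟩
  have h1 := hc.energyMeasure_le hu hΩ hb hθ hψ isClosed_empty subset_rfl
  rw [(BiLipTransf.refl Ω).image_self, ENNReal.ofReal_zero, zero_mul, add_zero, ← two_mul] at h1
  rw [hw.TV_eq hΩ, hu.TV_eq hΩ]
  exact (ENNReal.mul_le_mul_iff_right (by simp) (by simp)).1 h1

/-- By evenness and convexity with φ(0) = 0, φ(s) ≤ (|s|/|t|) φ(t), and φ(t) is positive and finite.
-/
lemma IsAdmissibleFidelity.lt_of_abs_lt (hφ : IsAdmissibleFidelity Ω φ)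
    (hpos : ∀ t, t ≠ 0 → φ t ≠ 0) {s t : ℝ} (hst : |s| < |t|) (ht : φ t ≠ ⊤) : φ s < φ t := by
  have habs : ∀ t, φ |t| = φ t := fun t => by
    rcases abs_choice t with h | h
    · rw [h]
    · rw [h, hφ.even]
  have ht0 : 0 < |t| := (abs_nonneg s).trans_lt hst
  rw [← habs s, ← habs t]
  rw [← habs t] at ht
  have h1 : |s| / |t| < 1 := (div_lt_one ht0).2 hst
  have h2 := hφ.convex |t| 0 (|s| / |t|) (1 - |s| / |t|) (by positivity) (by linarith) (by ring)
  rw [mul_zero, add_zero, div_mul_cancel₀ _ ht0.ne', hφ.zero, mul_zero, add_zero] at h2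
  refine h2.trans_lt ?_
  calc ENNReal.ofReal (|s| / |t|) * φ |t| < 1 * φ |t| := by
        refine ENNReal.mul_lt_mul_left (hpos _ ht0.ne') ht ?_
        exact ENNReal.ofReal_lt_one.2 h1
    _ = φ |t| := one_mul _

/-- Truncate u at M = ‖f‖_∞. The energy does not increase, and wherever |u| > M the truncated value
is strictly closer to f. Minimality therefore forces equal fidelities almost everywhere, so |u| > M
only on a null set. -/
theorem IsSolution.eLpNorm_le (h : IsSolution Ω (TV Ω ψ) φ f u) (hΩ : IsOpen Ω)
    (hb : Bornology.IsBounded Ω) (hψ : IsConvexEnergy ψ) (hφ : IsAdmissibleFidelity Ω φ)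
    (hpos : ∀ t, t ≠ 0 → φ t ≠ 0) (hf : IntegrableOn f Ω) :
    eLpNorm u ∞ (volume.restrict Ω) ≤ eLpNorm f ∞ (volume.restrict Ω) := by
  obtain ⟨hui, hfin, hmin⟩ := h
  rcases eq_or_ne (eLpNorm f ∞ (volume.restrict Ω)) ⊤ with h | hM
  · rw [h]; exact le_top
  set M := (eLpNorm f ∞ (volume.restrict Ω)).toReal with hMdef
  have hM0 : 0 ≤ M := ENNReal.toReal_nonneg
  have hfM : ∀ᵐ x ∂volume.restrict Ω, |f x| ≤ M := by
    have h1 := enorm_ae_le_eLpNormEssSup f (volume.restrict Ω)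
    filter_upwards [h1] with x hx
    rw [← eLpNorm_exponent_top] at hx
    have := ENNReal.toReal_mono hM hx
    rwa [toReal_enorm] at this
  set θ : ℝ → ℝ := fun t => max (-M) (min M t) with hθdef
  have hθ : LipschitzWith 1 θ := (LipschitzWith.id.const_min M).const_max (-M)
  obtain ⟨hint, hTV⟩ := ENNReal.add_ne_top.1 hfin
  have hu : IsBV Ω u := by
    by_contra h0
    exact hTV (TV_of_not_isBV h0)
  obtain ⟨hw, hle⟩ := hu.TV_comp_le hΩ hb hθ hψ
  have hge : ∫⁻ x in Ω, φ (f x - u x) ≤ ∫⁻ x in Ω, φ (f x - (θ ∘ u) x) := by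
    refine (ENNReal.add_le_add_iff_right hTV).1 ((hmin _ hw.1).trans ?_)
    rw [objective]
    gcongr
  have hφm : Measurable φ := hφ.lsc.measurable
  have hgm : AEMeasurable (fun x => φ (f x - u x)) (volume.restrict Ω) :=
    hφm.comp_aemeasurable (hf.aemeasurable.sub hui.aemeasurable)
  have hcases : ∀ {a b : ℝ}, |a| ≤ M → ¬ |b| ≤ M → |a - θ b| < |a - b| := by
    intro a b ha hb'
    obtain ⟨ha1, ha2⟩ := abs_le.1 ha
    rcases le_or_gt b M with h1 | h1
    · have h2 : b < -M := by
        by_contra h2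
        exact hb' (abs_le.2 ⟨not_lt.1 h2, h1⟩)
      have e : θ b = -M := by rw [hθdef]; simp [min_eq_right h1, h2.le]
      rw [e, abs_of_nonneg (by linarith), abs_of_nonneg (by linarith)]
      linarith
    · have e : θ b = M := by
        rw [hθdef]
        simp only [min_eq_left h1.le]
        exact max_eq_right (by linarith)
      rw [e, abs_of_nonpos (by linarith), abs_of_nonpos (by linarith)]
      linarith
  have hfix : ∀ {b : ℝ}, |b| ≤ M → θ b = b := fun hb' => by
    obtain ⟨h1, h2⟩ := abs_le.1 hb'
    rw [hθdef]
    simp [min_eq_right h2, h1]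
  have hmono : ∀ᵐ x ∂volume.restrict Ω, φ (f x - (θ ∘ u) x) ≤ φ (f x - u x) := by
    filter_upwards [hfM] with x hx
    by_cases hux : |u x| ≤ M
    · rw [Function.comp_apply, hfix hux]
    · rcases eq_or_ne (φ (f x - u x)) ⊤ with h0 | h0
      · rw [h0]; exact le_top
      · exact (hφ.lt_of_abs_lt hpos (hcases hx hux) h0).le
  -- Pointwise the truncated fidelity is smaller, by minimality its integral is not; both are
  -- finite, so the integrands agree.
  have heq := ae_eq_of_ae_le_of_lintegral_le hmono
    (ne_top_of_le_ne_top hint (lintegral_mono_ae hmono)) hgm hge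
  rw [eLpNorm_exponent_top, ← ENNReal.ofReal_toReal hM, ← hMdef]
  refine eLpNormEssSup_le_of_ae_bound ?_
  filter_upwards [hfM, heq, ae_lt_top' hgm hint] with x hx hxe hxt
  by_contra hux
  exact (hφ.lt_of_abs_lt hpos (hcases hx hux) hxt.ne).ne hxe

end Boundedness

end BVReg

theorem proposition4p7 (m : ℕ) (hm : 2 ≤ m) :
    (∀ η : ℝ, 0 < η → IsConvexEnergy (huber η)) ∧
    ∀ Ω : Set (Rn m), IsBoundedLipschitzDomain Ω →
    ∀ ψ : ℝ → ℝ, IsConvexEnergy ψ →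
      IsAdmissible Ω (TV Ω ψ) ∧
      IsDoubleLipschitzComparable Ω (TV Ω ψ) ∧
      IsSeparablyDoubleLipschitzComparable Ω (TV Ω ψ) ∧
      ∀ φ : ℝ → ℝ≥0∞, IsAdmissibleFidelity Ω φ → (∀ t, t ≠ 0 → φ t ≠ 0) →
      ∀ f u : Rn m → ℝ, IntegrableOn f Ω → IsSolution Ω (TV Ω ψ) φ f u →
        eLpNorm u ∞ (volume.restrict Ω) ≤ eLpNorm f ∞ (volume.restrict Ω) := by
  refine ⟨fun η hη => isConvexEnergy_huber hη, fun Ω hΩ ψ hψ => ?_⟩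
  exact ⟨isAdmissible_TV hψ hΩ.isOpen hΩ.isBounded.measure_lt_top.ne,
    isDoubleLipschitzComparable_TV hψ hΩ.isOpen hΩ.isBounded,
    isSeparablyDoubleLipschitzComparable_TV hψ hΩ.isOpen hΩ.isBounded,
    fun φ hφ hpos f u hf hu => hu.eLpNorm_le hΩ.isOpen hΩ.isBounded hψ hφ hpos hf⟩
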